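/- Let $V$ be a set and let $L$ be an abstract simplicial complex with vertices in $V$, i.e. a non-empty set of finite subsets of $V$ that is closed under passing to subsets (so $\emptyset\in L$ is the unique $(-1)$-simplex; the vertex set of $L$ may be smaller than $V$, infinite, or empty). Let $\mathbb{T}=\mathbb{R}/\mathbb{Z}$, let $T(V)=\bigoplus_{v\in V}\mathbb{T}$, and let $T_L=\bigcup_{\sigma\in L}T(\sigma)\subseteq T(V)$, with its CW topology (the weak topology with respect to the finite-dimensional tori $T(\sigma)$, $\sigma\in L$). Let $\mu_L:T_L\to\mathbb{T}$ be the map given by adding all the coordinates, and let $\widetilde T_L=\{(x,t)\in T_L\times\mathbb{R}: \mu_L(x)=t+\mathbb{Z}\}$ be the infinite cyclic cover of $T_L$ obtained by pulling back the universal cover $\mathbb{R}\to\mathbb{T}$. The infinite cyclic group $Z\cong\mathbb{Z}$ acts on $\widetilde T_L$ by deck transformations $(x,t)\mapsto(x,t+k)$, and hence on the (singular) homology of $\widetilde T_L$. Let $R$ be a ring and let $A$ be a left $R$-module. (For $R=\mathbb{Z}$, $A$ is an arbitrary abelian group; for ring coefficients take $A=R$.) Let $C^+_*(L;A)$ be the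 augmented simplicial chain complex of $L$ (simplices being oriented by any fixed total order on $V$), starting in degree $-1$, let $Z^+_*(L;A)$ and $B^+_*(L;A)$ be its cycles and boundaries, regarded as modules with trivial $Z$-action, and let $\overline H_*(L;A)=Z^+_*(L;A)/B^+_*(L;A)$ be the reduced homology of $L$. On $\mathbb{Z}[Z]\otimes_{\mathbb{Z}}\overline H_*(L;A)$ let $Z$ act by multiplication on $\mathbb{Z}[Z]$ and $R$ act through $\overline H_*(L;A)$. Then for every $n\ge 0$: 1. There is a short exact sequence of $R[Z]$-modules $$0\to B^+_{n-1}(L;A)\to H_n(\widetilde T_L;A)\to \mathbb{Z}[Z]\otimes\overline H_{n-1}(L;A)\to 0$$ in which the image of $B^+_{n-1}(L;A)$ is exactly the set of $Z$-fixed points of $H_n(\widetilde T_L;A)$. If $\overline H_{n-1}(L;A)$ is a projective $R$-module, this sequence splits as a sequence of $R[Z]$-modules. 2. There is a short exact sequence of $R[Z]$-modules $$0\to \mathbb{Z}[Z]\otimes\overline H_{n-1}(L;A)\to H_n(\widetilde T_L;A)\to Z^+_{n-1}(L;A)\to 0$$ in which the second map is the projection of $H_n(\widetilde T_L;A)$ onto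 its largest $Z$-invariant quotient, i.e. its kernel is the $R$-submodule generated by all elements $zh-h$ with $z\in Z$ and $h\in H_n(\widetilde T_L;A)$. This sequence always splits as a sequence of $R$-modules. -/

import Mathlib

open CategoryTheory
open scoped TensorProduct

universe u v

noncomputable section

/-- An abstract simplicial complex with vertices in `V`: a non-empty set of finite sets, closed
under inclusion.  The empty set is always a member, the unique simplex of dimension `-1`; the empty
simplicial complex is the one whose only member is the empty set. Not every element of `V` has to
be a vertex. -/
structure FiniteSetComplex (V : Type u) where
  faces : Set (Finset V)
  nonempty_faces : faces.Nonempty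
  down_closed : ∀ {σ τ : Finset V}, σ ∈ faces → τ ⊆ σ → τ ∈ faces

namespace FiniteSetComplex

variable {V : Type u}

/-! ### The complex `T_L` and its infinite cyclic cover -/

/-- The circle group is `ℝ / ℤ`, written additively, so that the direct sum `T(V)` of copies of the
circle indexed by `V` is `V →₀ ℝ / ℤ`.  For a finite set `σ`, the subtorus `T(σ)` consists of the
points supported in `σ`, and `T_L` is the union of the `T(σ)` over the simplices `σ` of `L`. -/
def TorusComplex (L : FiniteSetComplex V) : Type u :=
  {x : V →₀ UnitAddCircle // ∃ σ ∈ L.faces, x.support ⊆ σ}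

/-- The inclusion in `T_L` of the finite dimensional torus `T(σ)` of a simplex `σ`
(extension of a vector by the identity element of the circle). -/
def torusInclusion (L : FiniteSetComplex V) (σ : L.faces) (x : σ.1 → UnitAddCircle) :
    L.TorusComplex :=
  ⟨(Finsupp.equivFunOnFinite.symm x).embDomain (Function.Embedding.subtype (· ∈ σ.1)),
    σ.1, σ.2, by
      intro v hv
      rw [Finsupp.support_embDomain, Finset.mem_map] at hv
      obtain ⟨w, -, rfl⟩ := hv
      exact w.2⟩

/-- The CW topology of `T_L`: the weak topology with respect to the closed cells, that is, to the
finite dimensional tori `T(σ)` (with the product topology), for `σ` in `L`. -/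
instance (L : FiniteSetComplex V) : TopologicalSpace L.TorusComplex :=
  ⨆ σ : L.faces, TopologicalSpace.coinduced (L.torusInclusion σ) inferInstance

/-- The map `μ_L : T_L → ℝ / ℤ` induced by the group operation: the sum of all the coordinates. -/
def mu (L : FiniteSetComplex V) (x : L.TorusComplex) : UnitAddCircle :=
  x.1.sum fun _ t => t

/-- The infinite cyclic cover of `T_L`, the pullback along `μ_L` of the universal cover
`ℝ → ℝ / ℤ` of the circle, as a subspace of `T_L × ℝ`. -/
def Cover (L : FiniteSetComplex V) : Type u :=
  {p : L.TorusComplex × ℝ // L.mu p.1 = (p.2 : UnitAddCircle)}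

instance (L : FiniteSetComplex V) : TopologicalSpace L.Cover :=
  inferInstanceAs (TopologicalSpace {p : L.TorusComplex × ℝ // L.mu p.1 = (p.2 : UnitAddCircle)})

/-- The infinite cyclic group `Z` of deck transformations of `ℝ → ℝ / ℤ`, written
multiplicatively. -/
abbrev DeckGroup : Type := Multiplicative ℤ

/-- The deck transformation of the cover given by `z`: translation of the real coordinate. -/
def deckMap (L : FiniteSetComplex V) (z : DeckGroup) : C(L.Cover, L.Cover) where
  toFun p := ⟨(p.1.1, p.1.2 + (z.toAdd : ℝ)), by
    have h : (((z.toAdd : ℤ) : ℝ) : UnitAddCircle) = 0 :=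
      (AddCircle.coe_eq_zero_iff 1).2 ⟨z.toAdd, by simp⟩
    rw [AddCircle.coe_add, h, add_zero]
    exact p.2⟩
  continuous_toFun := by
    refine Continuous.subtype_mk ?_ _
    exact (continuous_fst.comp continuous_subtype_val).prodMk
      ((continuous_snd.comp continuous_subtype_val).add continuous_const)

lemma deckMap_one (L : FiniteSetComplex V) : L.deckMap 1 = ContinuousMap.id _ := by
  refine ContinuousMap.ext fun p => Subtype.ext (Prod.ext rfl ?_)
  change p.1.2 + (((1 : DeckGroup).toAdd : ℤ) : ℝ) = p.1.2
  simp

lemma deckMap_mul (L : FiniteSetComplex V) (y z : DeckGroup) :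
    L.deckMap (y * z) = (L.deckMap y).comp (L.deckMap z) := by
  refine ContinuousMap.ext fun p => Subtype.ext (Prod.ext rfl ?_)
  change p.1.2 + (((y * z).toAdd : ℤ) : ℝ) = p.1.2 + (z.toAdd : ℝ) + (y.toAdd : ℝ)
  rw [toAdd_mul, Int.cast_add]
  ring

section Coefficients

variable (R : Type v) [Ring R] (L : FiniteSetComplex V) (A : Type u) [AddCommGroup A] [Module R A]

/-- The singular homology of the infinite cyclic cover of `T_L` with coefficients in the left
`R`-module `A` (for `R = ℤ`, any abelian group), as a left `R`-module. -/
abbrev CoverHomology (n : ℕ) : ModuleCat.{u} R :=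
  ((AlgebraicTopology.singularHomologyFunctor (ModuleCat.{u} R) n).obj (ModuleCat.of R A)).obj
    (TopCat.of L.Cover)

/-- The action of `Z` on the homology of the cover that is induced by deck transformations. -/
def deckAction (n : ℕ) : DeckGroup →* Module.End R (CoverHomology R L A n) where
  toFun z :=
    (((AlgebraicTopology.singularHomologyFunctor (ModuleCat.{u} R) n).obj
      (ModuleCat.of R A)).map (TopCat.ofHom (L.deckMap z))).hom
  map_one' := by
    rw [deckMap_one, TopCat.ofHom_id, CategoryTheory.Functor.map_id]
    rfl
  map_mul' y z := by
    rw [deckMap_mul, TopCat.ofHom_comp, CategoryTheory.Functor.map_comp]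
    rfl

/-! ### The augmented chain complex of `L` -/

/-- The simplices of `L` with `m` vertices, that is, of dimension `m - 1`. -/
def Simplex (m : ℕ) : Type u := {σ : Finset V // σ ∈ L.faces ∧ σ.card = m}

/-- The group `C⁺_{m-1}(L; A)` of augmented simplicial chains of degree `m - 1`.  The index `m` is
the number of vertices, so that `m = 0` is degree `-1`. -/
abbrev AugChain (m : ℕ) : Type u := L.Simplex m →₀ A

variable {L} in
/-- The face of a simplex opposite to the vertex `w`. -/
def Simplex.face [DecidableEq V] {m : ℕ} (σ : L.Simplex (m + 1)) (w : σ.1) : L.Simplex m :=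
  ⟨σ.1.erase w.1, L.down_closed σ.2.1 (Finset.erase_subset _ _), by
    rw [Finset.card_erase_of_mem w.2, σ.2.2, Nat.add_sub_cancel]⟩

variable [LinearOrder V]

/-- The differential `C⁺_m(L; A) → C⁺_{m-1}(L; A)` of the augmented chain complex, where each
simplex is oriented by the order of its vertices:
`d [v₀ < ⋯ < v_m] = ∑ i, (-1) ^ i [v₀, …, v_{i-1}, v_{i+1}, …, v_m]`. -/
def augBoundary (m : ℕ) : AugChain L A (m + 1) →ₗ[R] AugChain L A m :=
  Finsupp.lsum ℕ fun σ => ∑ w : σ.1,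
    (-1 : ℤ) ^ (σ.1.filter (· < w.1)).card • Finsupp.lsingle (σ.face w)

/-- The cycles `Z⁺_{m-1}(L; A)`; in degree `-1` every chain is a cycle. -/
def augCycles : (m : ℕ) → Submodule R (AugChain L A m)
  | 0 => ⊤
  | m + 1 => LinearMap.ker (augBoundary R L A m)

/-- The boundaries `B⁺_{m-1}(L; A)`. -/
def augBoundaries (m : ℕ) : Submodule R (AugChain L A m) :=
  LinearMap.range (augBoundary R L A m)

/-- The reduced homology group of `L` of degree `m - 1` with coefficients in `A`: cycles modulo
boundaries. -/
abbrev ReducedHomology (m : ℕ) : Type u :=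
  augCycles R L A m ⧸ (augBoundaries R L A m).submoduleOf (augCycles R L A m)

end Coefficients

/-! ### Modules induced from the trivial group -/

section Induced

variable (R : Type v) [Ring R] (M : Type u) [AddCommGroup M] [Module R M]

/-- The module `ℤ[Z] ⊗ M` (tensor product over `ℤ`).  The factors are written in the opposite
order so that `R` acts through `M`; the group `Z` acts by multiplication on `ℤ[Z]`. -/
abbrev Induced : Type u := M ⊗[ℤ] MonoidAlgebra ℤ DeckGroup

/-- The action of `Z` on `ℤ[Z] ⊗ M` by multiplication on the factor `ℤ[Z]`. -/
def inducedAction : DeckGroup →* Module.End R (Induced M) where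
  toFun z := TensorProduct.AlgebraTensorModule.lTensor R M
    (LinearMap.mulLeft ℤ (MonoidAlgebra.of ℤ DeckGroup z))
  map_one' := by
    ext; simp
  map_mul' y z := by
    ext; simp [mul_assoc]

end Induced

end FiniteSetComplex

end

/-!
# The homology of the infinite cyclic cover of `T_L`

The complex `T_L` has one cell of dimension `k` for each simplex of `L` with `k` vertices, and its
infinite cyclic cover has one `k`-cell for each pair of such a simplex and a deck transformation.
The characteristic map `cell` sends a point of the cube `[0, 1]ᵏ` to the point of `T_L` with these
coordinates, and its real coordinate is the sum of the coordinates of the cube plus an integer. Two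
opposite faces of such a cube have the same image in `T_L`, but they differ in the cover by the
generator `z` of the deck group `Z`. Hence the cellular chain complex of the cover is
`ℤ[Z] ⊗ C⁺_{*-1}(L; A)` with differential `(z - 1) ⊗ d`. Multiplication by `z - 1` is injective on
`ℤ[Z] ⊗ M` for any `M`, so the cycles are `ℤ[Z] ⊗ Z⁺`, while the boundaries are
`(z - 1) (ℤ[Z] ⊗ B⁺)`. Thus `H_n` is the quotient `(ℤ[Z] ⊗ Z⁺) / (z - 1) (ℤ[Z] ⊗ B⁺)`, which is
`cycleClass_isPresentation`. Both sequences are consequences: the submodule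
`(ℤ[Z] ⊗ B⁺) / (z - 1) (ℤ[Z] ⊗ B⁺)` is `B⁺` and has quotient `ℤ[Z] ⊗ (Z⁺ / B⁺)`, and the submodule
`(z - 1) (ℤ[Z] ⊗ Z⁺) / (z - 1) (ℤ[Z] ⊗ B⁺)` is isomorphic to `ℤ[Z] ⊗ (Z⁺ / B⁺)` and has quotient
`Z⁺`. The fixed points lie in `B⁺` since `ℤ[Z] ⊗ M` has no non-zero fixed points. The splittings are
induced by a section of `Z⁺ → Z⁺ / B⁺` and by the inclusion of `Z⁺` as `1 ⊗ Z⁺`.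

The comparison of cellular with singular homology does not use CW theory. Iterated prisms define a
fundamental chain `fund` of the cube, whose boundary is the alternating sum of the fundamental
chains of its faces (`bd_fund_succ`). Pushing these chains forward along the cells gives a chain map
`cellToSing` from cellular to singular chains. It is an isomorphism on homology for two reasons.

* Singular chains can be replaced by chains of simplices that factor through cells
  (`exists_sub_bd_mem_allCellular`). By barycentric subdivision a chain can be made small with
  respect to the open cover by the sets on which the coordinates at the vertices of a simplex `σ`
  are non-zero and the other coordinates are close to zero. A deformation of the circle that
  collapses a neighbourhood of zero acts on all coordinates at once, preserves the cells, and at its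
  end moves each small simplex into a cell.
* A singular simplex that factors through a cell and does not lie in a proper face of it factors in
  a unique way (`eq_of_comp_eq`). So the complex of the chains that factor through cells of
  dimension at most `k`, relative to those that factor through smaller cells, is the direct sum over
  the `k`-cells of the complexes of the cube relative to its boundary. The homology of these is
  generated by the fundamental chain (`exists_of_bd_sub_fund_mem`), and induction on `k` gives
  `exists_of_bd_eq_cellToSing`.

Simplicial identities for singular chains are derived from the complex of tuples of points, where
boundary, prism and subdivision operators are defined recursively by cones.
-/

noncomputable section

namespace TorusCover

/-! ### Chains on tuples of points -/

section Tuples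

variable (R : Type*) [Ring R] {A : Type*} [AddCommGroup A] [Module R A] {K K' : Type*}

/-- Finite tuples of points of `K`, of any length (the empty tuple is allowed). -/
abbrev Tuple (K : Type*) : Type _ := Σ n : ℕ, Fin n → K

/-- Adding a vertex in front of a tuple. -/
def Tuple.cons (v : K) (p : Tuple K) : Tuple K := ⟨p.1 + 1, Fin.cons v p.2⟩

/-- The map of tuples induced by a map of points. -/
def Tuple.map (g : K → K') (p : Tuple K) : Tuple K' := ⟨p.1, g ∘ p.2⟩

/-- The alternating sum of the faces of a tuple; the empty tuple has no faces. -/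
def tupleFaces : (p : Tuple K) → A →ₗ[R] Tuple K →₀ A
  | ⟨0, _⟩ => 0
  | ⟨n + 1, p⟩ => ∑ i : Fin (n + 1), (-1 : ℤ) ^ (i : ℕ) • Finsupp.lsingle ⟨n, p ∘ i.succAbove⟩

/-- The boundary operator on chains of tuples, of all lengths at once. -/
def tupleBd : (Tuple K →₀ A) →ₗ[R] Tuple K →₀ A := Finsupp.lsum ℕ (tupleFaces R)

/-- The cone operator: adding a vertex in front of all tuples. -/
def cone (v : K) : (Tuple K →₀ A) →ₗ[R] Tuple K →₀ A := Finsupp.lmapDomain A R (Tuple.cons v)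

/-- The map of chains of tuples induced by a map of points. -/
def tupleMap (g : K → K') : (Tuple K →₀ A) →ₗ[R] Tuple K' →₀ A :=
  Finsupp.lmapDomain A R (Tuple.map g)

@[simp] lemma tupleBd_single_zero (p : Fin 0 → K) (a : A) :
    tupleBd R (Finsupp.single ⟨0, p⟩ a) = 0 := by
  simp [tupleBd, tupleFaces]

lemma tupleBd_single_succ {n : ℕ} (p : Fin (n + 1) → K) (a : A) :
    tupleBd R (Finsupp.single ⟨n + 1, p⟩ a) =
      ∑ i : Fin (n + 1), (-1 : ℤ) ^ (i : ℕ) • Finsupp.single ⟨n, p ∘ i.succAbove⟩ a := by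
  simp [tupleBd, tupleFaces, LinearMap.sum_apply]

@[simp] lemma cone_single (v : K) {n : ℕ} (p : Fin n → K) (a : A) :
    cone R v (Finsupp.single ⟨n, p⟩ a) = Finsupp.single ⟨n + 1, Fin.cons v p⟩ a := by
  simp [cone, Tuple.cons]

@[simp] lemma tupleMap_single (g : K → K') {n : ℕ} (p : Fin n → K) (a : A) :
    tupleMap R g (Finsupp.single ⟨n, p⟩ a) = Finsupp.single ⟨n, g ∘ p⟩ a := by
  simp [tupleMap, Tuple.map]

lemma tuple_induction {P : (Tuple K →₀ A) → Prop} (c : Tuple K →₀ A) (h0 : P 0)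
    (hadd : ∀ c d, P c → P d → P (c + d))
    (hsingle : ∀ n (p : Fin n → K) a, P (Finsupp.single ⟨n, p⟩ a)) : P c :=
  Finsupp.induction_linear c h0 hadd fun p a => hsingle p.1 p.2 a

/-- The boundary of a tuple with `n + 1` entries is a combination of tuples with `n` entries. -/
lemma tupleBd_single_induction {P : (Tuple K →₀ A) → Prop} {n : ℕ} (p : Fin (n + 1) → K) (a : A)
    (h0 : P 0) (hadd : ∀ c d, P c → P d → P (c + d))
    (hsingle : ∀ (q : Fin n → K) b, P (Finsupp.single ⟨n, q⟩ b)) :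
    P (tupleBd R (Finsupp.single ⟨n + 1, p⟩ a)) := by
  rw [tupleBd_single_succ]
  refine Finset.sum_induction _ P hadd h0 fun i _ => ?_
  rw [Finsupp.smul_single]
  exact hsingle _ _

/-- A cone is a null homotopy of the complex of tuples, augmented by the empty tuple. -/
lemma tupleBd_cone (v : K) (c : Tuple K →₀ A) :
    tupleBd R (cone R v c) = c - cone R v (tupleBd R c) := by
  induction c using tuple_induction with
  | h0 => simp
  | hadd c d hc hd => simp only [map_add, hc, hd]; abel
  | hsingle n p a =>
    rw [cone_single, tupleBd_single_succ, Fin.sum_univ_succ]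
    have h0 : (Fin.cons v p : Fin (n + 1) → K) ∘ (0 : Fin (n + 1)).succAbove = p := by
      ext i; simp
    rw [h0]
    cases n with
    | zero => simp
    | succ n =>
      rw [tupleBd_single_succ, map_sum]
      simp only [Fin.val_zero, pow_zero, one_smul, sub_eq_add_neg, ← Finset.sum_neg_distrib,
        map_zsmul, cone_single]
      congr 1
      refine Finset.sum_congr rfl fun i _ => ?_
      have hi : (Fin.cons v p : Fin (n + 2) → K) ∘ i.succ.succAbove =
          Fin.cons v (p ∘ i.succAbove) := by
        ext j
        refine Fin.cases ?_ (fun j => ?_) j <;> simp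
      rw [hi, Fin.val_succ, pow_succ, mul_neg_one, neg_smul]

lemma tupleBd_tupleBd (c : Tuple K →₀ A) : tupleBd R (tupleBd R c) = 0 := by
  suffices ∀ n (p : Fin n → K) (a : A), tupleBd R (tupleBd R (Finsupp.single ⟨n, p⟩ a)) = 0 by
    induction c using tuple_induction with
    | h0 => simp
    | hadd c d hc hd => simp [hc, hd]
    | hsingle n p a => exact this n p a
  intro n
  induction n with
  | zero => simp
  | succ n ih =>
    intro p a
    rw [← Fin.cons_self_tail p, ← cone_single R, tupleBd_cone, map_sub, tupleBd_cone, ih]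
    simp

lemma tupleMap_cone (g : K → K') (v : K) (c : Tuple K →₀ A) :
    tupleMap R g (cone R v c) = cone R (g v) (tupleMap R g c) := by
  induction c using tuple_induction with
  | h0 => simp
  | hadd c d hc hd => simp [hc, hd]
  | hsingle n p a =>
    simp only [cone_single, tupleMap_single]
    congr 2
    ext j
    refine Fin.cases ?_ (fun j => ?_) j <;> simp

lemma tupleMap_tupleBd (g : K → K') (c : Tuple K →₀ A) :
    tupleMap R g (tupleBd R c) = tupleBd R (tupleMap R g c) := by
  induction c using tuple_induction with
  | h0 => simp
  | hadd c d hc hd => simp [hc, hd]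
  | hsingle n p a =>
    cases n with
    | zero => simp
    | succ n =>
      simp only [tupleMap_single, tupleBd_single_succ, map_sum, map_zsmul]
      rfl

/-! ### The prism operator on tuples -/

/-- The prism over a tuple `p` of points of `K`, subdivided into tuples of points of `K × I`, where
`e₀` and `e₁` are the ends of the interval `I`.  The prism on `v * p` is
`(v, e₀) * (v, e₁) * (p, e₁)` minus the cone with vertex `(v, e₀)` on the prism over `p`. -/
def prismTuple {I : Type*} (e₀ e₁ : I) : (n : ℕ) → (Fin n → K) → A →ₗ[R] Tuple (K × I) →₀ A
  | 0, _ => 0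
  | n + 1, p =>
    cone R (p 0, e₀) ∘ₗ (cone R (p 0, e₁) ∘ₗ Finsupp.lsingle ⟨n, fun i => (p i.succ, e₁)⟩ -
      prismTuple e₀ e₁ n (Fin.tail p))

/-- The prism operator on chains of tuples. -/
def prismChain {I : Type*} (e₀ e₁ : I) : (Tuple K →₀ A) →ₗ[R] Tuple (K × I) →₀ A :=
  Finsupp.lsum ℕ fun p => prismTuple R e₀ e₁ p.1 p.2

variable {I : Type*} (e₀ e₁ : I)

@[simp] lemma prismChain_single {n : ℕ} (p : Fin n → K) (a : A) :
    prismChain R e₀ e₁ (Finsupp.single ⟨n, p⟩ a) = prismTuple R e₀ e₁ n p a := by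
  simp [prismChain]

lemma prismChain_cone (v : K) (c : Tuple K →₀ A) :
    prismChain R e₀ e₁ (cone R v c) = cone R (v, e₀) (cone R (v, e₁)
      (tupleMap R (fun x => (x, e₁)) c) - prismChain R e₀ e₁ c) := by
  induction c using tuple_induction with
  | h0 => simp
  | hadd c d hc hd => simp only [map_add, hc, hd, map_sub]; abel
  | hsingle n p a =>
    simp [prismTuple]
    rfl

lemma tupleBd_prismChain (c : Tuple K →₀ A) :
    tupleBd R (prismChain R e₀ e₁ c) = tupleMap R (fun x => (x, e₁)) c -
      tupleMap R (fun x => (x, e₀)) c - prismChain R e₀ e₁ (tupleBd R c) := by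
  suffices ∀ n (p : Fin n → K) (a : A), tupleBd R (prismChain R e₀ e₁ (Finsupp.single ⟨n, p⟩ a)) =
      tupleMap R (fun x => (x, e₁)) (Finsupp.single ⟨n, p⟩ a) -
      tupleMap R (fun x => (x, e₀)) (Finsupp.single ⟨n, p⟩ a) -
        prismChain R e₀ e₁ (tupleBd R (Finsupp.single ⟨n, p⟩ a)) by
    induction c using tuple_induction with
    | h0 => simp
    | hadd c d hc hd => simp only [map_add, hc, hd]; abel
    | hsingle n p a => exact this n p a
  intro n
  induction n with
  | zero =>
    intro p a
    simp [prismTuple, Subsingleton.elim (((fun x => (x, e₁)) : K → K × I) ∘ p)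
      (((fun x => (x, e₀)) : K → K × I) ∘ p)]
  | succ n ih =>
    intro p a
    rw [← Fin.cons_self_tail p, ← cone_single R]
    simp only [prismChain_cone, tupleBd_cone, map_sub, ih, tupleMap_cone, tupleMap_tupleBd]
    abel

lemma tupleMap_prismChain (g : K → K') (c : Tuple K →₀ A) :
    tupleMap R (Prod.map g id) (prismChain R e₀ e₁ c) = prismChain R e₀ e₁ (tupleMap R g c) := by
  suffices ∀ n (p : Fin n → K) (a : A),
      tupleMap R (Prod.map g id) (prismTuple R e₀ e₁ n p a) = prismTuple R e₀ e₁ n (g ∘ p) a by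
    induction c using tuple_induction with
    | h0 => simp
    | hadd c d hc hd => simp only [map_add, hc, hd]
    | hsingle n p a => simpa using this n p a
  intro n
  induction n with
  | zero => simp [prismTuple]
  | succ n ih =>
    intro p a
    simp only [prismTuple, LinearMap.comp_apply, LinearMap.sub_apply, map_sub, tupleMap_cone,
      Finsupp.lsingle_apply, tupleMap_single, ih]
    rfl

end Tuples

/-! ### Spaces with affine simplices -/

/-- The standard topological simplex of dimension `n`. -/
abbrev Simp (n : ℕ) : Type := stdSimplex ℝ (Fin (n + 1))

/-- A space in which every non-empty tuple of points spans an affine singular simplex; a convex set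
is the typical example. -/
class AffSpace (K : Type*) [TopologicalSpace K] where
  /-- The singular simplex spanned by a non-empty tuple. -/
  aff : {n : ℕ} → (Fin (n + 1) → K) → C(Simp n, K)
  /-- The simplex spanned by a tuple has the given vertices. -/
  aff_vertex : ∀ {n : ℕ} (p : Fin (n + 1) → K) (i : Fin (n + 1)), aff p (stdSimplex.vertex i) = p i
  /-- Affine simplices are compatible with composition, for simplices in a standard simplex. -/
  aff_of_coord : ∀ {m n : ℕ} (p : Fin (n + 1) → K) (q : Fin (m + 1) → Simp n)
    (x : Simp m) (y : Simp n), (∀ j, y j = ∑ i, x i * q i j) →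
      aff (fun i => aff p (q i)) x = aff p y

/-- A convex subset of a topological vector space has affine simplices. -/
@[reducible] def AffSpace.ofConvex {E : Type*} [AddCommGroup E] [Module ℝ E] [TopologicalSpace E]
    [ContinuousAdd E] [ContinuousSMul ℝ E] {s : Set E} (hs : Convex ℝ s) : AffSpace s where
  aff p :=
    { toFun := fun x => ⟨∑ i, x i • (p i : E),
        hs.sum_mem (fun i _ => x.2.1 i) x.2.2 fun i _ => (p i).2⟩
      continuous_toFun := by
        refine Continuous.subtype_mk (continuous_finsetSum _ fun i _ => ?_) _
        exact ((continuous_apply i).comp continuous_subtype_val).smul continuous_const }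
  aff_vertex p i := by
    apply Subtype.ext
    simp [Pi.single_apply, ite_smul]
  aff_of_coord p q x y h := by
    apply Subtype.ext
    simp only [ContinuousMap.coe_mk, h, Finset.smul_sum, Finset.sum_smul, smul_smul]
    exact Finset.sum_comm

instance (n : ℕ) : AffSpace (Simp n) := AffSpace.ofConvex (convex_stdSimplex ℝ _)

instance : AffSpace unitInterval := AffSpace.ofConvex (convex_Icc (0 : ℝ) 1)

instance {K K' : Type*} [TopologicalSpace K] [TopologicalSpace K'] [AffSpace K] [AffSpace K'] :
    AffSpace (K × K') where
  aff p := (AffSpace.aff fun i => (p i).1).prodMk (AffSpace.aff fun i => (p i).2)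
  aff_vertex _ i := Prod.ext (AffSpace.aff_vertex _ i) (AffSpace.aff_vertex _ i)
  aff_of_coord _ q x y h :=
    Prod.ext (AffSpace.aff_of_coord _ q x y h) (AffSpace.aff_of_coord _ q x y h)

open AffSpace

section Aff

variable {K K' : Type*} [TopologicalSpace K] [TopologicalSpace K'] [AffSpace K] [AffSpace K']

lemma aff_comp {m n : ℕ} (p : Fin (n + 1) → K) (q : Fin (m + 1) → Simp n) (x : Simp m) :
    aff p (aff q x) = aff (fun i => aff p (q i)) x := by
  refine (aff_of_coord p q x _ fun j => ?_).symm
  change (∑ i, x.1 i • (q i : Fin (n + 1) → ℝ)) j = _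
  simp only [Finset.sum_apply, Pi.smul_apply, smul_eq_mul]
  rfl

/-- The vertices of the standard simplex, in order. -/
def vertices (n : ℕ) : Fin (n + 1) → Simp n := fun i => stdSimplex.vertex i

lemma aff_vertices {n : ℕ} (x : Simp n) : aff (vertices n) x = x := by
  apply Subtype.ext
  funext j
  change (∑ i, x.1 i • (vertices n i : Fin (n + 1) → ℝ)) j = _
  simp [vertices, Finset.sum_apply, Pi.single_apply]

lemma aff_comp_vertices {n : ℕ} (p : Fin (n + 1) → K) : aff p ∘ vertices n = p :=
  funext fun i => aff_vertex p i

/-- The inclusion in the standard simplex of the face opposite to a vertex. -/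
def faceMap {n : ℕ} (i : Fin (n + 2)) : C(Simp n, Simp (n + 1)) :=
  aff (vertices (n + 1) ∘ i.succAbove)

lemma aff_comp_faceMap {n : ℕ} (p : Fin (n + 2) → K) (i : Fin (n + 2)) :
    (aff p).comp (faceMap i) = aff (p ∘ i.succAbove) := by
  ext x
  simp only [ContinuousMap.comp_apply, faceMap, aff_comp]
  congr 2
  funext j
  exact aff_vertex p _

/-- Maps that commute with the formation of affine simplices. -/
def IsAff (g : K → K') : Prop :=
  ∀ (n : ℕ) (p : Fin (n + 1) → K) (x : Simp n), g (aff p x) = aff (g ∘ p) x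

lemma isAff_aff {n : ℕ} (p : Fin (n + 1) → K) : IsAff (aff p) := fun _ q x => aff_comp p q x

end Aff

/-! ### Barycentric subdivision of tuples -/

section Subdivision

variable (R : Type*) [Ring R] {A : Type*} [AddCommGroup A] [Module R A]
variable {K K' : Type*} [TopologicalSpace K] [TopologicalSpace K'] [AffSpace K] [AffSpace K']

/-- The barycenter of a non-empty tuple. -/
def bary {n : ℕ} (p : Fin (n + 1) → K) : K := aff p stdSimplex.barycenter

lemma IsAff.map_bary {g : K → K'} (hg : IsAff g) {n : ℕ} (p : Fin (n + 1) → K) :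
    g (bary p) = bary (g ∘ p) := hg n p _

/-- The barycentric subdivision of a tuple: the cone on the subdivision of its boundary, with the
barycenter as vertex. -/
def sdTuple : (n : ℕ) → (Fin n → K) → A →ₗ[R] Tuple K →₀ A
  | 0, p => Finsupp.lsingle ⟨0, p⟩
  | n + 1, p => cone R (bary p) ∘ₗ
      ∑ i : Fin (n + 1), (-1 : ℤ) ^ (i : ℕ) • sdTuple n (p ∘ i.succAbove)

/-- The barycentric subdivision operator on chains of tuples. -/
def sdChain : (Tuple K →₀ A) →ₗ[R] Tuple K →₀ A := Finsupp.lsum ℕ fun p => sdTuple R p.1 p.2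

/-- The homotopy between the identity and barycentric subdivision on a tuple. -/
def sdHtpyTuple : (n : ℕ) → (Fin n → K) → A →ₗ[R] Tuple K →₀ A
  | 0, _ => 0
  | n + 1, p => cone R (bary p) ∘ₗ (Finsupp.lsingle ⟨n + 1, p⟩ -
      ∑ i : Fin (n + 1), (-1 : ℤ) ^ (i : ℕ) • sdHtpyTuple n (p ∘ i.succAbove))

/-- The homotopy between the identity and barycentric subdivision on chains of tuples. -/
def sdHtpyChain : (Tuple K →₀ A) →ₗ[R] Tuple K →₀ A :=
  Finsupp.lsum ℕ fun p => sdHtpyTuple R p.1 p.2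

@[simp] lemma sdChain_single {n : ℕ} (p : Fin n → K) (a : A) :
    sdChain R (Finsupp.single ⟨n, p⟩ a) = sdTuple R n p a := by
  simp [sdChain]

@[simp] lemma sdHtpyChain_single {n : ℕ} (p : Fin n → K) (a : A) :
    sdHtpyChain R (Finsupp.single ⟨n, p⟩ a) = sdHtpyTuple R n p a := by
  simp [sdHtpyChain]

lemma sdTuple_succ {n : ℕ} (p : Fin (n + 1) → K) (a : A) :
    sdTuple R (n + 1) p a =
      cone R (bary p) (sdChain R (tupleBd R (Finsupp.single ⟨n + 1, p⟩ a))) := by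
  simp [sdTuple, tupleBd_single_succ]

lemma sdHtpyTuple_succ {n : ℕ} (p : Fin (n + 1) → K) (a : A) :
    sdHtpyTuple R (n + 1) p a = cone R (bary p) (Finsupp.single ⟨n + 1, p⟩ a -
      sdHtpyChain R (tupleBd R (Finsupp.single ⟨n + 1, p⟩ a))) := by
  simp [sdHtpyTuple, tupleBd_single_succ, LinearMap.sum_apply]

lemma tupleBd_sdChain (c : Tuple K →₀ A) :
    tupleBd R (sdChain R c) = sdChain R (tupleBd R c) := by
  suffices ∀ n (p : Fin n → K) (a : A), tupleBd R (sdChain R (Finsupp.single ⟨n, p⟩ a)) =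
      sdChain R (tupleBd R (Finsupp.single ⟨n, p⟩ a)) by
    induction c using tuple_induction with
    | h0 => simp
    | hadd c d hc hd => simp only [map_add, hc, hd]
    | hsingle n p a => exact this n p a
  intro n
  induction n with
  | zero => simp [sdTuple]
  | succ n ih =>
    intro p a
    have key : tupleBd R (sdChain R (tupleBd R (Finsupp.single ⟨n + 1, p⟩ a))) =
        sdChain R (tupleBd R (tupleBd R (Finsupp.single ⟨n + 1, p⟩ a))) :=
      tupleBd_single_induction R (P := fun c => tupleBd R (sdChain R c) = sdChain R (tupleBd R c))
        p a (by simp) (fun c d hc hd => by simp only [map_add, hc, hd]) ih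
    rw [sdChain_single, sdTuple_succ, tupleBd_cone, key, tupleBd_tupleBd]
    simp

lemma tupleBd_sdHtpyChain (c : Tuple K →₀ A) :
    tupleBd R (sdHtpyChain R c) = c - sdChain R c - sdHtpyChain R (tupleBd R c) := by
  suffices ∀ n (p : Fin n → K) (a : A), tupleBd R (sdHtpyChain R (Finsupp.single ⟨n, p⟩ a)) =
      Finsupp.single ⟨n, p⟩ a - sdChain R (Finsupp.single ⟨n, p⟩ a) -
        sdHtpyChain R (tupleBd R (Finsupp.single ⟨n, p⟩ a)) by
    induction c using tuple_induction with
    | h0 => simp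
    | hadd c d hc hd => simp only [map_add, hc, hd]; abel
    | hsingle n p a => exact this n p a
  intro n
  induction n with
  | zero => simp [sdTuple, sdHtpyTuple]
  | succ n ih =>
    intro p a
    have key := tupleBd_single_induction R (P := fun c => tupleBd R (sdHtpyChain R c) =
        c - sdChain R c - sdHtpyChain R (tupleBd R c))
        p a (by simp) (fun c d hc hd => by simp only [map_add, hc, hd]; abel) ih
    rw [sdHtpyChain_single, sdHtpyTuple_succ, tupleBd_cone, map_sub, key, tupleBd_tupleBd,
      sdChain_single, sdTuple_succ]
    simp only [map_zero, map_sub]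
    abel

lemma tupleMap_sdChain {g : K → K'} (hg : IsAff g) (c : Tuple K →₀ A) :
    tupleMap R g (sdChain R c) = sdChain R (tupleMap R g c) := by
  suffices ∀ n (p : Fin n → K) (a : A), tupleMap R g (sdChain R (Finsupp.single ⟨n, p⟩ a)) =
      sdChain R (tupleMap R g (Finsupp.single ⟨n, p⟩ a)) by
    induction c using tuple_induction with
    | h0 => simp
    | hadd c d hc hd => simp only [map_add, hc, hd]
    | hsingle n p a => exact this n p a
  intro n
  induction n with
  | zero => simp [sdTuple]
  | succ n ih =>
    intro p a
    have key := tupleBd_single_induction R (P := fun c => tupleMap R g (sdChain R c) =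
        sdChain R (tupleMap R g c))
        p a (by simp) (fun c d hc hd => by simp only [map_add, hc, hd]) ih
    rw [sdChain_single, sdTuple_succ, tupleMap_cone, key, tupleMap_tupleBd, hg.map_bary,
      tupleMap_single, sdChain_single, sdTuple_succ]

lemma tupleMap_sdHtpyChain {g : K → K'} (hg : IsAff g) (c : Tuple K →₀ A) :
    tupleMap R g (sdHtpyChain R c) = sdHtpyChain R (tupleMap R g c) := by
  suffices ∀ n (p : Fin n → K) (a : A), tupleMap R g (sdHtpyChain R (Finsupp.single ⟨n, p⟩ a)) =
      sdHtpyChain R (tupleMap R g (Finsupp.single ⟨n, p⟩ a)) by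
    induction c using tuple_induction with
    | h0 => simp
    | hadd c d hc hd => simp only [map_add, hc, hd]
    | hsingle n p a => exact this n p a
  intro n
  induction n with
  | zero => simp [sdHtpyTuple]
  | succ n ih =>
    intro p a
    have key := tupleBd_single_induction R (P := fun c => tupleMap R g (sdHtpyChain R c) =
        sdHtpyChain R (tupleMap R g c))
        p a (by simp) (fun c d hc hd => by simp only [map_add, hc, hd]) ih
    rw [sdHtpyChain_single, sdHtpyTuple_succ, tupleMap_cone, map_sub, key, tupleMap_tupleBd,
      hg.map_bary, tupleMap_single, sdHtpyChain_single, sdHtpyTuple_succ]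

end Subdivision

/-! ### Singular chains -/

section Singular

variable (R : Type*) [Ring R] {A : Type*} [AddCommGroup A] [Module R A]
variable {X Y Y' : Type*} [TopologicalSpace X] [TopologicalSpace Y] [TopologicalSpace Y']
variable {K : Type*} [TopologicalSpace K] [AffSpace K]

/-- Singular simplices of all dimensions. -/
abbrev Sing (X : Type*) [TopologicalSpace X] : Type _ := Σ n : ℕ, C(Simp n, X)

/-- The singular simplex of `Y` obtained from one of `X` by a map `X → Y`. -/
def Sing.map (f : C(X, Y)) (s : Sing X) : Sing Y := ⟨s.1, f.comp s.2⟩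

/-- The alternating sum of the faces of a singular simplex; points have no faces. -/
def singFaces : (s : Sing X) → A →ₗ[R] Sing X →₀ A
  | ⟨0, _⟩ => 0
  | ⟨n + 1, s⟩ => ∑ i : Fin (n + 2), (-1 : ℤ) ^ (i : ℕ) • Finsupp.lsingle ⟨n, s.comp (faceMap i)⟩

/-- The boundary operator on singular chains, in all degrees at once. -/
def bd : (Sing X →₀ A) →ₗ[R] Sing X →₀ A := Finsupp.lsum ℕ (singFaces R)

/-- The map of singular chains induced by a continuous map. -/
def push (f : C(X, Y)) : (Sing X →₀ A) →ₗ[R] Sing Y →₀ A :=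
  Finsupp.lmapDomain A R (Sing.map f)

/-- A non-empty tuple of points spans an affine singular simplex. The empty tuple is sent to zero,
which makes this compatible with the boundary operators. -/
def realizeTuple : (p : Tuple K) → A →ₗ[R] Sing K →₀ A
  | ⟨0, _⟩ => 0
  | ⟨n + 1, p⟩ => Finsupp.lsingle ⟨n, aff p⟩

/-- The chain map from tuples to singular chains. -/
def realize : (Tuple K →₀ A) →ₗ[R] Sing K →₀ A := Finsupp.lsum ℕ (realizeTuple R)

@[simp] lemma bd_single_zero (s : C(Simp 0, X)) (a : A) :
    bd R (Finsupp.single ⟨0, s⟩ a) = 0 := by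
  simp [bd, singFaces]

lemma bd_single_succ {n : ℕ} (s : C(Simp (n + 1), X)) (a : A) :
    bd R (Finsupp.single ⟨n + 1, s⟩ a) =
      ∑ i : Fin (n + 2), (-1 : ℤ) ^ (i : ℕ) • Finsupp.single ⟨n, s.comp (faceMap i)⟩ a := by
  simp [bd, singFaces, LinearMap.sum_apply]

@[simp] lemma push_single (f : C(X, Y)) {n : ℕ} (s : C(Simp n, X)) (a : A) :
    push R f (Finsupp.single ⟨n, s⟩ a) = Finsupp.single ⟨n, f.comp s⟩ a := by
  simp [push, Sing.map]

@[simp] lemma realize_single_zero (p : Fin 0 → K) (a : A) :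
    realize R (Finsupp.single ⟨0, p⟩ a) = 0 := by
  simp [realize, realizeTuple]

@[simp] lemma realize_single_succ {n : ℕ} (p : Fin (n + 1) → K) (a : A) :
    realize R (Finsupp.single ⟨n + 1, p⟩ a) = Finsupp.single ⟨n, aff p⟩ a := by
  simp [realize, realizeTuple]

lemma sing_induction {P : (Sing X →₀ A) → Prop} (c : Sing X →₀ A) (h0 : P 0)
    (hadd : ∀ c d, P c → P d → P (c + d))
    (hsingle : ∀ n (s : C(Simp n, X)) a, P (Finsupp.single ⟨n, s⟩ a)) : P c :=
  Finsupp.induction_linear c h0 hadd fun p a => hsingle p.1 p.2 a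

lemma push_comp (g : C(Y, Y')) (f : C(X, Y)) (c : Sing X →₀ A) :
    push R (g.comp f) c = push R g (push R f c) := by
  induction c using sing_induction with
  | h0 => simp
  | hadd c d hc hd => simp only [map_add, hc, hd]
  | hsingle n s a => simp [ContinuousMap.comp_assoc]

lemma push_id (c : Sing X →₀ A) : push R (ContinuousMap.id X) c = c := by
  induction c using sing_induction with
  | h0 => simp
  | hadd c d hc hd => simp only [map_add, hc, hd]
  | hsingle n s a => simp

lemma bd_push (f : C(X, Y)) (c : Sing X →₀ A) : bd R (push R f c) = push R f (bd R c) := by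
  induction c using sing_induction with
  | h0 => simp
  | hadd c d hc hd => simp only [map_add, hc, hd]
  | hsingle n s a =>
    cases n with
    | zero => simp
    | succ n => simp [bd_single_succ, ContinuousMap.comp_assoc]

lemma bd_realize (c : Tuple K →₀ A) : bd R (realize R c) = realize R (tupleBd R c) := by
  induction c using tuple_induction with
  | h0 => simp
  | hadd c d hc hd => simp only [map_add, hc, hd]
  | hsingle n p a =>
    match n with
    | 0 => simp
    | 1 => simp [tupleBd_single_succ]
    | n + 2 => simp [tupleBd_single_succ, bd_single_succ, aff_comp_faceMap]

lemma push_realize {K' : Type*} [TopologicalSpace K'] [AffSpace K'] (g : C(K, K')) (hg : IsAff g)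
    (c : Tuple K →₀ A) : push R g (realize R c) = realize R (tupleMap R g c) := by
  induction c using tuple_induction with
  | h0 => simp
  | hadd c d hc hd => simp only [map_add, hc, hd]
  | hsingle n p a =>
    cases n with
    | zero => simp
    | succ n =>
      simp only [realize_single_succ, push_single, tupleMap_single]
      congr 2
      ext x
      exact hg n p x

/-- The tautological tuple whose realization is the identity of the standard simplex. -/
def tautTuple (n : ℕ) (a : A) : Tuple (Simp n) →₀ A := Finsupp.single ⟨n + 1, vertices n⟩ a

/-- Every singular simplex is the image of a tuple in a simplex, which reduces natural identities to
identities on tuples. -/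
lemma push_realize_tautTuple {n : ℕ} (s : C(Simp n, X)) (a : A) :
    push R s (realize R (tautTuple n a)) = Finsupp.single ⟨n, s⟩ a := by
  rw [tautTuple, realize_single_succ, push_single]
  congr 2
  ext x
  simp [aff_vertices]

lemma bd_bd (c : Sing X →₀ A) : bd R (bd R c) = 0 := by
  induction c using sing_induction with
  | h0 => simp
  | hadd c d hc hd => simp only [map_add, hc, hd, add_zero]
  | hsingle n s a =>
    rw [← push_realize_tautTuple R s a]
    simp [bd_push, bd_realize, tupleBd_tupleBd]

/-! ### Natural operators on singular chains -/

/-- The subdivision operator on singular chains. -/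
def sd : (Sing X →₀ A) →ₗ[R] Sing X →₀ A :=
  Finsupp.lsum ℕ fun s => push R s.2 ∘ₗ realize R ∘ₗ sdTuple R (s.1 + 1) (vertices s.1)

/-- The homotopy between the identity and subdivision on singular chains. -/
def sdHtpy : (Sing X →₀ A) →ₗ[R] Sing X →₀ A :=
  Finsupp.lsum ℕ fun s => push R s.2 ∘ₗ realize R ∘ₗ sdHtpyTuple R (s.1 + 1) (vertices s.1)

/-- The product of a map with the identity of the unit interval. -/
abbrev prodI (f : C(X, Y)) : C(X × unitInterval, Y × unitInterval) :=
  f.prodMap (ContinuousMap.id unitInterval)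

/-- The prism operator on singular chains. -/
def prism : (Sing X →₀ A) →ₗ[R] Sing (X × unitInterval) →₀ A :=
  Finsupp.lsum ℕ fun s => push R (prodI s.2) ∘ₗ realize R ∘ₗ
    prismTuple R (0 : unitInterval) 1 (s.1 + 1) (vertices s.1)

lemma sd_push_realize (s : C(K, X)) (c : Tuple K →₀ A) :
    sd R (push R s (realize R c)) = push R s (realize R (sdChain R c)) := by
  induction c using tuple_induction with
  | h0 => simp
  | hadd c d hc hd => simp only [map_add, hc, hd]
  | hsingle n p a =>
    cases n with
    | zero => simp [sdTuple]
    | succ n =>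
      simp only [realize_single_succ, push_single, sd, Finsupp.lsum_single, LinearMap.comp_apply,
        push_comp, push_realize R _ (isAff_aff p), ← sdChain_single,
        tupleMap_sdChain R (isAff_aff p), tupleMap_single, aff_comp_vertices]

lemma sdHtpy_push_realize (s : C(K, X)) (c : Tuple K →₀ A) :
    sdHtpy R (push R s (realize R c)) = push R s (realize R (sdHtpyChain R c)) := by
  induction c using tuple_induction with
  | h0 => simp
  | hadd c d hc hd => simp only [map_add, hc, hd]
  | hsingle n p a =>
    cases n with
    | zero => simp [sdHtpyTuple]
    | succ n =>
      simp only [realize_single_succ, push_single, sdHtpy, Finsupp.lsum_single,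
        LinearMap.comp_apply, push_comp, push_realize R _ (isAff_aff p), ← sdHtpyChain_single,
        tupleMap_sdHtpyChain R (isAff_aff p), tupleMap_single, aff_comp_vertices]

lemma prodI_comp (g : C(Y, Y')) (f : C(X, Y)) : prodI (g.comp f) = (prodI g).comp (prodI f) := rfl

lemma prism_push_realize (s : C(K, X)) (c : Tuple K →₀ A) :
    prism R (push R s (realize R c)) =
      push R (prodI s) (realize R (prismChain R (0 : unitInterval) 1 c)) := by
  induction c using tuple_induction with
  | h0 => simp
  | hadd c d hc hd => simp only [map_add, hc, hd]
  | hsingle n p a =>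
    cases n with
    | zero => simp [prismTuple]
    | succ n =>
      have h : IsAff (prodI (aff p)) := fun n q x => Prod.ext (isAff_aff p n _ x) rfl
      simp only [realize_single_succ, push_single, prism, Finsupp.lsum_single,
        LinearMap.comp_apply, prodI_comp, push_comp, push_realize R _ h]
      rw [← prismChain_single]
      change push R (prodI s) (realize R (tupleMap R (Prod.map (aff p) id) _)) = _
      rw [tupleMap_prismChain, tupleMap_single, aff_comp_vertices]

lemma prism_push (f : C(X, Y)) (c : Sing X →₀ A) :
    prism R (push R f c) = push R (prodI f) (prism R c) := by
  induction c using sing_induction with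
  | h0 => simp
  | hadd c d hc hd => simp only [map_add, hc, hd]
  | hsingle n s a =>
    rw [← push_realize_tautTuple R s a]
    simp only [← push_comp, prism_push_realize, prodI_comp]

lemma bd_sd (c : Sing X →₀ A) : bd R (sd R c) = sd R (bd R c) := by
  induction c using sing_induction with
  | h0 => simp
  | hadd c d hc hd => simp only [map_add, hc, hd]
  | hsingle n s a =>
    rw [← push_realize_tautTuple R s a]
    simp only [sd_push_realize, bd_push, bd_realize, tupleBd_sdChain]

lemma bd_sdHtpy (c : Sing X →₀ A) : bd R (sdHtpy R c) = c - sd R c - sdHtpy R (bd R c) := by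
  induction c using sing_induction with
  | h0 => simp
  | hadd c d hc hd => simp only [map_add, hc, hd]; abel
  | hsingle n s a =>
    rw [← push_realize_tautTuple R s a]
    simp only [sd_push_realize, sdHtpy_push_realize, bd_push, bd_realize, tupleBd_sdHtpyChain,
      map_sub]

/-- The inclusion of the slice of height `t` in a cylinder. -/
def slice (X : Type*) [TopologicalSpace X] (t : unitInterval) : C(X, X × unitInterval) :=
  (ContinuousMap.id X).prodMk (ContinuousMap.const X t)

lemma bd_prism (c : Sing X →₀ A) :
    bd R (prism R c) = push R (slice X 1) c - push R (slice X 0) c - prism R (bd R c) := by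
  induction c using sing_induction with
  | h0 => simp
  | hadd c d hc hd => simp only [map_add, hc, hd]; abel
  | hsingle n s a =>
    rw [← push_realize_tautTuple R s a]
    have h (t : unitInterval) (c : Tuple (Simp n) →₀ A) :
        push R (slice X t) (push R s (realize R c)) =
          push R (prodI s) (realize R (tupleMap R (fun x => (x, t)) c)) := by
      have ht : IsAff (slice (Simp n) t) := fun n q x => Prod.ext rfl (by
        change t = aff (fun _ => t) x
        apply Subtype.ext
        change (t : ℝ) = ∑ i, x.1 i • (t : ℝ)
        rw [← Finset.sum_smul, x.2.2, one_smul])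
      rw [← push_comp]
      change push R ((prodI s).comp (slice (Simp n) t)) _ = _
      rw [push_comp, push_realize R _ ht]
      rfl
    simp only [h, prism_push_realize, bd_push, bd_realize, tupleBd_prismChain, map_sub]

/-- The chain homotopy defined by a homotopy. -/
def htpy (h : C(X × unitInterval, Y)) : (Sing X →₀ A) →ₗ[R] Sing Y →₀ A := push R h ∘ₗ prism R

lemma bd_htpy (h : C(X × unitInterval, Y)) (c : Sing X →₀ A) :
    bd R (htpy R h c) =
      push R (h.comp (slice X 1)) c - push R (h.comp (slice X 0)) c - htpy R h (bd R c) := by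
  simp only [htpy, LinearMap.comp_apply, bd_push, bd_prism, map_sub, push_comp]

lemma htpy_push {X' : Type*} [TopologicalSpace X'] (h : C(X × unitInterval, Y)) (f : C(X', X))
    (c : Sing X' →₀ A) : htpy R h (push R f c) = htpy R (h.comp (prodI f)) c := by
  simp only [htpy, LinearMap.comp_apply, prism_push, push_comp]

lemma push_htpy (g : C(Y, Y')) (h : C(X × unitInterval, Y)) (c : Sing X →₀ A) :
    push R g (htpy R h c) = htpy R (g.comp h) c := by
  simp only [htpy, LinearMap.comp_apply, push_comp]

end Singular

/-! ### Chains supported on a class of simplices -/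

section Support

variable (R : Type*) [Ring R] {A : Type*} [AddCommGroup A] [Module R A]
variable {X Y : Type*} [TopologicalSpace X] [TopologicalSpace Y]

lemma lmapDomain_mem_supported {α β : Type*} {f : α → β} {P : Set α} {Q : Set β}
    (h : ∀ x ∈ P, f x ∈ Q) {c : α →₀ A} (hc : c ∈ Finsupp.supported A R P) :
    Finsupp.lmapDomain A R f c ∈ Finsupp.supported A R Q := by
  have := Submodule.mem_map_of_mem (f := Finsupp.lmapDomain A R f) hc
  rw [Finsupp.lmapDomain_supported] at this
  exact Finsupp.supported_mono (Set.image_subset_iff.2 h) this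

lemma lsum_mem {α M : Type*} [AddCommGroup M] [Module R M] {F : α → A →ₗ[R] M} {P : Set α}
    {N : Submodule R M} (h : ∀ x ∈ P, ∀ a, F x a ∈ N) {c : α →₀ A}
    (hc : c ∈ Finsupp.supported A R P) : Finsupp.lsum ℕ F c ∈ N := by
  rw [Finsupp.lsum_apply]
  exact Submodule.sum_mem _ fun x hx => h x (hc hx) _

/-- A class of singular simplices is a sieve if it is closed under precomposition with all maps
between standard simplices. -/
def IsSieve (P : Set (Sing X)) : Prop :=
  ∀ ⦃n : ℕ⦄ ⦃s : C(Simp n, X)⦄, ⟨n, s⟩ ∈ P → ∀ (m : ℕ) (g : C(Simp m, Simp n)), ⟨m, s.comp g⟩ ∈ P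

lemma push_mem {f : C(X, Y)} {P : Set (Sing X)} {Q : Set (Sing Y)}
    (h : ∀ s ∈ P, Sing.map f s ∈ Q) {c : Sing X →₀ A} (hc : c ∈ Finsupp.supported A R P) :
    push R f c ∈ Finsupp.supported A R Q :=
  lmapDomain_mem_supported R h hc

lemma IsSieve.push_mem {P : Set (Sing X)} (hP : IsSieve P) {n : ℕ} {s : C(Simp n, X)}
    (hs : ⟨n, s⟩ ∈ P) (c : Sing (Simp n) →₀ A) : push R s c ∈ Finsupp.supported A R P :=
  TorusCover.push_mem R (P := Set.univ) (fun g _ => hP hs g.1 g.2) (by simp)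

lemma IsSieve.bd_mem {P : Set (Sing X)} (hP : IsSieve P) {c : Sing X →₀ A}
    (hc : c ∈ Finsupp.supported A R P) : bd R c ∈ Finsupp.supported A R P := by
  refine lsum_mem R (fun s hs a => ?_) hc
  have : singFaces R s a = bd R (Finsupp.single ⟨s.1, s.2⟩ a) := by simp [bd]
  rw [this, ← push_realize_tautTuple R s.2, bd_push]
  exact hP.push_mem R hs _

lemma IsSieve.sd_mem {P : Set (Sing X)} (hP : IsSieve P) {c : Sing X →₀ A}
    (hc : c ∈ Finsupp.supported A R P) : sd R c ∈ Finsupp.supported A R P :=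
  lsum_mem R (fun _ hs _ => hP.push_mem R hs _) hc

lemma IsSieve.sdHtpy_mem {P : Set (Sing X)} (hP : IsSieve P) {c : Sing X →₀ A}
    (hc : c ∈ Finsupp.supported A R P) : sdHtpy R c ∈ Finsupp.supported A R P :=
  lsum_mem R (fun _ hs _ => hP.push_mem R hs _) hc

lemma htpy_mem {h : C(X × unitInterval, Y)} {P : Set (Sing X)} {Q : Set (Sing Y)}
    (hPQ : ∀ n (s : C(Simp n, X)), ⟨n, s⟩ ∈ P → ∀ m (g : C(Simp m, Simp n × unitInterval)),
      ⟨m, (h.comp (prodI s)).comp g⟩ ∈ Q)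
    {c : Sing X →₀ A} (hc : c ∈ Finsupp.supported A R P) :
    htpy R h c ∈ Finsupp.supported A R Q := by
  have : prism R c ∈ (Finsupp.supported A R Q).comap (push R h) := by
    refine lsum_mem R (fun s hs a => ?_) hc
    simp only [Submodule.mem_comap, LinearMap.comp_apply, ← push_comp]
    exact push_mem R (P := Set.univ) (fun g _ => hPQ s.1 s.2 hs g.1 g.2) (by simp)
  exact this

end Support

/-! ### Small simplices -/

section Small

variable (R : Type*) [Ring R] {A : Type*} [AddCommGroup A] [Module R A]
variable {X : Type*} [TopologicalSpace X]

lemma coe_aff_simp {m n : ℕ} (p : Fin (m + 1) → Simp n) (x : Simp m) :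
    ((aff p x : Simp n) : Fin (n + 1) → ℝ) = ∑ i, x.1 i • (p i : Fin (n + 1) → ℝ) := rfl

lemma dist_aff_le {m n : ℕ} (p : Fin (m + 1) → Simp n) (x : Simp m) {y : Simp n} {r : ℝ}
    (h : ∀ i, dist (p i) y ≤ r) : dist (aff p x) y ≤ r := by
  have := (convex_closedBall (y : Fin (n + 1) → ℝ) r).sum_mem (t := Finset.univ)
    (fun i _ => x.2.1 i) x.2.2 (z := fun i => (p i : Fin (n + 1) → ℝ)) fun i _ => h i
  exact this

lemma dist_bary_le {m n : ℕ} (p : Fin (m + 1) → Simp n) {D : ℝ}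
    (h : ∀ i j, dist (p i) (p j) ≤ D) (j : Fin (m + 1)) :
    dist (bary p) (p j) ≤ m / (m + 1) * D := by
  have h1 : ((bary p : Simp n) : Fin (n + 1) → ℝ) - p j =
      ∑ i, ((m : ℝ) + 1)⁻¹ • ((p i : Fin (n + 1) → ℝ) - p j) := by
    rw [bary, coe_aff_simp]
    simp only [stdSimplex.barycenter_apply, Fintype.card_fin, Nat.cast_add, Nat.cast_one, smul_sub,
      Finset.sum_sub_distrib, Finset.sum_const, Finset.card_univ]
    rw [← Nat.cast_smul_eq_nsmul ℝ, smul_smul]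
    have : ((m + 1 : ℕ) : ℝ) * ((m : ℝ) + 1)⁻¹ = 1 := by
      push_cast
      field_simp
    rw [this, one_smul]
  rw [Subtype.dist_eq, dist_eq_norm]
  refine (congrArg norm h1).trans_le ?_
  rw [← Finset.add_sum_erase _ _ (Finset.mem_univ j)]
  simp only [sub_self, smul_zero, zero_add]
  refine (norm_sum_le _ _).trans ?_
  have h2 : ∀ i ∈ Finset.univ.erase j, ‖((m : ℝ) + 1)⁻¹ • ((p i : Fin (n + 1) → ℝ) - p j)‖ ≤
      ((m : ℝ) + 1)⁻¹ * D := by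
    intro i _
    rw [norm_smul, Real.norm_of_nonneg (by positivity), ← dist_eq_norm]
    exact mul_le_mul_of_nonneg_left (h i j) (by positivity)
  refine (Finset.sum_le_sum h2).trans (le_of_eq ?_)
  simp [Finset.card_erase_of_mem]
  ring

/-- The tuples with `m` entries within the tuple `p`, and of diameter at most `D`. -/
def fineTuples {n m : ℕ} (p : Fin m → Simp n) (D : ℝ) : Set (Tuple (Simp n)) :=
  {q | q.1 = m ∧ (∀ y r, (∀ i, dist (p i) y ≤ r) → ∀ i, dist (q.2 i) y ≤ r) ∧
    ∀ i j, dist (q.2 i) (q.2 j) ≤ D}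

/-- Barycentric subdivision of a tuple with `m` entries reduces its diameter at least by the factor
`(m - 1) / m`. -/
lemma sdTuple_mem_fine {n : ℕ} {D : ℝ} (hD : 0 ≤ D) (m : ℕ) (p : Fin m → Simp n)
    (hp : ∀ i j, dist (p i) (p j) ≤ D) (a : A) :
    sdTuple R m p a ∈ Finsupp.supported A R (fineTuples p ((m - 1) / m * D)) := by
  induction m with
  | zero =>
    rw [sdTuple, Finsupp.lsingle_apply]
    exact Finsupp.single_mem_supported _ _ ⟨rfl, fun _ _ h => h, fun i => i.elim0⟩
  | succ m ih =>
    rw [sdTuple, LinearMap.comp_apply, LinearMap.sum_apply, map_sum]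
    refine Submodule.sum_mem _ fun k _ => ?_
    rw [LinearMap.smul_apply, map_zsmul]
    refine zsmul_mem (lmapDomain_mem_supported R ?_
      (ih (p ∘ k.succAbove) fun i j => hp _ _)) _
    rintro ⟨l, q⟩ ⟨rfl, hq1, hq2⟩
    dsimp only at hq1 hq2 k p
    have hc : ((l + 1 : ℕ) - 1 : ℝ) / (l + 1 : ℕ) = l / (l + 1) := by push_cast; ring
    rw [hc]
    have hb : ∀ i, dist (q i) (bary p) ≤ l / (l + 1) * D :=
      hq1 _ _ fun i => (dist_comm _ _).trans_le (dist_bary_le p hp _)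
    have hl : ((l : ℝ) - 1) / l * D ≤ l / (l + 1) * D := by
      refine mul_le_mul_of_nonneg_right ?_ hD
      rcases Nat.eq_zero_or_pos l with rfl | hl
      · simp
      · have : (0 : ℝ) < l := by exact_mod_cast hl
        rw [div_le_div_iff₀ this (by positivity)]
        nlinarith
    refine ⟨rfl, fun y r h i => ?_, fun i j => ?_⟩
    · refine Fin.cases ?_ (fun i => ?_) i
      · exact dist_aff_le p _ h
      · exact hq1 y r (fun i => h _) i
    · refine Fin.cases ?_ (fun i => ?_) i <;> refine Fin.cases ?_ (fun j => ?_) j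
      · simp only [Tuple.cons, Fin.cons_zero, dist_self]
        positivity
      · simpa [Tuple.cons, dist_comm] using hb j
      · simpa [Tuple.cons] using hb i
      · simpa [Tuple.cons] using (hq2 i j).trans hl

lemma sdChain_iterate_mem_fine {n : ℕ} {D : ℝ} (hD : 0 ≤ D) {m : ℕ} (p : Fin m → Simp n)
    (hp : ∀ i j, dist (p i) (p j) ≤ D) (a : A) (k : ℕ) :
    (sdChain R)^[k] (Finsupp.single ⟨m, p⟩ a) ∈
      Finsupp.supported A R (fineTuples p (((m - 1) / m) ^ k * D)) := by
  induction k with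
  | zero => exact Finsupp.single_mem_supported _ _ ⟨rfl, fun _ _ h => h, by simpa using hp⟩
  | succ k ih =>
    rw [Function.iterate_succ_apply']
    refine lsum_mem R (fun q hq b => ?_) ih
    obtain ⟨l, q⟩ := q
    obtain ⟨rfl, hq1, hq2⟩ := hq
    dsimp only at hq1 hq2 p
    have h0 : (0 : ℝ) ≤ (l - 1) / l := by
      rcases Nat.eq_zero_or_pos l with rfl | hl
      · simp
      · have : (1 : ℝ) ≤ l := by exact_mod_cast hl
        exact div_nonneg (by linarith) (by linarith)
    refine Finsupp.supported_mono ?_ (sdTuple_mem_fine R (by positivity) l q hq2 b)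
    rintro ⟨_, t⟩ ⟨rfl, ht1, ht2⟩
    refine ⟨rfl, fun y r h => ht1 y r (hq1 y r h), fun i j => (ht2 i j).trans (le_of_eq ?_)⟩
    rw [pow_succ]
    ring

/-- The singular simplices that lie in a member of the family `U`. -/
def smallSing {ι : Type*} (U : ι → Set X) : Set (Sing X) := {s | ∃ i, ∀ x, s.2 x ∈ U i}

lemma isSieve_smallSing {ι : Type*} (U : ι → Set X) : IsSieve (smallSing U) := by
  rintro n s ⟨i, hi⟩ m g
  exact ⟨i, fun x => hi _⟩

lemma sd_iterate_push_realize {K : Type*} [TopologicalSpace K] [AffSpace K] (s : C(K, X))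
    (c : Tuple K →₀ A) (k : ℕ) :
    (sd R)^[k] (push R s (realize R c)) = push R s (realize R ((sdChain R)^[k] c)) := by
  induction k with
  | zero => rfl
  | succ k ih => rw [Function.iterate_succ_apply', ih, Function.iterate_succ_apply',
      sd_push_realize]

lemma dist_simp_le_one {n : ℕ} (x y : Simp n) : dist x y ≤ 1 := by
  rw [Subtype.dist_eq]
  refine (dist_pi_le_iff zero_le_one).2 fun i => ?_
  exact Real.dist_le_of_mem_Icc_01 (mem_Icc_of_mem_stdSimplex x.2 i)
    (mem_Icc_of_mem_stdSimplex y.2 i)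

/-- Every singular chain becomes small after sufficiently many subdivisions. -/
lemma exists_sd_iterate_mem_small {ι : Type*} {U : ι → Set X} (hU : ∀ i, IsOpen (U i))
    (hcov : ∀ x, ∃ i, x ∈ U i) (c : Sing X →₀ A) :
    ∃ k, (sd R)^[k] c ∈ Finsupp.supported A R (smallSing U) := by
  have mono : ∀ (c : Sing X →₀ A) k l, (sd R)^[k] c ∈ Finsupp.supported A R (smallSing U) →
      (sd R)^[l + k] c ∈ Finsupp.supported A R (smallSing U) := by
    intro c k l h
    induction l with
    | zero => simpa using h
    | succ l ih =>
      rw [Nat.succ_add, Function.iterate_succ_apply']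
      exact (isSieve_smallSing U).sd_mem R ih
  induction c using sing_induction with
  | h0 => exact ⟨0, by simp⟩
  | hadd c d hc hd =>
    obtain ⟨k, hk⟩ := hc
    obtain ⟨l, hl⟩ := hd
    refine ⟨l + k, ?_⟩
    rw [iterate_map_add (sd R)]
    refine add_mem (mono c k l hk) ?_
    rw [add_comm]
    exact mono d l k hl
  | hsingle n s a =>
    obtain ⟨δ, hδ, h⟩ := lebesgue_number_lemma_of_metric (isCompact_univ (X := Simp n))
      (c := fun i => s ⁻¹' U i) (fun i => (hU i).preimage s.continuous)
      (fun x _ => Set.mem_iUnion.2 (hcov (s x)))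
    obtain ⟨k, hk⟩ := exists_pow_lt_of_lt_one hδ
      (show ((n + 1 : ℕ) - 1 : ℝ) / (n + 1 : ℕ) < 1 by
        rw [div_lt_one (by positivity)]; linarith)
    refine ⟨k, ?_⟩
    rw [← push_realize_tautTuple R, sd_iterate_push_realize]
    have h1 := sdChain_iterate_mem_fine R zero_le_one (vertices n)
      (fun i j => dist_simp_le_one _ _) a k
    have h2 : realize R ((sdChain R)^[k] (tautTuple n a)) ∈
        Finsupp.supported A R (smallSing fun i => s ⁻¹' U i) := by
      refine lsum_mem R (fun q hq b => ?_) h1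
      obtain ⟨l, q⟩ := q
      obtain ⟨rfl, -, hq⟩ := hq
      refine Finsupp.single_mem_supported _ _ ?_
      obtain ⟨i, hi⟩ := h (q 0) (Set.mem_univ _)
      refine ⟨i, fun x => hi ?_⟩
      rw [mul_one] at hq
      exact (dist_aff_le q x fun j => hq j 0).trans_lt hk
    exact push_mem R (fun t ht => ht) h2

/-- Up to a boundary, a chain whose boundary is supported on a sieve `P` is the sum of a small chain
and of a chain supported on `P`. -/
theorem exists_small_add_bd {ι : Type*} {U : ι → Set X} (hU : ∀ i, IsOpen (U i))
    (hcov : ∀ x, ∃ i, x ∈ U i) {P : Set (Sing X)} (hP : IsSieve P) (y : Sing X →₀ A)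
    (hy : bd R y ∈ Finsupp.supported A R P) :
    ∃ z ∈ Finsupp.supported A R (smallSing U), ∃ w, bd R z ∈ Finsupp.supported A R P ∧
      y - z - bd R w ∈ Finsupp.supported A R P := by
  have h : ∀ k, bd R ((sd R)^[k] y) ∈ Finsupp.supported A R P ∧
      ∃ w, y - (sd R)^[k] y - bd R w ∈ Finsupp.supported A R P := by
    intro k
    induction k with
    | zero => exact ⟨hy, 0, by simp⟩
    | succ k ih =>
      obtain ⟨h1, w, hw⟩ := ih
      rw [Function.iterate_succ_apply']
      refine ⟨by rw [bd_sd]; exact hP.sd_mem R h1, w + sdHtpy R ((sd R)^[k] y), ?_⟩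
      have := add_mem hw (hP.sdHtpy_mem R h1)
      rw [map_add, bd_sdHtpy]
      convert this using 1
      abel
  obtain ⟨k, hk⟩ := exists_sd_iterate_mem_small R hU hcov y
  obtain ⟨h1, w, hw⟩ := h k
  exact ⟨_, hk, w, h1, hw⟩

end Small

/-! ### Cubes relative to their boundaries -/

section Cube

open unitInterval

/-- The cube of dimension `k`. -/
abbrev Cube (k : ℕ) : Type := Fin k → unitInterval

/-- The inclusion of the face of a cube on which coordinate `i` is equal to `e`. -/
def cubeFace {k : ℕ} (i : Fin (k + 1)) (e : unitInterval) : C(Cube k, Cube (k + 1)) where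
  toFun x := i.insertNth e x
  continuous_toFun := by fun_prop

lemma cubeFace_apply_self {k : ℕ} (i : Fin (k + 1)) (e : unitInterval) (x : Cube k) :
    cubeFace i e x i = e := by
  simp [cubeFace]

lemma cubeFace_zero_apply_zero {k : ℕ} (e : unitInterval) (x : Cube k) :
    cubeFace 0 e x 0 = e := by
  simp [cubeFace]

lemma cubeFace_zero_apply_succ {k : ℕ} (e : unitInterval) (x : Cube k) (i : Fin k) :
    cubeFace 0 e x i.succ = x i := by
  simp [cubeFace]

/-- The cylinder on a cube is a cube, the height being the coordinate with index `0`. -/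
def cubeCons (k : ℕ) : C(Cube k × unitInterval, Cube (k + 1)) where
  toFun p := Fin.cons p.2 p.1
  continuous_toFun := by fun_prop

lemma cubeCons_slice (k : ℕ) (e : unitInterval) :
    (cubeCons k).comp (slice (Cube k) e) = cubeFace 0 e := by
  ext x i
  simp [cubeCons, slice, cubeFace, Fin.insertNth_zero']

lemma cubeCons_comp_cubeFace {k : ℕ} (i : Fin (k + 1)) (e : unitInterval) :
    (cubeCons (k + 1)).comp (prodI (cubeFace i e)) = (cubeFace i.succ e).comp (cubeCons k) := by
  refine ContinuousMap.ext fun x => funext fun j => ?_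
  change (Fin.cons x.2 (i.insertNth e x.1 : Cube (k + 1)) : Cube (k + 2)) j =
    (i.succ.insertNth e (Fin.cons x.2 x.1 : Cube (k + 1)) : Cube (k + 2)) j
  refine Fin.cases ?_ (fun j => ?_) j
  · rw [← Fin.succ_succAbove_zero i, Fin.insertNth_apply_succAbove]
    simp
  · rw [Fin.cons_succ]
    rcases Fin.eq_self_or_eq_succAbove i j with rfl | ⟨j, rfl⟩
    · simp
    · rw [← Fin.succ_succAbove_succ, Fin.insertNth_apply_succAbove,
        Fin.insertNth_apply_succAbove, Fin.cons_succ]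

variable (R : Type*) [Ring R] {A : Type*} [AddCommGroup A] [Module R A]

/-- The fundamental chain of the cube with coefficient in `A`, obtained by iterating the prism
operator. -/
def fund : (k : ℕ) → A →ₗ[R] Sing (Cube k) →₀ A
  | 0 => Finsupp.lsingle ⟨0, ContinuousMap.const _ default⟩
  | k + 1 => htpy R (cubeCons k) ∘ₗ fund k

lemma bd_fund_zero (a : A) : bd R (fund R 0 a) = 0 := by simp [fund]

lemma bd_fund_succ_eq_sub (k : ℕ) (a : A) :
    bd R (fund R (k + 1) a) = push R (cubeFace 0 1) (fund R k a) -
      push R (cubeFace 0 0) (fund R k a) - htpy R (cubeCons k) (bd R (fund R k a)) := by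
  rw [fund, LinearMap.comp_apply, bd_htpy, cubeCons_slice, cubeCons_slice]

lemma bd_fund_succ (k : ℕ) (a : A) :
    bd R (fund R (k + 1) a) = ∑ i : Fin (k + 1), (-1 : ℤ) ^ (i : ℕ) •
      (push R (cubeFace i 1) (fund R k a) - push R (cubeFace i 0) (fund R k a)) := by
  induction k with
  | zero => simp [bd_fund_succ_eq_sub, bd_fund_zero]
  | succ k ih =>
    rw [bd_fund_succ_eq_sub, ih, Fin.sum_univ_succ (n := k + 1), map_sum, sub_eq_add_neg,
      ← Finset.sum_neg_distrib]
    simp only [Fin.val_zero, pow_zero, one_smul]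
    congr 1
    refine Finset.sum_congr rfl fun i _ => ?_
    rw [map_zsmul, map_sub, htpy_push, htpy_push, cubeCons_comp_cubeFace, cubeCons_comp_cubeFace,
      ← push_htpy, ← push_htpy, Fin.val_succ, pow_succ, mul_neg_one, neg_smul]
    rfl

/-- The singular simplices that lie in a proper face of the cube. -/
def cubeBdry (k : ℕ) : Set (Sing (Cube k)) :=
  {s | ∃ i, (∀ x, s.2 x i = 0) ∨ ∀ x, s.2 x i = 1}

/-- The singular simplices that lie in a proper face of the cube other than the face on which the
first coordinate is `1`. -/
def cubeBox (k : ℕ) : Set (Sing (Cube (k + 1))) :=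
  {s | (∀ x, s.2 x 0 = 0) ∨ ∃ i : Fin k, (∀ x, s.2 x i.succ = 0) ∨ ∀ x, s.2 x i.succ = 1}

lemma isSieve_cubeBox (k : ℕ) : IsSieve (cubeBox k) := by
  rintro n s h m g
  exact h.imp (fun h x => h _) fun ⟨i, h⟩ => ⟨i, h.imp (fun h x => h _) fun h x => h _⟩

lemma cubeBox_subset (k : ℕ) : cubeBox k ⊆ cubeBdry (k + 1) := by
  rintro s (h | ⟨i, h⟩)
  exacts [⟨0, Or.inl h⟩, ⟨i.succ, h⟩]

lemma mem_of_mem_supported {α : Type*} {P : Set α} {N : Submodule R (α →₀ A)}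
    (h : ∀ x ∈ P, ∀ a, Finsupp.single x a ∈ N) {c : α →₀ A} (hc : c ∈ Finsupp.supported A R P) :
    c ∈ N := by
  have := lsum_mem R (F := fun x => Finsupp.lsingle x) (N := N) h hc
  rwa [Finsupp.lsum_apply, show (c.sum fun x a => Finsupp.lsingle (R := R) x a) = c from
    Finsupp.sum_single c] at this

/-- A chain in the boundary of a cube is the sum of a chain in the box and of a chain in the face on
which the first coordinate is `1`. -/
lemma exists_push_cubeFace {k : ℕ} {c : Sing (Cube (k + 1)) →₀ A}
    (hc : c ∈ Finsupp.supported A R (cubeBdry (k + 1))) :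
    ∃ u, c - push R (cubeFace 0 1) u ∈ Finsupp.supported A R (cubeBox k) := by
  have : c ∈ Finsupp.supported A R (cubeBox k) ⊔
      LinearMap.range (push R (A := A) (cubeFace (k := k) 0 1)) := by
    refine mem_of_mem_supported R (fun s hs a => ?_) hc
    by_cases hs' : s ∈ cubeBox k
    · exact Submodule.mem_sup_left (Finsupp.single_mem_supported _ _ hs')
    · refine Submodule.mem_sup_right ⟨Finsupp.single ⟨s.1, ⟨fun x => Fin.tail (s.2 x), by
        exact continuous_pi fun i => (continuous_apply i.succ).comp s.2.continuous⟩⟩ a, ?_⟩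
      have h1 : ∀ x, s.2 x 0 = 1 := by
        obtain ⟨i, h⟩ := hs
        induction i using Fin.cases with
        | zero => exact h.resolve_left fun h => hs' (Or.inl h)
        | succ i => exact absurd (Or.inr ⟨i, h⟩) hs'
      rw [push_single]
      congr 1
      refine Sigma.ext rfl (heq_of_eq (ContinuousMap.ext fun x => ?_))
      change (Fin.insertNth 0 1 (Fin.tail (s.2 x)) : Cube (k + 1)) = s.2 x
      rw [Fin.insertNth_zero', ← h1 x, Fin.cons_self_tail]
  obtain ⟨d, hd, _, ⟨u, rfl⟩, h⟩ := Submodule.mem_sup.1 this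
  exact ⟨u, by rwa [← h, add_sub_cancel_right]⟩

lemma mem_supported_of_push {X Y : Type*} [TopologicalSpace X] [TopologicalSpace Y] {f : C(X, Y)}
    (hf : Function.Injective f) {P : Set (Sing X)} {Q : Set (Sing Y)}
    (h : ∀ s, Sing.map f s ∈ Q → s ∈ P) {c : Sing X →₀ A}
    (hc : push R f c ∈ Finsupp.supported A R Q) : c ∈ Finsupp.supported A R P := by
  classical
  have hinj : Function.Injective (Sing.map f) := by
    rintro ⟨n, s⟩ ⟨m, t⟩ hst
    obtain rfl : n = m := congrArg Sigma.fst hst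
    have h2 : f.comp s = f.comp t := eq_of_heq (Sigma.mk.inj hst).2
    congr 1
    exact ContinuousMap.ext fun x => hf (DFunLike.congr_fun h2 x)
  intro s hs
  refine h s (hc ?_)
  rw [push, Finsupp.lmapDomain_apply, Finset.mem_coe, Finsupp.mapDomain_support_of_injective hinj]
  exact Finset.mem_image_of_mem _ hs

lemma mem_cubeBdry_of_push {k : ℕ} {c : Sing (Cube k) →₀ A}
    (hc : push R (cubeFace 0 1) c ∈ Finsupp.supported A R (cubeBox k)) :
    c ∈ Finsupp.supported A R (cubeBdry k) := by
  refine mem_supported_of_push R (fun x y h => funext fun i => ?_) ?_ hc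
  · rw [← cubeFace_zero_apply_succ 1 x i, h, cubeFace_zero_apply_succ]
  · rintro ⟨n, s⟩ (h | ⟨i, h⟩)
    · exact absurd ((cubeFace_zero_apply_zero _ (s (vertices n 0))).symm.trans
        (h (vertices n 0))) one_ne_zero
    · exact ⟨i, h.imp (fun h x => (cubeFace_zero_apply_succ 1 _ _).symm.trans (h x))
        fun h x => (cubeFace_zero_apply_succ 1 _ _).symm.trans (h x)⟩

/-- The contraction of a cube onto the face on which the first coordinate vanishes. -/
def cubeContract (k : ℕ) : C(Cube (k + 1) × unitInterval, Cube (k + 1)) where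
  toFun p := Fin.cons (σ p.2 * p.1 0) (Fin.tail p.1)
  continuous_toFun := by
    have : Continuous fun p : Cube (k + 1) × unitInterval => Fin.tail p.1 :=
      continuous_pi fun i => (continuous_apply i.succ).comp continuous_fst
    fun_prop

/-- The complex of the cube relative to the box is acyclic. -/
lemma exists_of_bd_mem_cubeBox {k : ℕ} {y : Sing (Cube (k + 1)) →₀ A}
    (hy : bd R y ∈ Finsupp.supported A R (cubeBox k)) :
    ∃ w, y - bd R w ∈ Finsupp.supported A R (cubeBox k) := by
  have h0 : (cubeContract k).comp (slice _ 0) = ContinuousMap.id _ := by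
    refine ContinuousMap.ext fun x => ?_
    simp [cubeContract, slice]
  have h1 : push R ((cubeContract k).comp (slice _ 1)) y ∈ Finsupp.supported A R (cubeBox k) := by
    refine push_mem R (P := Set.univ) (fun s _ => Or.inl fun x => ?_) (by simp)
    change σ 1 * (s.2 x) 0 = 0
    simp
  have h2 : htpy R (cubeContract k) (bd R y) ∈ Finsupp.supported A R (cubeBox k) := by
    refine htpy_mem R (fun n s hs m g => ?_) hy
    rcases hs with h | ⟨i, h⟩
    · refine Or.inl fun x => ?_
      simp only at h
      simp [cubeContract, h]
    · refine Or.inr ⟨i, ?_⟩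
      simp only at h
      simpa [cubeContract, Fin.tail] using h.imp (fun h x => h (g x).1) (fun h x => h (g x).1)
  refine ⟨-htpy R (cubeContract k) y, ?_⟩
  rw [map_neg, bd_htpy, h0, push_id]
  convert sub_mem h1 h2 using 1
  abel

/-- The sum of the coefficients of the points in a singular chain. -/
def augmentation (X : Type*) [TopologicalSpace X] : (Sing X →₀ A) →ₗ[R] A :=
  Finsupp.lsum ℕ fun s => if s.1 = 0 then LinearMap.id else 0

@[simp] lemma augmentation_single {X : Type*} [TopologicalSpace X] {n : ℕ} (s : C(Simp n, X))
    (a : A) : augmentation R X (Finsupp.single ⟨n, s⟩ a) = if n = 0 then a else 0 := by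
  rw [augmentation, Finsupp.lsum_single]
  split_ifs <;> rfl

lemma augmentation_bd {X : Type*} [TopologicalSpace X] (c : Sing X →₀ A) :
    augmentation R X (bd R c) = 0 := by
  induction c using sing_induction with
  | h0 => simp
  | hadd c d hc hd => simp [hc, hd]
  | hsingle n s a =>
    match n with
    | 0 => simp
    | 1 => simp [bd_single_succ, Fin.sum_univ_succ]
    | n + 2 => simp [bd_single_succ]

/-- The tuple of equal points that corresponds to a singular simplex of a point. -/
def constTuple : (Sing (Cube 0) →₀ A) →ₗ[R] Tuple unitInterval →₀ A :=
  Finsupp.lmapDomain A R fun s => ⟨s.1 + 1, fun _ => 0⟩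

@[simp] lemma constTuple_single {n : ℕ} (s : C(Simp n, Cube 0)) (a : A) :
    constTuple R (Finsupp.single ⟨n, s⟩ a) = Finsupp.single ⟨n + 1, fun _ => 0⟩ a := by
  simp [constTuple]

lemma push_realize_constTuple (y : Sing (Cube 0) →₀ A) :
    push R (ContinuousMap.const _ default) (realize R (constTuple R y)) = y := by
  induction y using sing_induction with
  | h0 => simp
  | hadd c d hc hd => simp only [map_add, hc, hd]
  | hsingle n s a =>
    rw [constTuple_single, realize_single_succ, push_single]
    congr 2
    exact ContinuousMap.ext fun x => Subsingleton.elim _ _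

lemma tupleBd_constTuple (y : Sing (Cube 0) →₀ A) :
    tupleBd R (constTuple R y) = constTuple R (bd R y) +
      Finsupp.single ⟨0, Fin.elim0⟩ (augmentation R _ y) := by
  induction y using sing_induction with
  | h0 => simp
  | hadd c d hc hd => simp only [map_add, hc, hd, Finsupp.single_add]; abel
  | hsingle n s a =>
    cases n with
    | zero => simp [tupleBd_single_succ, Subsingleton.elim _ (Fin.elim0 : Fin 0 → unitInterval)]
    | succ n =>
      simp only [constTuple_single, tupleBd_single_succ, bd_single_succ, map_sum, map_zsmul,
        augmentation_single, if_neg n.succ_ne_zero, Finsupp.single_zero, add_zero]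
      rfl

/-- The homology of a point. -/
lemma exists_of_bd_eq_fund_zero {y : Sing (Cube 0) →₀ A} {a : A} (hy : bd R y = fund R 0 a) :
    a = 0 ∧ ∃ b w, y = fund R 0 b + bd R w := by
  have ha : a = 0 := by
    have := congrArg (augmentation R (Cube 0)) hy
    rw [augmentation_bd, fund, Finsupp.lsingle_apply, augmentation_single, if_pos rfl] at this
    exact this.symm
  refine ⟨ha, ?_⟩
  rw [ha, map_zero] at hy
  set b := augmentation R _ y
  have hz : tupleBd R (constTuple R y - Finsupp.single ⟨1, fun _ => 0⟩ b) = 0 := by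
    rw [map_sub, tupleBd_constTuple, hy, map_zero, zero_add, tupleBd_single_succ]
    simp [b, Subsingleton.elim _ (Fin.elim0 : Fin 0 → unitInterval)]
  have h := congrArg (fun c => push R (ContinuousMap.const _ (default : Cube 0)) (realize R c))
    (tupleBd_cone R (0 : unitInterval) (constTuple R y - Finsupp.single ⟨1, fun _ => 0⟩ b))
  simp only [hz, map_zero, sub_zero, ← bd_realize, ← bd_push] at h
  refine ⟨b, _, eq_add_of_sub_eq' (Eq.trans ?_ h.symm)⟩
  rw [map_sub, map_sub, push_realize_constTuple, realize_single_succ, push_single]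
  rfl

/-- The homology of a cube relative to its boundary: it is freely generated by the fundamental
chain. -/
theorem exists_of_bd_sub_fund_mem {k : ℕ} {y : Sing (Cube k) →₀ A} {a : A}
    (hy : bd R y - fund R k a ∈ Finsupp.supported A R (cubeBdry k)) :
    a = 0 ∧ ∃ b w, y - fund R k b - bd R w ∈ Finsupp.supported A R (cubeBdry k) := by
  induction k generalizing a with
  | zero =>
    have h0 : ∀ c : Sing (Cube 0) →₀ A, c ∈ Finsupp.supported A R (cubeBdry 0) → c = 0 := by
      intro c hc
      have : cubeBdry 0 = ∅ := Set.eq_empty_of_forall_notMem fun s ⟨i, _⟩ => i.elim0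
      rwa [this, Finsupp.supported_empty, Submodule.mem_bot] at hc
    obtain ⟨ha, b, w, h⟩ := exists_of_bd_eq_fund_zero R (sub_eq_zero.1 (h0 _ hy))
    refine ⟨ha, b, w, ?_⟩
    rw [h, add_sub_cancel_left, sub_self]
    exact zero_mem _
  | succ k ih =>
    -- The fundamental chain of the cube has boundary that of the top face, modulo the box.
    have hfund : ∀ b : A, bd R (fund R (k + 1) b) - push R (cubeFace 0 1) (fund R k b) ∈
        Finsupp.supported A R (cubeBox k) := by
      intro b
      rw [bd_fund_succ, Fin.sum_univ_succ, Fin.val_zero, pow_zero, one_smul, add_sub_right_comm,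
        sub_sub_cancel_left]
      refine add_mem (neg_mem ?_) (Submodule.sum_mem _ fun i _ => zsmul_mem (sub_mem ?_ ?_) _)
      · exact push_mem R (P := Set.univ)
          (fun s _ => Or.inl fun x => cubeFace_apply_self 0 0 (s.2 x)) (by simp)
      · exact push_mem R (P := Set.univ)
          (fun s _ => Or.inr ⟨i, Or.inr fun x => cubeFace_apply_self _ _ _⟩) (by simp)
      · exact push_mem R (P := Set.univ)
          (fun s _ => Or.inr ⟨i, Or.inl fun x => cubeFace_apply_self _ _ _⟩) (by simp)
    obtain ⟨u, hu⟩ := exists_push_cubeFace R hy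
    have h1 := (isSieve_cubeBox k).bd_mem R hu
    rw [map_sub, map_sub, bd_bd, zero_sub, bd_push] at h1
    have h2 : bd R u - fund R k (-a) ∈ Finsupp.supported A R (cubeBdry k) := by
      refine mem_cubeBdry_of_push R ?_
      have := neg_mem (add_mem h1 (hfund a))
      rw [map_neg, map_sub, map_neg]
      convert this using 1
      abel
    obtain ⟨ha, b, w, h⟩ := ih h2
    have ha : a = 0 := neg_eq_zero.1 ha
    set y₁ := y - fund R (k + 1) b - push R (cubeFace 0 1) w with hy₁
    have h3 : bd R y₁ ∈ Finsupp.supported A R (cubeBox k) := by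
      have h6 : push R (cubeFace 0 1) (u - fund R k b - bd R w) ∈
          Finsupp.supported A R (cubeBox k) := by
        refine push_mem R ?_ h
        rintro ⟨n, s⟩ ⟨i, hs⟩
        exact Or.inr ⟨i, hs.imp (fun hs x => (cubeFace_zero_apply_succ 1 _ _).trans (hs x))
          fun hs x => (cubeFace_zero_apply_succ 1 _ _).trans (hs x)⟩
      rw [ha, map_zero, sub_zero] at hu
      convert sub_mem (add_mem hu h6) (hfund b) using 1
      simp only [hy₁, map_sub, bd_push]
      abel
    obtain ⟨w', hw'⟩ := exists_of_bd_mem_cubeBox R h3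
    refine ⟨ha, b, w', ?_⟩
    have h4 : push R (cubeFace 0 1) w ∈ Finsupp.supported A R (cubeBdry (k + 1)) := by
      refine push_mem R (P := Set.univ) (fun s _ => ?_) (by simp)
      exact ⟨0, Or.inr fun x => cubeFace_apply_self 0 1 (s.2 x)⟩
    convert add_mem (Finsupp.supported_mono (cubeBox_subset k) hw') h4 using 1
    rw [hy₁]
    abel

end Cube

/-! ### The cells of the infinite cyclic cover -/

section Cells

open FiniteSetComplex

lemma intCast_circle (n : ℤ) : ((n : ℝ) : UnitAddCircle) = 0 :=
  (AddCircle.coe_eq_zero_iff 1).2 ⟨n, by simp⟩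

lemma circle_eq_iff {x y : ℝ} : (x : UnitAddCircle) = y ↔ ∃ n : ℤ, x - y = n := by
  rw [← sub_eq_zero, ← AddCircle.coe_sub, AddCircle.coe_eq_zero_iff]
  simp [eq_comm]

/-- A continuous function with integral values on a connected space is constant. -/
lemma exists_eq_of_forall_exists_int {X : Type*} [TopologicalSpace X] [PreconnectedSpace X]
    [Nonempty X] {f : X → ℝ} (hf : Continuous f) (h : ∀ x, ∃ n : ℤ, f x = n) :
    ∃ n : ℤ, ∀ x, f x = n := by
  choose g hg using h
  have hc : Continuous g := by
    rw [Int.isClosedEmbedding_coe_real.isEmbedding.continuous_iff]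
    convert hf using 1
    exact (funext hg).symm
  obtain ⟨x₀⟩ := ‹Nonempty X›
  refine ⟨g x₀, fun x => ?_⟩
  rw [hg, PreconnectedSpace.constant inferInstance hc]

variable {V : Type u} {L : FiniteSetComplex V}

lemma continuous_torusInclusion (σ : L.faces) : Continuous (L.torusInclusion σ) :=
  continuous_iSup_rng continuous_coinduced_rng

lemma torusInclusion_apply (σ : L.faces) (x : σ.1 → UnitAddCircle) (v : σ.1) :
    (L.torusInclusion σ x).1 v = x v :=
  Finsupp.embDomain_apply_self (Function.Embedding.subtype (· ∈ σ.1)) _ v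

lemma torusInclusion_apply_of_notMem (σ : L.faces) (x : σ.1 → UnitAddCircle) {v : V}
    (hv : v ∉ σ.1) : (L.torusInclusion σ x).1 v = 0 := by
  refine Finsupp.embDomain_of_notMem_range _ _ _ ?_
  rintro ⟨w, rfl⟩
  exact hv w.2

lemma cover_ext {p q : L.Cover} (h1 : ∀ v, p.1.1.1 v = q.1.1.1 v) (h2 : p.1.2 = q.1.2) : p = q :=
  Subtype.ext (Prod.ext (Subtype.ext (Finsupp.ext h1)) h2)

variable [LinearOrder V]

/-- The vertices of a simplex, in increasing order. -/
def vtx {k : ℕ} (σ : L.Simplex k) : Fin k ↪o V := σ.1.orderEmbOfFin σ.2.2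

lemma vtx_mem {k : ℕ} (σ : L.Simplex k) (i : Fin k) : vtx σ i ∈ σ.1 :=
  Finset.orderEmbOfFin_mem _ _ _

lemma exists_vtx_eq {k : ℕ} (σ : L.Simplex k) {v : V} (hv : v ∈ σ.1) : ∃ i, vtx σ i = v := by
  have : v ∈ Set.range (σ.1.orderEmbOfFin σ.2.2) := by
    rw [Finset.range_orderEmbOfFin]
    exact hv
  exact this

/-- The face of a simplex opposite to the vertex with index `i`. -/
def faceAt {k : ℕ} (σ : L.Simplex (k + 1)) (i : Fin (k + 1)) : L.Simplex k :=
  σ.face ⟨vtx σ i, vtx_mem σ i⟩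

lemma vtx_faceAt {k : ℕ} (σ : L.Simplex (k + 1)) (i : Fin (k + 1)) (j : Fin k) :
    vtx (faceAt σ i) j = vtx σ (i.succAbove j) := by
  have h := Finset.orderEmbOfFin_unique (s := (faceAt σ i).1) (faceAt σ i).2.2
    (f := fun j => vtx σ (i.succAbove j)) (fun j => ?_)
    ((vtx σ).strictMono.comp (Fin.strictMono_succAbove i))
  · exact (congrFun h j).symm
  · exact Finset.mem_erase.2 ⟨fun h => Fin.succAbove_ne i j ((vtx σ).injective h), vtx_mem σ _⟩

/-- The point of the torus of a simplex whose coordinates are the images of given real numbers in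
the unit interval. -/
def cellPoint {k : ℕ} (σ : L.Simplex k) (x : Cube k) : L.TorusComplex :=
  L.torusInclusion ⟨σ.1, σ.2.1⟩ fun v =>
    ((x ((σ.1.orderIsoOfFin σ.2.2).symm v) : ℝ) : UnitAddCircle)

lemma cellPoint_vtx {k : ℕ} (σ : L.Simplex k) (x : Cube k) (i : Fin k) :
    (cellPoint σ x).1 (vtx σ i) = ((x i : ℝ) : UnitAddCircle) := by
  refine (torusInclusion_apply ⟨σ.1, σ.2.1⟩ _ ⟨vtx σ i, vtx_mem σ i⟩).trans ?_
  have : (⟨vtx σ i, vtx_mem σ i⟩ : σ.1) = σ.1.orderIsoOfFin σ.2.2 i := rfl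
  rw [this, OrderIso.symm_apply_apply]

lemma cellPoint_of_notMem {k : ℕ} (σ : L.Simplex k) (x : Cube k) {v : V} (hv : v ∉ σ.1) :
    (cellPoint σ x).1 v = 0 :=
  torusInclusion_apply_of_notMem _ _ hv

lemma continuous_cellPoint {k : ℕ} (σ : L.Simplex k) : Continuous (cellPoint σ) := by
  refine (continuous_torusInclusion _).comp (continuous_pi fun v => ?_)
  exact (AddCircle.continuous_mk' 1).comp (continuous_subtype_val.comp (continuous_apply _))

lemma torusComplex_sum {k : ℕ} (σ : L.Simplex k) (x : L.TorusComplex) (hx : ∀ v ∉ σ.1, x.1 v = 0)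
    {M : Type*} [AddCommMonoid M] (f : UnitAddCircle → M) (hf : f 0 = 0) :
    (x.1.sum fun _ t => f t) = ∑ i, f (x.1 (vtx σ i)) := by
  have hs : x.1.support ⊆ Finset.univ.map (vtx σ).toEmbedding := by
    intro v hv
    have : v ∈ σ.1 := by
      by_contra h
      exact Finsupp.mem_support_iff.1 hv (hx v h)
    obtain ⟨i, rfl⟩ := exists_vtx_eq σ this
    simp
  rw [Finsupp.sum_of_support_subset _ hs _ fun _ _ => hf, Finset.sum_map]
  rfl

lemma mu_cellPoint {k : ℕ} (σ : L.Simplex k) (x : Cube k) :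
    L.mu (cellPoint σ x) = ((∑ i, (x i : ℝ) : ℝ) : UnitAddCircle) := by
  refine (torusComplex_sum σ _ (fun v hv => cellPoint_of_notMem σ x hv) id rfl).trans ?_
  simp only [id, cellPoint_vtx]
  exact (map_sum (QuotientAddGroup.mk' (AddSubgroup.zmultiples (1 : ℝ))) _ _).symm

/-- The characteristic map of a cell of the infinite cyclic cover. The cells are indexed by the
simplices of `L`, including the empty one, and by the elements of the deck group. -/
def cell {k : ℕ} (c : L.Simplex k × DeckGroup) : C(Cube k, L.Cover) where
  toFun x := ⟨(cellPoint c.1 x, ∑ i, (x i : ℝ) + (c.2.toAdd : ℝ)), by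
    rw [AddCircle.coe_add, intCast_circle, add_zero]
    exact mu_cellPoint _ _⟩
  continuous_toFun := by
    refine Continuous.subtype_mk ((continuous_cellPoint _).prodMk (Continuous.add
      (continuous_finsetSum _ fun i _ => ?_) continuous_const)) _
    exact continuous_subtype_val.comp (continuous_apply i)

lemma cell_eq {k : ℕ} (c : L.Simplex k × DeckGroup) (x : Cube k) (p : L.Cover)
    (h0 : ∀ v ∉ c.1.1, p.1.1.1 v = 0)
    (h1 : ∀ i, p.1.1.1 (vtx c.1 i) = ((x i : ℝ) : UnitAddCircle))
    (h2 : p.1.2 = ∑ i, (x i : ℝ) + (c.2.toAdd : ℝ)) : cell c x = p := by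
  refine cover_ext (fun v => ?_) h2.symm
  by_cases hv : v ∈ c.1.1
  · obtain ⟨i, rfl⟩ := exists_vtx_eq _ hv
    exact (cellPoint_vtx _ _ _).trans (h1 i).symm
  · exact (cellPoint_of_notMem _ _ hv).trans (h0 v hv).symm

/-- The front and the back faces of a cell are cells; the back faces are translated by the generator
of the deck group. -/
lemma cell_comp_cubeFace {k : ℕ} (σ : L.Simplex (k + 1)) (z : DeckGroup) (i : Fin (k + 1))
    (e : unitInterval) (n : ℤ) (he : (e : ℝ) = n) :
    (cell (σ, z)).comp (cubeFace i e) = cell (faceAt σ i, z * Multiplicative.ofAdd n) := by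
  refine ContinuousMap.ext fun x => (cell_eq _ _ _ (fun v hv => ?_) (fun j => ?_) ?_).symm
  · change (cellPoint σ (cubeFace i e x)).1 v = 0
    by_cases h : v ∈ σ.1
    · obtain ⟨j, rfl⟩ := exists_vtx_eq _ h
      obtain rfl : j = i := by
        by_contra hj
        exact hv (Finset.mem_erase.2 ⟨fun h => hj ((vtx σ).injective h), h⟩)
      rw [cellPoint_vtx, cubeFace_apply_self, he, intCast_circle]
    · exact cellPoint_of_notMem _ _ h
  · change (cellPoint σ (cubeFace i e x)).1 (vtx (faceAt σ i) j) = _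
    rw [vtx_faceAt, cellPoint_vtx]
    simp [cubeFace]
  · change ∑ i', ((cubeFace i e x i' : unitInterval) : ℝ) + (z.toAdd : ℝ) = _
    rw [Fin.sum_univ_succAbove _ i, cubeFace_apply_self, he, toAdd_mul, toAdd_ofAdd, Int.cast_add]
    simp only [cubeFace, ContinuousMap.coe_mk, Fin.insertNth_apply_succAbove]
    ring

lemma deckMap_comp_cell {k : ℕ} (σ : L.Simplex k) (y z : DeckGroup) :
    (L.deckMap y).comp (cell (σ, z)) = cell (σ, y * z) := by
  refine ContinuousMap.ext fun x => cover_ext (fun v => rfl) ?_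
  change ∑ i, (x i : ℝ) + (z.toAdd : ℝ) + (y.toAdd : ℝ) = ∑ i, (x i : ℝ) + ((y * z).toAdd : ℝ)
  rw [toAdd_mul, Int.cast_add]
  ring

/-! ### Singular simplices that factor through cells -/

/-- The singular simplices that lift to a cube of dimension less than `k`. -/
def cellular (L : FiniteSetComplex V) (k : ℕ) : Set (Sing L.Cover) :=
  {s | ∃ j < k, ∃ (c : L.Simplex j × DeckGroup) (t : C(Simp s.1, Cube j)), s.2 = (cell c).comp t}

lemma isSieve_cellular (k : ℕ) : IsSieve (cellular L k) := by
  rintro n s ⟨j, hj, c, t, h⟩ m g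
  exact ⟨j, hj, c, t.comp g, by dsimp only at h; rw [h]; rfl⟩

lemma cellular_mono {k l : ℕ} (h : k ≤ l) : cellular L k ⊆ cellular L l := by
  rintro s ⟨j, hj, hs⟩
  exact ⟨j, hj.trans_le h, hs⟩

/-- A simplex in a proper face of a cell factors through a cell of smaller dimension. -/
lemma map_cell_mem_cellular {k : ℕ} (c : L.Simplex k × DeckGroup) {t : Sing (Cube k)}
    (ht : t ∈ cubeBdry k) : Sing.map (cell c) t ∈ cellular L k := by
  obtain ⟨σ, z⟩ := c
  obtain ⟨n, t⟩ := t
  obtain ⟨i, h⟩ := ht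
  obtain ⟨k, rfl⟩ : ∃ l, k = l + 1 := ⟨k - 1, by have := i.pos; omega⟩
  have key (e : unitInterval) (he : ∀ x, t x i = e) (m : ℤ) (hm : (e : ℝ) = m) :
      (⟨n, (cell (σ, z)).comp t⟩ : Sing L.Cover) ∈ cellular L (k + 1) := by
    refine ⟨k, k.lt_succ_self, (faceAt σ i, z * Multiplicative.ofAdd m),
      ⟨fun x => i.removeNth (t x), ?_⟩, ?_⟩
    · exact continuous_pi fun j => (continuous_apply _).comp t.continuous
    · rw [← cell_comp_cubeFace σ z i e m hm]
      refine ContinuousMap.ext fun x => congrArg (cell (σ, z)) ?_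
      change t x = i.insertNth e (i.removeNth (t x))
      rw [← he x, Fin.insertNth_self_removeNth]
  rcases h with h | h
  · exact key 0 h 0 (by simp)
  · exact key 1 h 1 (by simp)

/-- A simplex of a cube that is not contained in a proper face has a point at which a given
coordinate is neither `0` nor `1`. -/
lemma exists_mem_Ioo {n k : ℕ} {t : C(Simp n, Cube k)} (ht : ⟨n, t⟩ ∉ cubeBdry k) (i : Fin k) :
    ∃ x, (0 : ℝ) < t x i ∧ ((t x i : unitInterval) : ℝ) < 1 := by
  by_contra! h
  refine ht ⟨i, ?_⟩
  by_contra! h'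
  obtain ⟨⟨x, hx⟩, y, hy⟩ := h'
  have hx' : (1 : ℝ) ≤ t x i := h x (unitInterval.pos_iff_ne_zero.2 hx)
  have hy' : ((t y i : unitInterval) : ℝ) ≤ 0 := by
    by_contra! h0
    exact hy (Subtype.ext (le_antisymm (t y i).2.2 (h y h0)))
  have hc : Continuous fun x => ((t x i : unitInterval) : ℝ) :=
    continuous_subtype_val.comp ((continuous_apply i).comp t.continuous)
  obtain ⟨w, hw⟩ := mem_range_of_exists_le_of_exists_ge hc (c := 1 / 2)
    ⟨y, hy'.trans (by norm_num)⟩ ⟨x, le_trans (by norm_num) hx'⟩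
  dsimp only at hw
  have := h w (by rw [hw]; norm_num)
  rw [hw] at this
  norm_num at this

lemma cell_fst {k : ℕ} (c : L.Simplex k × DeckGroup) (x : Cube k) :
    (cell c x).1.1 = cellPoint c.1 x := rfl

lemma coe_ne_zero_of_mem_Ioo {r : ℝ} (h0 : 0 < r) (h1 : r < 1) : (r : UnitAddCircle) ≠ 0 := by
  intro h
  obtain ⟨n, hn⟩ := (AddCircle.coe_eq_zero_iff 1).1 h
  simp only [zsmul_eq_mul, mul_one] at hn
  rw [← hn] at h0 h1
  have h0' : 0 < n := by exact_mod_cast h0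
  have h1' : n < 1 := by exact_mod_cast h1
  omega

lemma subset_of_comp_eq {n k k' : ℕ} {c : L.Simplex k × DeckGroup} {c' : L.Simplex k' × DeckGroup}
    {t : C(Simp n, Cube k)} {t' : C(Simp n, Cube k')} (ht : ⟨n, t⟩ ∉ cubeBdry k)
    (h : (cell c).comp t = (cell c').comp t') : c.1.1 ⊆ c'.1.1 := by
  intro v hv
  by_contra hv'
  obtain ⟨i, rfl⟩ := exists_vtx_eq _ hv
  obtain ⟨x, h0, h1⟩ := exists_mem_Ioo ht i
  have := congrArg (fun p : L.Cover => p.1.1.1 (vtx c.1 i)) (DFunLike.congr_fun h x)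
  simp only [ContinuousMap.comp_apply, cell_fst, cellPoint_vtx, cellPoint_of_notMem _ _ hv'] at this
  exact coe_ne_zero_of_mem_Ioo h0 h1 this

lemma map_cell_notMem_cellular {n k : ℕ} (c : L.Simplex k × DeckGroup) {t : C(Simp n, Cube k)}
    (ht : ⟨n, t⟩ ∉ cubeBdry k) : (⟨n, (cell c).comp t⟩ : Sing L.Cover) ∉ cellular L k := by
  rintro ⟨j, hj, c', t', h⟩
  have := Finset.card_le_card (subset_of_comp_eq ht h)
  rw [c.1.2.2, c'.1.2.2] at this
  omega

/-- The lift of a simplex to a cube is unique if it is not contained in a proper face. -/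
lemma eq_of_comp_eq {n k : ℕ} {c c' : L.Simplex k × DeckGroup} {t t' : C(Simp n, Cube k)}
    (ht : ⟨n, t⟩ ∉ cubeBdry k) (h : (cell c).comp t = (cell c').comp t') : c = c' ∧ t = t' := by
  obtain ⟨σ, z⟩ := c
  obtain ⟨σ', z'⟩ := c'
  obtain rfl : σ = σ' := Subtype.ext (Finset.eq_of_subset_of_card_le (subset_of_comp_eq ht h)
    (by rw [σ.2.2, σ'.2.2]))
  have hcoord : ∀ i x, t x i = t' x i := by
    intro i
    have hint : ∀ x, ∃ m : ℤ, ((t x i : unitInterval) : ℝ) - t' x i = m := by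
      intro x
      rw [← circle_eq_iff, ← cellPoint_vtx σ, ← cellPoint_vtx σ]
      exact congrArg (fun p : L.Cover => p.1.1.1 (vtx σ i)) (DFunLike.congr_fun h x)
    obtain ⟨m, hm⟩ := exists_eq_of_forall_exists_int (by fun_prop) hint
    obtain ⟨x, h0, h1⟩ := exists_mem_Ioo ht i
    have hm0 : m = 0 := by
      have := hm x
      have h2 := (t' x i).2.1
      have h3 := (t' x i).2.2
      have h4 : (m : ℝ) < 1 := by linarith
      have h5 : (-1 : ℝ) < m := by linarith
      have h4' : m < 1 := by exact_mod_cast h4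
      have h5' : -1 < m := by exact_mod_cast h5
      omega
    intro x
    have := hm x
    rw [hm0, Int.cast_zero, sub_eq_zero] at this
    exact Subtype.ext this
  obtain rfl : t = t' := ContinuousMap.ext fun x => funext fun i => hcoord i x
  refine ⟨Prod.ext rfl ?_, rfl⟩
  have := congrArg (fun p : L.Cover => p.1.2) (DFunLike.congr_fun h (vertices n 0))
  change ∑ i, ((t _ i : unitInterval) : ℝ) + (z.toAdd : ℝ) =
    ∑ i, ((t _ i : unitInterval) : ℝ) + (z'.toAdd : ℝ) at this
  exact Multiplicative.toAdd.injective (by exact_mod_cast add_left_cancel this)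

end Cells

/-! ### The cellular chain complex -/

section Cellular

open FiniteSetComplex

variable (R : Type v) [Ring R] {A : Type u} [AddCommGroup A] [Module R A]
variable {V : Type u} {L : FiniteSetComplex V}

/-- The cells of the infinite cyclic cover, of all dimensions. -/
abbrev Cell (L : FiniteSetComplex V) : Type u := Σ k : ℕ, L.Simplex k × DeckGroup

/-- The fundamental chains of the cells of dimension `k` that occur in a cellular chain. -/
def topCubes (k : ℕ) : (Cell L →₀ A) →ₗ[R] L.Simplex k × DeckGroup →₀ Sing (Cube k) →₀ A :=
  Finsupp.mapRange.linearMap (fund R k) ∘ₗ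
    Finsupp.lcomapDomain (Sigma.mk k : _ → Cell L) sigma_mk_injective

lemma topCubes_apply {k : ℕ} (m : Cell L →₀ A) (c : L.Simplex k × DeckGroup) :
    topCubes R k m c = fund R k (m ⟨k, c⟩) := by
  simp [topCubes, Finsupp.lcomapDomain]

variable [LinearOrder V]

/-- The cellular boundary of a cell: the alternating sum of the differences of its opposite
faces. -/
def cellFaces : (c : Cell L) → A →ₗ[R] Cell L →₀ A
  | ⟨0, _⟩ => 0
  | ⟨k + 1, (σ, z)⟩ => ∑ i : Fin (k + 1), (-1 : ℤ) ^ (i : ℕ) •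
      (Finsupp.lsingle ⟨k, faceAt σ i, z * Multiplicative.ofAdd 1⟩ -
        Finsupp.lsingle ⟨k, faceAt σ i, z⟩)

/-- The boundary operator on cellular chains, in all degrees at once. -/
def cellBd : (Cell L →₀ A) →ₗ[R] Cell L →₀ A := Finsupp.lsum ℕ (cellFaces R)

/-- The chain map from cellular to singular chains given by the fundamental chains of cubes. -/
def cellToSing : (Cell L →₀ A) →ₗ[R] Sing L.Cover →₀ A :=
  Finsupp.lsum ℕ fun c => push R (cell c.2) ∘ₗ fund R c.1

@[simp] lemma cellToSing_single {k : ℕ} (c : L.Simplex k × DeckGroup) (a : A) :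
    cellToSing R (Finsupp.single ⟨k, c⟩ a) = push R (cell c) (fund R k a) := by
  simp [cellToSing]

lemma cellBd_single_zero (c : L.Simplex 0 × DeckGroup) (a : A) :
    cellBd R (Finsupp.single ⟨0, c⟩ a) = 0 := by
  simp [cellBd, cellFaces]

lemma cellBd_single_succ {k : ℕ} (σ : L.Simplex (k + 1)) (z : DeckGroup) (a : A) :
    cellBd R (Finsupp.single ⟨k + 1, σ, z⟩ a) = ∑ i : Fin (k + 1), (-1 : ℤ) ^ (i : ℕ) •
      (Finsupp.single ⟨k, faceAt σ i, z * Multiplicative.ofAdd 1⟩ a -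
        Finsupp.single ⟨k, faceAt σ i, z⟩ a) := by
  simp [cellBd, cellFaces, LinearMap.sum_apply]

lemma bd_cellToSing (m : Cell L →₀ A) :
    bd R (cellToSing R m) = cellToSing R (cellBd R m) := by
  induction m using Finsupp.induction_linear with
  | zero => simp
  | add m m' h h' => simp only [map_add, h, h']
  | single c a =>
    obtain ⟨k, σ, z⟩ := c
    cases k with
    | zero => rw [cellToSing_single, bd_push, bd_fund_zero, cellBd_single_zero, map_zero, map_zero]
    | succ k =>
      rw [cellToSing_single, bd_push, bd_fund_succ, cellBd_single_succ, map_sum, map_sum]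
      refine Finset.sum_congr rfl fun i _ => ?_
      simp only [map_zsmul, map_sub, cellToSing_single, ← push_comp]
      rw [cell_comp_cubeFace σ z i 1 1 (by simp), cell_comp_cubeFace σ z i 0 0 (by simp),
        ofAdd_zero, mul_one]

/-- The singular chain of the cover obtained from chains of the cubes of dimension `k`, one for each
cell. -/
def cubesToSing (k : ℕ) :
    (L.Simplex k × DeckGroup →₀ Sing (Cube k) →₀ A) →ₗ[R] Sing L.Cover →₀ A :=
  Finsupp.lsum ℕ fun c => push R (cell c)

lemma cubesToSing_single {k : ℕ} (c : L.Simplex k × DeckGroup) (y : Sing (Cube k) →₀ A) :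
    cubesToSing R k (Finsupp.single c y) = push R (cell c) y := by
  simp [cubesToSing]

lemma bd_cubesToSing {k : ℕ} (Y : L.Simplex k × DeckGroup →₀ Sing (Cube k) →₀ A) :
    bd R (cubesToSing R k Y) = cubesToSing R k (Finsupp.mapRange.linearMap (bd R) Y) := by
  induction Y using Finsupp.induction_linear with
  | zero => simp
  | add m m' h h' => simp only [map_add, h, h']
  | single c y =>
    rw [cubesToSing_single, bd_push, Finsupp.mapRange.linearMap_apply, Finsupp.mapRange_single,
      cubesToSing_single]

lemma exists_cubesToSing {k : ℕ} {y : Sing L.Cover →₀ A}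
    (hy : y ∈ Finsupp.supported A R (cellular L (k + 1))) :
    ∃ Y, y - cubesToSing R k Y ∈ Finsupp.supported A R (cellular L k) := by
  have : y ∈ Finsupp.supported A R (cellular L k) ⊔
      LinearMap.range (cubesToSing R (A := A) (L := L) k) := by
    refine mem_of_mem_supported R ?_ hy
    rintro ⟨n, s⟩ ⟨j, hj, c, t, hs⟩ a
    dsimp only at hs t
    rcases Nat.lt_succ_iff_lt_or_eq.1 hj with hj | rfl
    · exact Submodule.mem_sup_left (Finsupp.single_mem_supported _ _ ⟨j, hj, c, t, hs⟩)
    · refine Submodule.mem_sup_right ⟨Finsupp.single c (Finsupp.single ⟨n, t⟩ a), ?_⟩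
      rw [cubesToSing_single, push_single, hs]
  obtain ⟨d, hd, _, ⟨Y, rfl⟩, h⟩ := Submodule.mem_sup.1 this
  exact ⟨Y, by rwa [← h, add_sub_cancel_right]⟩

/-- The coefficients of a chain of cubes at the simplices that do not lie in proper faces can be
read off from its image in the cover. -/
lemma cubesToSing_apply {n k : ℕ} (Y : L.Simplex k × DeckGroup →₀ Sing (Cube k) →₀ A)
    (c : L.Simplex k × DeckGroup) {t : C(Simp n, Cube k)} (ht : ⟨n, t⟩ ∉ cubeBdry k) :
    cubesToSing R k Y ⟨n, (cell c).comp t⟩ = Y c ⟨n, t⟩ := by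
  classical
  induction Y using Finsupp.induction_linear with
  | zero => simp
  | add m m' h h' => simp only [map_add, Finsupp.add_apply, h, h']
  | single c' y =>
    rw [cubesToSing_single]
    induction y using sing_induction with
    | h0 => simp
    | hadd y y' h h' => simp only [map_add, Finsupp.single_add, Finsupp.add_apply, h, h']
    | hsingle n' t' a =>
      rw [push_single]
      by_cases hn : n' = n
      · subst hn
        by_cases h : (cell c).comp t = (cell c').comp t'
        · obtain ⟨rfl, rfl⟩ := eq_of_comp_eq ht h
          simp
        · have h1 : (⟨n', (cell c).comp t⟩ : Sing L.Cover) ≠ ⟨n', (cell c').comp t'⟩ :=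
            fun h' => h (eq_of_heq (Sigma.mk.inj h').2)
          rw [Finsupp.single_eq_of_ne h1]
          by_cases hc : c = c'
          · subst hc
            rw [Finsupp.single_eq_same, Finsupp.single_eq_of_ne]
            intro h'
            exact h (by rw [eq_of_heq (Sigma.mk.inj h').2])
          · rw [Finsupp.single_eq_of_ne hc, Finsupp.zero_apply]
      · rw [Finsupp.single_eq_of_ne fun h => hn (Sigma.mk.inj h).1.symm, Finsupp.single_apply]
        split_ifs
        · rw [Finsupp.single_eq_of_ne fun h => hn (Sigma.mk.inj h).1.symm]
        · rfl

lemma mem_cubeBdry_of_cubesToSing {k : ℕ} {Y : L.Simplex k × DeckGroup →₀ Sing (Cube k) →₀ A}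
    (hY : cubesToSing R k Y ∈ Finsupp.supported A R (cellular L k))
    (c : L.Simplex k × DeckGroup) : Y c ∈ Finsupp.supported A R (cubeBdry k) := by
  intro t ht
  by_contra htb
  obtain ⟨n, t⟩ := t
  rw [Finset.mem_coe, Finsupp.mem_support_iff, ← cubesToSing_apply R Y c htb] at ht
  exact map_cell_notMem_cellular c htb (hY (Finsupp.mem_support_iff.2 ht))

lemma cellToSing_sub_mem {k : ℕ} {m : Cell L →₀ A}
    (hm : m ∈ Finsupp.supported A R {c | c.1 < k + 1}) :
    cellToSing R m - cubesToSing R k (topCubes R k m) ∈ Finsupp.supported A R (cellular L k) := by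
  have : m ∈ (Finsupp.supported A R (cellular L k)).comap
      (cellToSing R - cubesToSing R k ∘ₗ topCubes R k) := by
    refine mem_of_mem_supported R ?_ hm
    rintro ⟨j, c⟩ hj a
    rw [Submodule.mem_comap, LinearMap.sub_apply, cellToSing_single, LinearMap.comp_apply]
    rcases Nat.lt_succ_iff_lt_or_eq.1 hj with hj | rfl
    · have h0 : topCubes R k (Finsupp.single (⟨j, c⟩ : Cell L) a) = 0 := by
        ext1 c'
        rw [topCubes_apply, Finsupp.single_eq_of_ne, map_zero, Finsupp.zero_apply]
        intro h
        exact hj.ne' (Sigma.mk.inj h).1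
      rw [h0, map_zero, sub_zero]
      refine push_mem R (P := Set.univ) (fun t _ => ?_) (by simp)
      exact ⟨j, hj, c, t.2, rfl⟩
    · have h0 : topCubes R j (Finsupp.single (⟨j, c⟩ : Cell L) a) =
          Finsupp.single c (fund R j a) := by
        classical
        ext1 c'
        rw [topCubes_apply, Finsupp.single_apply, Finsupp.single_apply]
        by_cases h : c = c'
        · subst h
          simp
        · have h1 : (⟨j, c⟩ : Cell L) ≠ ⟨j, c'⟩ := fun h' => h (eq_of_heq (Sigma.mk.inj h').2)
          rw [if_neg h, if_neg h1, map_zero]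
      rw [h0, cubesToSing_single, sub_self]
      exact zero_mem _
  exact this

lemma cellBd_mem {k : ℕ} {m : Cell L →₀ A} (hm : m ∈ Finsupp.supported A R {c | c.1 < k + 1}) :
    cellBd R m ∈ Finsupp.supported A R {c : Cell L | c.1 < k} := by
  refine lsum_mem R ?_ hm
  rintro ⟨j, σ, z⟩ hj a
  cases j with
  | zero => exact zero_mem _
  | succ j =>
    rw [show cellFaces R (⟨j + 1, σ, z⟩ : Cell L) a = _ from
      (by simp [cellBd] : _ = cellBd R (Finsupp.single ⟨j + 1, σ, z⟩ a)), cellBd_single_succ]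
    have : j < k := Nat.lt_of_succ_lt_succ hj
    refine Submodule.sum_mem _ fun i _ => zsmul_mem (sub_mem ?_ ?_) _ <;>
      exact Finsupp.single_mem_supported _ _ this

/-- The mapping cone of `cellToSing`, as a map to the chains on simplices that factor through cells,
is acyclic.  The proof is by induction on the skeleta, using the homology of cubes relative to their
boundaries for each cell. -/
theorem exists_of_bd_eq_cellToSing_of_mem (k : ℕ) {y : Sing L.Cover →₀ A} {m : Cell L →₀ A}
    (hy : y ∈ Finsupp.supported A R (cellular L k)) (hm : m ∈ Finsupp.supported A R {c | c.1 < k})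
    (h : bd R y = cellToSing R m) :
    ∃ m' w, y = cellToSing R m' + bd R w ∧ m = cellBd R m' := by
  induction k generalizing y m with
  | zero =>
    have h1 : cellular L 0 = ∅ := Set.eq_empty_of_forall_notMem fun s ⟨j, hj, _⟩ => by omega
    have h2 : {c : Cell L | c.1 < 0} = ∅ := by simp
    rw [h1, Finsupp.supported_empty, Submodule.mem_bot] at hy
    rw [h2, Finsupp.supported_empty, Submodule.mem_bot] at hm
    exact ⟨0, 0, by simp [hy], by simp [hm]⟩
  | succ k ih =>
    obtain ⟨Y, hY⟩ := exists_cubesToSing R hy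
    have h1 : cubesToSing R k (Finsupp.mapRange.linearMap (bd R) Y - topCubes R k m) ∈
        Finsupp.supported A R (cellular L k) := by
      have := sub_mem (cellToSing_sub_mem R hm) ((isSieve_cellular k).bd_mem R hY)
      rw [← h, map_sub, bd_cubesToSing] at this
      rw [map_sub]
      convert this using 1
      abel
    have h2 : ∀ c, m ⟨k, c⟩ = 0 ∧ ∃ b w, Y c - fund R k b - bd R w ∈
        Finsupp.supported A R (cubeBdry k) := by
      intro c
      refine exists_of_bd_sub_fund_mem R ?_
      have := mem_cubeBdry_of_cubesToSing R h1 c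
      rwa [Finsupp.sub_apply, topCubes_apply, Finsupp.mapRange.linearMap_apply,
        Finsupp.mapRange_apply] at this
    choose h2 b w hbw using h2
    set m₁ : Cell L →₀ A := ∑ c ∈ Y.support, Finsupp.single ⟨k, c⟩ (b c) with hm₁
    set w₁ : Sing L.Cover →₀ A := ∑ c ∈ Y.support, push R (cell c) (w c) with hw₁
    have h3 : y - cellToSing R m₁ - bd R w₁ ∈ Finsupp.supported A R (cellular L k) := by
      have h4 : ∑ c ∈ Y.support, push R (cell c) (Y c - fund R k (b c) - bd R (w c)) ∈
          Finsupp.supported A R (cellular L k) :=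
        Submodule.sum_mem _ fun c _ => push_mem R (fun t ht => map_cell_mem_cellular c ht) (hbw c)
      convert add_mem hY h4 using 1
      simp only [hm₁, hw₁, map_sum, cellToSing_single, map_sub, Finset.sum_sub_distrib, bd_push]
      rw [show cubesToSing R k Y = ∑ c ∈ Y.support, push R (cell c) (Y c) by
        rw [cubesToSing, Finsupp.lsum_apply]; rfl]
      abel
    have h5 : m - cellBd R m₁ ∈ Finsupp.supported A R {c : Cell L | c.1 < k} := by
      refine sub_mem ?_ (cellBd_mem R ?_)
      · rintro ⟨j, c⟩ hc
        rcases Nat.lt_succ_iff_lt_or_eq.1 (hm hc) with hj | rfl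
        · exact hj
        · exact absurd (h2 c) (Finsupp.mem_support_iff.1 hc)
      · exact Submodule.sum_mem _ fun c _ => Finsupp.single_mem_supported _ _ k.lt_succ_self
    obtain ⟨m', w', h6, h7⟩ := ih h3 h5 (by
      rw [map_sub, map_sub, map_sub, bd_bd, h, bd_cellToSing, sub_zero])
    refine ⟨m₁ + m', w₁ + w', ?_, ?_⟩
    · rw [map_add, map_add, add_add_add_comm, ← h6]
      abel
    · rw [map_add, ← h7]
      abel

/-- The singular simplices that lift to a cube. -/
def allCellular (L : FiniteSetComplex V) : Set (Sing L.Cover) := {s | ∃ k, s ∈ cellular L k}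

lemma isSieve_allCellular : IsSieve (allCellular L) := by
  rintro n s ⟨k, hk⟩ m g
  exact ⟨k, isSieve_cellular k hk m g⟩

lemma exists_mem_cellular {y : Sing L.Cover →₀ A}
    (hy : y ∈ Finsupp.supported A R (allCellular L)) :
    ∃ k, y ∈ Finsupp.supported A R (cellular L k) := by
  have h : ∀ s : Sing L.Cover, ∃ k, s ∈ y.support → s ∈ cellular L k := by
    intro s
    by_cases hs : s ∈ y.support
    · exact (hy hs).imp fun k hk _ => hk
    · exact ⟨0, fun h => absurd h hs⟩
  choose k hk using h
  exact ⟨y.support.sup k, fun s hs => cellular_mono (Finset.le_sup hs) (hk s hs)⟩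

theorem exists_of_bd_eq_cellToSing {y : Sing L.Cover →₀ A} {m : Cell L →₀ A}
    (hy : y ∈ Finsupp.supported A R (allCellular L)) (h : bd R y = cellToSing R m) :
    ∃ m' w, y = cellToSing R m' + bd R w ∧ m = cellBd R m' := by
  obtain ⟨k, hk⟩ := exists_mem_cellular R hy
  refine exists_of_bd_eq_cellToSing_of_mem R (max k (m.support.sup fun c => c.1 + 1))
    (Finsupp.supported_mono (cellular_mono (le_max_left _ _)) hk) (fun c hc => ?_) h
  exact (Finset.le_sup (f := fun c : Cell L => c.1 + 1) hc).trans (le_max_right _ _)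

lemma cellToSing_mem (m : Cell L →₀ A) :
    cellToSing R m ∈ Finsupp.supported A R (allCellular L) := by
  refine lsum_mem R (P := Set.univ) (fun c _ a => ?_) (by simp)
  refine push_mem R (P := Set.univ) (fun t _ => ?_) (by simp)
  exact ⟨c.1 + 1, c.1, c.1.lt_succ_self, c.2, t.2, rfl⟩

end Cellular

/-! ### A deformation of the circle -/

section Deformation

open FiniteSetComplex Topology

/-- The displacement of a map from the unit interval to itself that collapses a neighbourhood of
each end point and stretches the rest. -/
def realDisp (x : ℝ) : ℝ := max 0 (min 1 (2 * x - 1 / 2)) - x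

lemma continuous_realDisp : Continuous realDisp := by
  unfold realDisp
  fun_prop

lemma realDisp_zero : realDisp 0 = 0 := by norm_num [realDisp]

lemma realDisp_one : realDisp 1 = 0 := by norm_num [realDisp]

lemma add_realDisp_mem (x : ℝ) : x + realDisp x ∈ Set.Icc (0 : ℝ) 1 := by
  simp only [realDisp, add_sub_cancel]
  exact ⟨le_max_left _ _, max_le zero_le_one (min_le_left _ _)⟩

/-- The displacement, as a function on the circle. -/
def disp : UnitAddCircle → ℝ := AddCircle.liftIco 1 0 realDisp

lemma continuous_disp : Continuous disp :=
  AddCircle.liftIco_zero_continuous (by rw [realDisp_zero, realDisp_one])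
    continuous_realDisp.continuousOn

lemma disp_coe {x : ℝ} (hx : x ∈ Set.Icc (0 : ℝ) 1) : disp (x : UnitAddCircle) = realDisp x := by
  rcases hx.2.eq_or_lt with rfl | h
  · have : ((1 : ℝ) : UnitAddCircle) = ((0 : ℝ) : UnitAddCircle) := AddCircle.coe_period 1
    rw [this, disp, AddCircle.liftIco_zero_coe_apply (by simp), realDisp_zero, realDisp_one]
  · exact AddCircle.liftIco_zero_coe_apply ⟨hx.1, h⟩

lemma disp_zero : disp 0 = 0 := by
  have := disp_coe (x := 0) (by simp)
  rwa [realDisp_zero, AddCircle.coe_zero] at this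

/-- The representative in the unit interval of a displaced point of the circle. -/
def collapse (x : UnitAddCircle) : unitInterval :=
  ⟨(AddCircle.equivIco 1 0 x : ℝ) + realDisp (AddCircle.equivIco 1 0 x), add_realDisp_mem _⟩

lemma coe_collapse (x : UnitAddCircle) :
    (((collapse x : unitInterval) : ℝ) : UnitAddCircle) = x + (disp x : UnitAddCircle) := by
  rw [collapse, AddCircle.coe_add, AddCircle.coe_equivIco]
  rfl

lemma continuousAt_collapse {x : UnitAddCircle} (hx : x ≠ 0) : ContinuousAt collapse x := by
  have h : ContinuousAt (fun x : UnitAddCircle => (AddCircle.equivIco 1 0 x : ℝ)) x :=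
    continuousAt_subtype_val.comp (AddCircle.continuousAt_equivIco 1 0 (by simpa using hx))
  rw [Topology.IsEmbedding.subtypeVal.continuousAt_iff]
  exact h.add (continuous_realDisp.continuousAt.comp h)

/-- The displacement sends a neighbourhood of zero to zero. -/
lemma add_disp_eq_zero {x : UnitAddCircle} (hx : ‖x‖ < 1 / 4) :
    x + (disp x : UnitAddCircle) = 0 := by
  rw [← coe_collapse]
  set r : ℝ := (AddCircle.equivIco 1 0 x : ℝ) with hr
  have h0 : 0 ≤ r := (AddCircle.equivIco 1 0 x).2.1
  have h1 : r < 1 := by simpa using (AddCircle.equivIco 1 0 x).2.2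
  have hxr : (r : UnitAddCircle) = x := AddCircle.coe_equivIco
  rw [← hxr, UnitAddCircle.norm_eq, abs_sub_round_eq_min, Int.fract_eq_self.2 ⟨h0, h1⟩] at hx
  rcases min_lt_iff.1 hx with h | h
  · have : ((collapse x : unitInterval) : ℝ) = ((0 : ℤ) : ℝ) := by
      simp only [collapse, realDisp, add_sub_cancel, ← hr, Int.cast_zero]
      exact max_eq_left ((min_le_right _ _).trans (by linarith))
    rw [this, intCast_circle]
  · have : ((collapse x : unitInterval) : ℝ) = ((1 : ℤ) : ℝ) := by
      simp only [collapse, realDisp, add_sub_cancel, ← hr, Int.cast_one]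
      rw [min_eq_left (by linarith), max_eq_right zero_le_one]
    rw [this, intCast_circle]

/-! ### The induced deformation of the infinite cyclic cover -/

variable {V : Type u} {L : FiniteSetComplex V}

/-- The position at time `s` of a point of the circle. -/
def moveCircle (s : unitInterval) (x : UnitAddCircle) : UnitAddCircle :=
  x + ((s * disp x : ℝ) : UnitAddCircle)

lemma moveCircle_zero (s : unitInterval) : moveCircle s 0 = 0 := by
  simp [moveCircle, disp_zero]

/-- The deformation of `T_L` that moves all coordinates. -/
def moveTorus (p : L.TorusComplex × unitInterval) : L.TorusComplex :=
  ⟨p.1.1.mapRange (moveCircle p.2) (moveCircle_zero p.2),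
    p.1.2.imp fun _ h => ⟨h.1, Finsupp.support_mapRange.trans h.2⟩⟩

/-- The sum of the displacements of all coordinates. -/
def moveSum (p : L.TorusComplex × unitInterval) : ℝ := p.1.1.sum fun _ t => (p.2 : ℝ) * disp t

lemma exists_torusInclusion_eq (x : L.TorusComplex) : ∃ σ y, L.torusInclusion σ y = x := by
  obtain ⟨σ, hσ, hx⟩ := x.2
  refine ⟨⟨σ, hσ⟩, fun v => x.1 v, Subtype.ext (Finsupp.ext fun v => ?_)⟩
  by_cases hv : v ∈ σ
  · exact torusInclusion_apply ⟨σ, hσ⟩ _ ⟨v, hv⟩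
  · rw [torusInclusion_apply_of_notMem _ _ hv]
    by_contra h
    exact hv (hx (Finsupp.mem_support_iff.2 (Ne.symm h)))

lemma sum_torusInclusion (σ : L.faces) (y : σ.1 → UnitAddCircle) {M : Type*} [AddCommMonoid M]
    (f : UnitAddCircle → M) (hf : f 0 = 0) :
    ((L.torusInclusion σ y).1.sum fun _ t => f t) = ∑ v, f (y v) := by
  rw [torusInclusion, Finsupp.sum_embDomain, Finsupp.sum_fintype _ _ fun _ => hf]
  rfl

lemma moveTorus_torusInclusion (σ : L.faces) (y : σ.1 → UnitAddCircle) (s : unitInterval) :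
    moveTorus (L.torusInclusion σ y, s) = L.torusInclusion σ fun v => moveCircle s (y v) := by
  refine Subtype.ext (Finsupp.ext fun v => ?_)
  rw [moveTorus, Finsupp.mapRange_apply]
  by_cases hv : v ∈ σ.1
  · exact (congrArg _ (torusInclusion_apply σ y ⟨v, hv⟩)).trans
      (torusInclusion_apply σ (fun v => moveCircle s (y v)) ⟨v, hv⟩).symm
  · dsimp only
    rw [torusInclusion_apply_of_notMem _ _ hv, torusInclusion_apply_of_notMem _ _ hv,
      moveCircle_zero]

lemma moveSum_torusInclusion (σ : L.faces) (y : σ.1 → UnitAddCircle) (s : unitInterval) :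
    moveSum (L.torusInclusion σ y, s) = ∑ v, (s : ℝ) * disp (y v) :=
  sum_torusInclusion σ y (fun t => (s : ℝ) * disp t) (by rw [disp_zero, mul_zero])

/-- The complex `T_L` is a quotient of the disjoint union of its tori. -/
lemma isQuotientMap_torusInclusion : IsQuotientMap
    fun p : Σ σ : L.faces, σ.1 → UnitAddCircle => L.torusInclusion p.1 p.2 where
  eq_coinduced := by
    change (⨆ σ : L.faces, _) = TopologicalSpace.coinduced _ (⨆ σ, _)
    rw [coinduced_iSup]
    rfl
  surjective x := by
    obtain ⟨σ, y, h⟩ := exists_torusInclusion_eq x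
    exact ⟨⟨σ, y⟩, h⟩

lemma continuous_torusComplex_prod {Y : Type*} [TopologicalSpace Y]
    {g : L.TorusComplex × unitInterval → Y}
    (hg : ∀ σ : L.faces, Continuous fun p : (σ.1 → UnitAddCircle) × unitInterval =>
      g (L.torusInclusion σ p.1, p.2)) : Continuous g := by
  refine isQuotientMap_torusInclusion.continuous_lift_prod_left ?_
  rw [← Homeomorph.sigmaProdDistrib.symm.comp_continuous_iff', continuous_sigma_iff]
  exact hg

lemma continuous_moveCircle {X : Type*} [TopologicalSpace X] {f : X → unitInterval}
    {g : X → UnitAddCircle} (hf : Continuous f) (hg : Continuous g) :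
    Continuous fun x => moveCircle (f x) (g x) :=
  hg.add ((AddCircle.continuous_mk' 1).comp
    ((continuous_subtype_val.comp hf).mul (continuous_disp.comp hg)))

lemma continuous_moveTorus : Continuous (moveTorus (L := L)) := by
  refine continuous_torusComplex_prod fun σ => ?_
  simp only [moveTorus_torusInclusion]
  exact (continuous_torusInclusion σ).comp (continuous_pi fun v =>
    continuous_moveCircle continuous_snd ((continuous_apply v).comp continuous_fst))

lemma continuous_moveSum : Continuous (moveSum (L := L)) := by
  refine continuous_torusComplex_prod fun σ => ?_
  simp only [moveSum_torusInclusion]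
  exact continuous_finsetSum _ fun v _ => (continuous_subtype_val.comp continuous_snd).mul
    (continuous_disp.comp ((continuous_apply v).comp continuous_fst))

lemma mu_moveTorus (p : L.TorusComplex × unitInterval) :
    L.mu (moveTorus p) = L.mu p.1 + (moveSum p : UnitAddCircle) := by
  obtain ⟨x, s⟩ := p
  obtain ⟨σ, y, rfl⟩ := exists_torusInclusion_eq x
  rw [moveTorus_torusInclusion, moveSum_torusInclusion]
  have h (y : σ.1 → UnitAddCircle) : L.mu (L.torusInclusion σ y) = ∑ v, y v :=
    sum_torusInclusion σ y id rfl
  rw [h, h]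
  simp only [moveCircle, Finset.sum_add_distrib]
  congr 1
  exact (map_sum (QuotientAddGroup.mk' (AddSubgroup.zmultiples (1 : ℝ))) _ _).symm

/-- The deformation of the infinite cyclic cover. -/
def deform (L : FiniteSetComplex V) : C(L.Cover × unitInterval, L.Cover) where
  toFun p := ⟨(moveTorus (p.1.1.1, p.2), p.1.1.2 + moveSum (p.1.1.1, p.2)), by
    rw [mu_moveTorus, AddCircle.coe_add]
    exact congrArg (· + _) p.1.2⟩
  continuous_toFun := by
    have h1 : Continuous fun p : L.Cover × unitInterval => p.1.1.1 :=
      continuous_fst.comp (continuous_subtype_val.comp continuous_fst)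
    have h2 : Continuous fun p : L.Cover × unitInterval => p.1.1.2 :=
      continuous_snd.comp (continuous_subtype_val.comp continuous_fst)
    exact Continuous.subtype_mk ((continuous_moveTorus.comp (h1.prodMk continuous_snd)).prodMk
      (h2.add (continuous_moveSum.comp (h1.prodMk continuous_snd)))) _

lemma deform_zero : (deform L).comp (slice L.Cover 0) = ContinuousMap.id L.Cover := by
  refine ContinuousMap.ext fun p => cover_ext (fun v => ?_) ?_
  · change moveCircle 0 (p.1.1.1 v) = p.1.1.1 v
    simp [moveCircle]
  · change p.1.2 + moveSum (p.1.1, 0) = p.1.2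
    simp [moveSum]

/-- The deformation of a cube that moves all coordinates. -/
def cubeDeform (k : ℕ) : C(Cube k × unitInterval, Cube k) where
  toFun p i := ⟨p.1 i + p.2 * realDisp (p.1 i), by
    have h := convex_Icc (0 : ℝ) 1 (p.1 i).2 (add_realDisp_mem (p.1 i))
      (sub_nonneg.2 p.2.2.2) p.2.2.1 (sub_add_cancel _ _)
    convert h using 1
    simp only [smul_eq_mul]
    ring⟩
  continuous_toFun := by
    refine continuous_pi fun i => Continuous.subtype_mk ?_ _
    have h : Continuous fun p : Cube k × unitInterval => ((p.1 i : unitInterval) : ℝ) := by fun_prop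
    exact h.add ((continuous_subtype_val.comp continuous_snd).mul (continuous_realDisp.comp h))

lemma continuous_coord (v : V) : Continuous fun x : L.TorusComplex => x.1 v := by
  refine continuous_iSup_dom.2 fun τ => continuous_coinduced_dom.2 ?_
  by_cases hv : v ∈ τ.1
  · exact (continuous_apply (⟨v, hv⟩ : τ.1)).congr fun y => (torusInclusion_apply τ y ⟨v, hv⟩).symm
  · exact continuous_const.congr fun y => (torusInclusion_apply_of_notMem τ y hv).symm

/-- The points of the cover with non-zero coordinates at the vertices of `σ`, and with all other
coordinates close to zero. -/
def nearCell (L : FiniteSetComplex V) (σ : L.faces) : Set L.Cover :=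
  {p | (∀ v ∈ σ.1, p.1.1.1 v ≠ 0) ∧ ∀ v ∉ σ.1, ‖p.1.1.1 v‖ < 1 / 4}

lemma isOpen_nearCell (σ : L.faces) : IsOpen (nearCell L σ) := by
  have h : IsOpen {x : L.TorusComplex | (∀ v ∈ σ.1, x.1 v ≠ 0) ∧ ∀ v ∉ σ.1, ‖x.1 v‖ < 1 / 4} := by
    refine isOpen_iSup_iff.2 fun τ => isOpen_coinduced.2 ?_
    have h1 : L.torusInclusion τ ⁻¹'
        {x | (∀ v ∈ σ.1, x.1 v ≠ 0) ∧ ∀ v ∉ σ.1, ‖x.1 v‖ < 1 / 4} =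
        {_y | σ.1 ⊆ τ.1} ∩
          ⋂ w : τ.1, {y | (w.1 ∈ σ.1 → y w ≠ 0) ∧ (w.1 ∉ σ.1 → ‖y w‖ < 1 / 4)} := by
      ext y
      simp only [Set.mem_preimage, Set.mem_ofPred_eq, Set.mem_inter_iff, Set.mem_iInter]
      constructor
      · rintro ⟨h1, h2⟩
        refine ⟨fun v hv => ?_, fun w => ⟨fun hw => ?_, fun hw => ?_⟩⟩
        · by_contra h
          exact h1 v hv (torusInclusion_apply_of_notMem _ _ h)
        · rw [← torusInclusion_apply τ y w]
          exact h1 _ hw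
        · rw [← torusInclusion_apply τ y w]
          exact h2 _ hw
      · rintro ⟨h1, h2⟩
        refine ⟨fun v hv => ?_, fun v hv => ?_⟩
        · rw [torusInclusion_apply τ y ⟨v, h1 hv⟩]
          exact (h2 ⟨v, h1 hv⟩).1 hv
        · by_cases hvτ : v ∈ τ.1
          · rw [torusInclusion_apply τ y ⟨v, hvτ⟩]
            exact (h2 ⟨v, hvτ⟩).2 hv
          · rw [torusInclusion_apply_of_notMem _ _ hvτ, norm_zero]
            norm_num
    rw [h1]
    refine isOpen_const.inter (isOpen_iInter_of_finite fun w => ?_)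
    by_cases hw : w.1 ∈ σ.1
    · simp only [hw, true_imp_iff, not_true, false_imp_iff, and_true]
      exact isOpen_compl_singleton.preimage (continuous_apply w)
    · simp only [hw, true_imp_iff, not_false_eq_true, false_imp_iff, true_and]
      exact isOpen_lt (continuous_norm.comp (continuous_apply w)) continuous_const
  exact h.preimage (continuous_fst.comp continuous_subtype_val)

lemma exists_mem_nearCell (p : L.Cover) : ∃ σ, p ∈ nearCell L σ := by
  obtain ⟨τ, hτ, h⟩ := p.1.1.2
  refine ⟨⟨p.1.1.1.support, L.down_closed hτ h⟩, fun v hv => Finsupp.mem_support_iff.1 hv,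
    fun v hv => ?_⟩
  rw [Finsupp.notMem_support_iff.1 hv, norm_zero]
  norm_num

variable [LinearOrder V]

/-- The deformation preserves each cell. -/
lemma deform_comp_cell {k : ℕ} (c : L.Simplex k × DeckGroup) :
    (deform L).comp (prodI (cell c)) = (cell c).comp (cubeDeform k) := by
  refine ContinuousMap.ext fun ⟨x, s⟩ => (cell_eq c _ _ (fun v hv => ?_) (fun i => ?_) ?_).symm
  · change moveCircle s ((cellPoint c.1 x).1 v) = 0
    rw [cellPoint_of_notMem _ _ hv, moveCircle_zero]
  · change moveCircle s ((cellPoint c.1 x).1 (vtx c.1 i)) = _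
    rw [cellPoint_vtx, moveCircle, disp_coe (x i).2, ← AddCircle.coe_add]
    rfl
  · change ∑ i, (x i : ℝ) + (c.2.toAdd : ℝ) + moveSum (cellPoint c.1 x, s) =
      ∑ i, ((x i : ℝ) + s * realDisp (x i)) + (c.2.toAdd : ℝ)
    have h : moveSum (cellPoint c.1 x, s) = ∑ i, (s : ℝ) * realDisp (x i) := by
      refine (torusComplex_sum c.1 _ (fun v hv => cellPoint_of_notMem c.1 x hv)
        (fun t => (s : ℝ) * disp t) (by rw [disp_zero, mul_zero])).trans ?_
      exact Finset.sum_congr rfl fun i _ => by rw [cellPoint_vtx, disp_coe (x i).2]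
    rw [h, Finset.sum_add_distrib]
    ring

/-- The end of the deformation moves each small simplex into a cell. -/
lemma map_deform_mem_allCellular {s : Sing L.Cover} (hs : s ∈ smallSing (nearCell L)) :
    Sing.map ((deform L).comp (slice L.Cover 1)) s ∈ allCellular L := by
  obtain ⟨n, s⟩ := s
  obtain ⟨⟨σ, hσ⟩, h⟩ := hs
  let τ : L.Simplex σ.card := ⟨σ, hσ, rfl⟩
  have hcoord (v : V) : Continuous fun x => (s x).1.1.1 v :=
    (continuous_coord v).comp (continuous_fst.comp (continuous_subtype_val.comp s.continuous))
  let t : C(Simp n, Cube σ.card) :=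
    ⟨fun x i => collapse ((s x).1.1.1 (vtx τ i)), continuous_pi fun i =>
      continuous_iff_continuousAt.2 fun x =>
        ((continuousAt_collapse ((h x).1 _ (vtx_mem τ i))).comp
          (f := fun x => (s x).1.1.1 (vtx τ i)) (hcoord _).continuousAt)⟩
  obtain ⟨q, hqs⟩ : ∃ q, q = ((deform L).comp (slice L.Cover 1)).comp s := ⟨_, rfl⟩
  have hq (x : Simp n) (v : V) : (q x).1.1.1 v = moveCircle 1 ((s x).1.1.1 v) := by
    rw [hqs]
    rfl
  have hq0 (x : Simp n) : ∀ v ∉ σ, (q x).1.1.1 v = 0 := by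
    intro v hv
    rw [hq, moveCircle, Set.Icc.coe_one, one_mul, add_disp_eq_zero ((h x).2 v hv)]
  have hq1 (x : Simp n) (i : Fin σ.card) :
      (q x).1.1.1 (vtx τ i) = (((t x i : unitInterval) : ℝ) : UnitAddCircle) := by
    rw [hq, moveCircle, Set.Icc.coe_one, one_mul]
    exact (coe_collapse _).symm
  -- The real coordinate of the lift differs from the sum of the cube coordinates by an integer,
  -- which is the deck transformation that specifies the cell.
  obtain ⟨m, hm⟩ : ∃ m : ℤ, ∀ x, (q x).1.2 - ∑ i, ((t x i : unitInterval) : ℝ) = m := by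
    refine exists_eq_of_forall_exists_int ?_ fun x => circle_eq_iff.1 ?_
    · have : Continuous fun x => (q x).1.2 :=
        continuous_snd.comp (continuous_subtype_val.comp q.continuous)
      fun_prop
    · rw [← (q x).2]
      refine (torusComplex_sum τ _ (hq0 x) id rfl).trans ?_
      simp only [id, hq1]
      exact (map_sum (QuotientAddGroup.mk' (AddSubgroup.zmultiples (1 : ℝ))) _ _).symm
  have hc (x : Simp n) : cell (τ, Multiplicative.ofAdd m) (t x) = q x := by
    refine cell_eq _ _ _ (hq0 x) (hq1 x) ?_
    rw [toAdd_ofAdd, ← hm x, add_sub_cancel]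
  refine ⟨σ.card + 1, σ.card, σ.card.lt_succ_self, (τ, Multiplicative.ofAdd m), t, ?_⟩
  exact hqs.symm.trans (ContinuousMap.ext fun x => (hc x).symm)

variable (R : Type v) [Ring R] {A : Type u} [AddCommGroup A] [Module R A]

/-- A chain of the cover whose boundary consists of simplices that lift to cubes is the sum of a
boundary and of a chain of the same kind. -/
theorem exists_sub_bd_mem_allCellular {y : Sing L.Cover →₀ A}
    (hy : bd R y ∈ Finsupp.supported A R (allCellular L)) :
    ∃ w, y - bd R w ∈ Finsupp.supported A R (allCellular L) := by
  obtain ⟨z, hz, w, hbz, hzw⟩ :=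
    exists_small_add_bd R isOpen_nearCell exists_mem_nearCell isSieve_allCellular y hy
  have h1 : push R ((deform L).comp (slice L.Cover 1)) z ∈ Finsupp.supported A R (allCellular L) :=
    push_mem R (fun s hs => map_deform_mem_allCellular hs) hz
  have h2 : htpy R (deform L) (bd R z) ∈ Finsupp.supported A R (allCellular L) := by
    refine htpy_mem R ?_ hbz
    rintro n s ⟨k, j, hj, c, t, ht⟩ m g
    dsimp only at ht t
    refine ⟨k, j, hj, c, ((cubeDeform j).comp (prodI t)).comp g, ?_⟩
    rw [ht, prodI_comp, ← ContinuousMap.comp_assoc, deform_comp_cell]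
    rfl
  refine ⟨w - htpy R (deform L) z, ?_⟩
  convert add_mem hzw (sub_mem h1 h2) using 1
  rw [map_sub, bd_htpy, deform_zero, push_id]
  abel

end Deformation

/-! ### Homogeneous components -/

section Degree

variable (R : Type*) [Ring R] {A : Type*} [AddCommGroup A] [Module R A] {α : ℕ → Type*}

/-- The chains that are homogeneous of degree `n`. -/
def homog (A : Type*) [AddCommGroup A] [Module R A] (α : ℕ → Type*) (n : ℕ) :
    Submodule R ((Σ k, α k) →₀ A) :=
  Finsupp.supported A R {s | s.1 = n}

/-- The projection onto the homogeneous chains of degree `n`. -/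
def degProj (n : ℕ) : ((Σ k, α k) →₀ A) →ₗ[R] (Σ k, α k) →₀ A :=
  Finsupp.lsum ℕ fun s => if s.1 = n then Finsupp.lsingle s else 0

lemma degProj_single {n k : ℕ} (s : α k) (a : A) :
    degProj R n (Finsupp.single ⟨k, s⟩ a) = if k = n then Finsupp.single ⟨k, s⟩ a else 0 := by
  rw [degProj, Finsupp.lsum_single]
  split_ifs <;> rfl

lemma degProj_mem (n : ℕ) (c : (Σ k, α k) →₀ A) : degProj R n c ∈ homog R A α n := by
  refine lsum_mem R (P := Set.univ) (fun s _ a => ?_) (by simp)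
  split_ifs with h
  · exact Finsupp.single_mem_supported _ _ h
  · exact zero_mem _

lemma single_mem_homog {n : ℕ} (s : α n) (a : A) : Finsupp.single ⟨n, s⟩ a ∈ homog R A α n :=
  Finsupp.single_mem_supported _ _ rfl

lemma degProj_eq_self {n : ℕ} {c : (Σ k, α k) →₀ A} (hc : c ∈ homog R A α n) :
    degProj R n c = c := by
  have : c ∈ LinearMap.eqLocus (degProj R n) (LinearMap.id (R := R) (M := (Σ k, α k) →₀ A)) := by
    refine mem_of_mem_supported R ?_ hc
    rintro ⟨k, s⟩ rfl a
    rw [LinearMap.mem_eqLocus, degProj_single, if_pos rfl, LinearMap.id_apply]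
  exact this

lemma degProj_eq_zero {n k : ℕ} (hkn : k ≠ n) {c : (Σ k, α k) →₀ A} (hc : c ∈ homog R A α k) :
    degProj R n c = 0 := by
  have : c ∈ LinearMap.ker (degProj (A := A) (α := α) R n) := by
    refine mem_of_mem_supported R ?_ hc
    rintro ⟨k, s⟩ rfl a
    rw [LinearMap.mem_ker, degProj_single, if_neg hkn]
  exact this

/-- A linear map that lowers degrees by one commutes with the projections. -/
lemma map_degProj_succ {β : ℕ → Type*} (f : ((Σ k, α k) →₀ A) →ₗ[R] (Σ k, β k) →₀ A)
    (h0 : ∀ (s : α 0) a, f (Finsupp.single ⟨0, s⟩ a) = 0)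
    (hf : ∀ n (s : α (n + 1)) a, f (Finsupp.single ⟨n + 1, s⟩ a) ∈ homog R A β n) (n : ℕ)
    (c : (Σ k, α k) →₀ A) : f (degProj R (n + 1) c) = degProj R n (f c) := by
  induction c using Finsupp.induction_linear with
  | zero => simp
  | add c d hc hd => simp only [map_add, hc, hd]
  | single s a =>
    obtain ⟨k, s⟩ := s
    cases k with
    | zero => rw [degProj_single, if_neg n.succ_ne_zero.symm, h0, map_zero, map_zero]
    | succ k =>
      rw [degProj_single]
      split_ifs with h
      · obtain rfl := Nat.succ_injective h
        exact (degProj_eq_self R (hf _ _ _)).symm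
      · rw [map_zero, degProj_eq_zero R (fun h' => h (congrArg _ h')) (hf _ _ _)]

/-- A linear map that preserves degrees commutes with the projections. -/
lemma map_degProj {β : ℕ → Type*} (f : ((Σ k, α k) →₀ A) →ₗ[R] (Σ k, β k) →₀ A)
    (hf : ∀ n (s : α n) a, f (Finsupp.single ⟨n, s⟩ a) ∈ homog R A β n) (n : ℕ)
    (c : (Σ k, α k) →₀ A) : f (degProj R n c) = degProj R n (f c) := by
  induction c using Finsupp.induction_linear with
  | zero => simp
  | add c d hc hd => simp only [map_add, hc, hd]
  | single s a =>
    obtain ⟨k, s⟩ := s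
    rw [degProj_single]
    split_ifs with h
    · subst h
      exact (degProj_eq_self R (hf _ _ _)).symm
    · rw [map_zero, degProj_eq_zero R h (hf _ _ _)]

variable {X Y : Type*} [TopologicalSpace X] [TopologicalSpace Y]

/-- The homogeneous singular chains. -/
abbrev singHomog (A : Type*) [AddCommGroup A] [Module R A] (X : Type*) [TopologicalSpace X]
    (n : ℕ) : Submodule R (Sing X →₀ A) := homog R A (fun n => C(Simp n, X)) n

lemma bd_degProj (n : ℕ) (c : Sing X →₀ A) :
    bd R (degProj (α := fun n => C(Simp n, X)) R (n + 1) c) =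
      degProj (α := fun n => C(Simp n, X)) R n (bd R c) := by
  refine map_degProj_succ R (bd R) (bd_single_zero R) (fun n s a => ?_) n c
  rw [bd_single_succ]
  exact Submodule.sum_mem _ fun i _ => zsmul_mem (single_mem_homog R _ _) _

lemma push_mem_homog (f : C(X, Y)) {n : ℕ} {c : Sing X →₀ A} (hc : c ∈ singHomog R A X n) :
    push R f c ∈ singHomog R A Y n :=
  push_mem R (fun _ hs => hs) hc

lemma prismTuple_mem {K I : Type*} (e₀ e₁ : I) (n : ℕ) (p : Fin n → K) (a : A) :
    prismTuple R e₀ e₁ n p a ∈ homog R A (fun n => Fin n → K × I) (n + 1) := by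
  induction n with
  | zero => exact zero_mem _
  | succ n ih =>
    have hcone (v : K × I) {n : ℕ} {c : Tuple (K × I) →₀ A}
        (hc : c ∈ homog R A (fun n => Fin n → K × I) n) :
        cone R v c ∈ homog R A (fun n => Fin n → K × I) (n + 1) :=
      lmapDomain_mem_supported R (fun p hp => congrArg (· + 1) hp) hc
    exact hcone _ (sub_mem (hcone _ (single_mem_homog R _ _)) (ih _))

lemma htpy_mem_homog (h : C(X × unitInterval, Y)) {n : ℕ} {c : Sing X →₀ A}
    (hc : c ∈ singHomog R A X n) : htpy R h c ∈ singHomog R A Y (n + 1) := by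
  refine push_mem_homog R h (lsum_mem R ?_ hc)
  rintro ⟨n, s⟩ rfl a
  refine push_mem_homog R _ (lsum_mem R ?_ (prismTuple_mem R (0 : unitInterval) 1 _ _ a))
  rintro ⟨_, p⟩ rfl b
  exact single_mem_homog R (α := fun n => C(Simp n, _)) _ _

lemma fund_mem (k : ℕ) (a : A) : fund R k a ∈ singHomog R A (Cube k) k := by
  induction k with
  | zero => exact single_mem_homog R (α := fun n => C(Simp n, Cube 0)) _ _
  | succ k ih => exact htpy_mem_homog R _ ih

end Degree

/-! ### The cellular chain complex as an induced complex -/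

section Model

open FiniteSetComplex

variable (R : Type v) [Ring R] {A : Type u} [AddCommGroup A] [Module R A]
variable {V : Type u} {L : FiniteSetComplex V}

/-- The homogeneous cellular chains. -/
abbrev cellHomog (A : Type u) [AddCommGroup A] [Module R A] (L : FiniteSetComplex V) (n : ℕ) :
    Submodule R (Cell L →₀ A) := homog R A (fun n => L.Simplex n × DeckGroup) n

/-- A finitely supported function on the deck group with values in the chains of `L` is a
homogeneous cellular chain. -/
def toCell (n : ℕ) : (DeckGroup →₀ AugChain L A n) →ₗ[R] Cell L →₀ A :=
  Finsupp.lsum ℕ fun z => Finsupp.lmapDomain A R fun σ => (⟨n, σ, z⟩ : Cell L)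

lemma toCell_single {n : ℕ} (z : DeckGroup) (σ : L.Simplex n) (a : A) :
    toCell R n (Finsupp.single z (Finsupp.single σ a)) = Finsupp.single ⟨n, σ, z⟩ a := by
  simp [toCell]

lemma finsupp_induction₂ {n : ℕ} {P : (DeckGroup →₀ AugChain L A n) → Prop}
    (m : DeckGroup →₀ AugChain L A n) (h0 : P 0) (hadd : ∀ c d, P c → P d → P (c + d))
    (h : ∀ z σ a, P (Finsupp.single z (Finsupp.single σ a))) : P m := by
  refine Finsupp.induction_linear m h0 hadd fun z c => ?_
  refine Finsupp.induction_linear c (by simpa using h0) (fun c d hc hd => ?_) fun σ a => h z σ a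
  rw [Finsupp.single_add]
  exact hadd _ _ hc hd

lemma toCell_apply {n : ℕ} (m : DeckGroup →₀ AugChain L A n) (z : DeckGroup) (σ : L.Simplex n) :
    toCell R n m ⟨n, σ, z⟩ = m z σ := by
  classical
  induction m using finsupp_induction₂ with
  | h0 => simp
  | hadd c d hc hd => simp only [map_add, Finsupp.add_apply, hc, hd]
  | h z' σ' a =>
    rw [toCell_single, Finsupp.single_apply, Finsupp.single_apply]
    by_cases hz : z' = z
    · subst hz
      rw [if_pos rfl, Finsupp.single_apply]
      by_cases hσ : σ' = σ
      · subst hσ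
        simp
      · have : (⟨n, σ', z'⟩ : Cell L) ≠ ⟨n, σ, z'⟩ := fun h =>
          hσ (congrArg Prod.fst (eq_of_heq (Sigma.mk.inj h).2))
        rw [if_neg this, if_neg hσ]
    · have : (⟨n, σ', z'⟩ : Cell L) ≠ ⟨n, σ, z⟩ := fun h =>
        hz (congrArg Prod.snd (eq_of_heq (Sigma.mk.inj h).2))
      rw [if_neg this, if_neg hz, Finsupp.zero_apply]

lemma toCell_injective (n : ℕ) : Function.Injective (toCell R (A := A) (L := L) n) := by
  intro m m' h
  ext z σ
  rw [← toCell_apply R, h, toCell_apply]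

lemma toCell_mem (n : ℕ) (m : DeckGroup →₀ AugChain L A n) :
    toCell R n m ∈ cellHomog R A L n := by
  induction m using finsupp_induction₂ with
  | h0 => exact zero_mem _
  | hadd c d hc hd => rw [map_add]; exact add_mem hc hd
  | h z σ a =>
    rw [toCell_single]
    exact single_mem_homog R (α := fun n => L.Simplex n × DeckGroup) _ _

lemma exists_toCell_eq {n : ℕ} {m : Cell L →₀ A} (hm : m ∈ cellHomog R A L n) :
    ∃ m', toCell R n m' = m := by
  have : m ∈ LinearMap.range (toCell R (A := A) (L := L) n) := by
    refine mem_of_mem_supported R ?_ hm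
    rintro ⟨_, σ, z⟩ rfl a
    exact ⟨_, toCell_single R z σ a⟩
  exact this

/-- Multiplication by an element of the deck group on finitely supported functions. -/
def translate (M : Type*) [AddCommGroup M] [Module R M] (z : DeckGroup) :
    (DeckGroup →₀ M) →ₗ[R] DeckGroup →₀ M :=
  Finsupp.lmapDomain M R (z * ·)

@[simp] lemma translate_single {M : Type*} [AddCommGroup M] [Module R M] (z y : DeckGroup) (x : M) :
    translate R M z (Finsupp.single y x) = Finsupp.single (z * y) x := by
  simp [translate]

/-- The generator of the deck group. -/
abbrev gen : DeckGroup := Multiplicative.ofAdd 1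

/-- Multiplication by the difference of the generator of the deck group and `1`. -/
def genSubOne (M : Type*) [AddCommGroup M] [Module R M] :
    (DeckGroup →₀ M) →ₗ[R] DeckGroup →₀ M :=
  translate R M gen - LinearMap.id

lemma genSubOne_single {M : Type*} [AddCommGroup M] [Module R M] (z : DeckGroup) (x : M) :
    genSubOne R M (Finsupp.single z x) = Finsupp.single (gen * z) x - Finsupp.single z x := by
  simp [genSubOne]

variable [LinearOrder V]

lemma card_filter_vtx {k : ℕ} (σ : L.Simplex k) (i : Fin k) :
    (σ.1.filter (· < vtx σ i)).card = i := by
  have : σ.1.filter (· < vtx σ i) = (Finset.Iio i).map (vtx σ).toEmbedding := by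
    ext v
    simp only [Finset.mem_filter, Finset.mem_map, Finset.mem_Iio]
    constructor
    · rintro ⟨hv, h⟩
      obtain ⟨j, rfl⟩ := exists_vtx_eq σ hv
      exact ⟨j, (vtx σ).lt_iff_lt.1 h, rfl⟩
    · rintro ⟨j, hj, rfl⟩
      exact ⟨vtx_mem σ j, (vtx σ).lt_iff_lt.2 hj⟩
  rw [this, Finset.card_map, Fin.card_Iio]

lemma augBoundary_single {n : ℕ} (σ : L.Simplex (n + 1)) (a : A) :
    augBoundary R L A n (Finsupp.single σ a) =
      ∑ i : Fin (n + 1), (-1 : ℤ) ^ (i : ℕ) • Finsupp.single (faceAt σ i) a := by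
  rw [augBoundary, Finsupp.lsum_single, LinearMap.sum_apply,
    ← (σ.1.orderIsoOfFin σ.2.2).toEquiv.sum_comp]
  refine Finset.sum_congr rfl fun i _ => ?_
  rw [LinearMap.smul_apply, Finsupp.lsingle_apply]
  congr 2
  exact card_filter_vtx σ i

lemma cellBd_toCell {n : ℕ} (m : DeckGroup →₀ AugChain L A (n + 1)) :
    cellBd R (toCell R (n + 1) m) =
      toCell R n (genSubOne R _
        (Finsupp.mapRange.linearMap (augBoundary R L A n) m)) := by
  induction m using finsupp_induction₂ with
  | h0 => simp
  | hadd c d hc hd => simp only [map_add, hc, hd]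
  | h z σ a =>
    have hs {ι : Type} (s : Finset ι) (y : DeckGroup) (f : ι → AugChain L A n) :
        Finsupp.single y (∑ i ∈ s, f i) = ∑ i ∈ s, Finsupp.single y (f i) :=
      map_sum (Finsupp.singleAddHom y) _ _
    rw [toCell_single, cellBd_single_succ, Finsupp.mapRange.linearMap_apply,
      Finsupp.mapRange_single, augBoundary_single, genSubOne_single, hs, hs,
      ← Finset.sum_sub_distrib, map_sum]
    refine Finset.sum_congr rfl fun i _ => ?_
    rw [← Finsupp.smul_single, ← Finsupp.smul_single, ← smul_sub, map_zsmul, map_sub, toCell_single,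
      toCell_single, mul_comm]

lemma cellBd_toCell_zero (m : DeckGroup →₀ AugChain L A 0) : cellBd R (toCell R 0 m) = 0 := by
  induction m using finsupp_induction₂ with
  | h0 => simp
  | hadd c d hc hd => simp only [map_add, hc, hd, add_zero]
  | h z σ a => rw [toCell_single, cellBd_single_zero]

lemma cellBd_degProj (n : ℕ) (c : Cell L →₀ A) :
    cellBd R (degProj (α := fun n => L.Simplex n × DeckGroup) R (n + 1) c) =
      degProj (α := fun n => L.Simplex n × DeckGroup) R n (cellBd R c) := by
  refine map_degProj_succ R (cellBd R) (fun s a => cellBd_single_zero R s a) (fun n s a => ?_) n c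
  rw [cellBd_single_succ]
  exact Submodule.sum_mem _ fun i _ => zsmul_mem (sub_mem
    (single_mem_homog R (α := fun n => L.Simplex n × DeckGroup) _ _)
    (single_mem_homog R (α := fun n => L.Simplex n × DeckGroup) _ _)) _

lemma cellBd_degProj_zero (c : Cell L →₀ A) :
    cellBd R (degProj (α := fun n => L.Simplex n × DeckGroup) R 0 c) = 0 := by
  obtain ⟨m, hm⟩ := exists_toCell_eq R (degProj_mem R 0 c)
  rw [← hm, cellBd_toCell_zero]

lemma cellToSing_degProj (n : ℕ) (c : Cell L →₀ A) :
    cellToSing R (degProj (α := fun n => L.Simplex n × DeckGroup) R n c) =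
      degProj (α := fun n => C(Simp n, L.Cover)) R n (cellToSing R c) := by
  refine map_degProj R (cellToSing R) (fun n s a => ?_) n c
  rw [cellToSing_single]
  exact push_mem_homog R _ (fund_mem R n a)

/-- The chain map from the induced complex to singular chains, in degree `n`. -/
def indToSing (n : ℕ) : (DeckGroup →₀ AugChain L A n) →ₗ[R] Sing L.Cover →₀ A :=
  cellToSing R ∘ₗ toCell R n

lemma indToSing_mem (n : ℕ) (m : DeckGroup →₀ AugChain L A n) :
    indToSing R n m ∈ singHomog R A L.Cover n := by
  rw [indToSing, LinearMap.comp_apply, ← degProj_eq_self R (toCell_mem R n m), cellToSing_degProj]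
  exact degProj_mem R n _

lemma bd_indToSing_zero (m : DeckGroup →₀ AugChain L A 0) : bd R (indToSing R 0 m) = 0 := by
  rw [indToSing, LinearMap.comp_apply, bd_cellToSing, cellBd_toCell_zero, map_zero]

lemma bd_indToSing {n : ℕ} (m : DeckGroup →₀ AugChain L A (n + 1)) :
    bd R (indToSing R (n + 1) m) = indToSing R n (genSubOne R _
        (Finsupp.mapRange.linearMap (augBoundary R L A n) m)) := by
  rw [indToSing, LinearMap.comp_apply, bd_cellToSing, cellBd_toCell]
  rfl

lemma push_deckMap_indToSing (z : DeckGroup) {n : ℕ} (m : DeckGroup →₀ AugChain L A n) :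
    push R (L.deckMap z) (indToSing R n m) = indToSing R n (translate R _ z m) := by
  induction m using finsupp_induction₂ with
  | h0 => simp
  | hadd c d hc hd => simp only [map_add, hc, hd]
  | h y σ a =>
    simp only [indToSing, LinearMap.comp_apply, toCell_single, cellToSing_single, translate_single,
      ← push_comp, deckMap_comp_cell]

/-- The chain map from the induced complex to singular chains is surjective on homology. -/
theorem exists_eq_indToSing_add_bd {n : ℕ} {y : Sing L.Cover →₀ A}
    (hy : y ∈ singHomog R A L.Cover n) (h : bd R y = 0) :
    ∃ m w, cellBd R (toCell R n m) = 0 ∧ w ∈ singHomog R A L.Cover (n + 1) ∧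
      y = indToSing R n m + bd R w := by
  obtain ⟨w, hw⟩ := exists_sub_bd_mem_allCellular R (y := y) (by rw [h]; exact zero_mem _)
  obtain ⟨m, w', h1, h2⟩ := exists_of_bd_eq_cellToSing R (m := 0) hw
    (by rw [map_sub, bd_bd, h, sub_zero, map_zero])
  obtain ⟨m', hm'⟩ := exists_toCell_eq R (degProj_mem R n m)
  refine ⟨m', degProj R (n + 1) (w' + w), ?_, degProj_mem R _ _, ?_⟩
  · rw [hm']
    cases n with
    | zero => exact cellBd_degProj_zero R m
    | succ n => rw [cellBd_degProj, ← h2, map_zero]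
  · rw [indToSing, LinearMap.comp_apply, hm', cellToSing_degProj, bd_degProj, map_add (bd R),
      ← map_add (degProj R n), ← add_assoc, ← h1, sub_add_cancel]
    exact (degProj_eq_self R hy).symm

/-- The chain map from the induced complex to singular chains is injective on homology. -/
theorem exists_eq_of_indToSing_eq_bd {n : ℕ} {m : DeckGroup →₀ AugChain L A n}
    {w : Sing L.Cover →₀ A} (h : indToSing R n m = bd R w) :
    ∃ m', m = genSubOne R _
      (Finsupp.mapRange.linearMap (augBoundary R L A n) m') := by
  obtain ⟨w', hw'⟩ := exists_sub_bd_mem_allCellular R (y := w)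
    (by rw [← h]; exact cellToSing_mem R _)
  obtain ⟨m₁, _, -, h2⟩ := exists_of_bd_eq_cellToSing R (m := toCell R n m) hw'
    (by rw [map_sub, bd_bd, ← h, sub_zero]; rfl)
  obtain ⟨m', hm'⟩ := exists_toCell_eq R (degProj_mem R (n + 1) m₁)
  refine ⟨m', toCell_injective R n ?_⟩
  rw [← cellBd_toCell, hm', cellBd_degProj, ← h2, degProj_eq_self R (toCell_mem R n m)]

end Model

/-! ### Homology classes in complexes of modules -/

section HomologyClasses

variable {R : Type v} [Ring R] (K : ChainComplex (ModuleCat.{u} R) ℕ) {n : ℕ}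
variable {M : Type u} [AddCommGroup M] [Module R M]

/-- The map to homology induced by a linear map with values in cycles. -/
def homologyLift (f : M →ₗ[R] K.X n)
    (hf : ∀ x, K.d n ((ComplexShape.down ℕ).next n) (f x) = 0) : M →ₗ[R] K.homology n :=
  (K.liftCycles (ModuleCat.ofHom f) _ rfl (ModuleCat.hom_ext (LinearMap.ext hf)) ≫
    K.homologyπ n).hom

lemma iCycles_liftCycles_apply (f : M →ₗ[R] K.X n)
    (hf : ∀ x, K.d n ((ComplexShape.down ℕ).next n) (f x) = 0) (x : M) :
    K.iCycles n (K.liftCycles (ModuleCat.ofHom f) _ rfl (ModuleCat.hom_ext (LinearMap.ext hf)) x) =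
      f x := by
  rw [← ConcreteCategory.comp_apply, HomologicalComplex.liftCycles_i]
  rfl

lemma iCycles_injective : Function.Injective (K.iCycles n) :=
  (ModuleCat.mono_iff_injective _).1 inferInstance

lemma iCycles_toCycles_apply (y : K.X (n + 1)) :
    K.iCycles n (K.toCycles (n + 1) n y) = K.d (n + 1) n y := by
  rw [← ConcreteCategory.comp_apply, HomologicalComplex.toCycles_i]

lemma homologyπ_eq_zero_iff (z : K.cycles n) :
    K.homologyπ n z = 0 ↔ ∃ y, K.iCycles n z = K.d (n + 1) n y := by
  have hex : (ShortComplex.mk _ _ (K.toCycles_comp_homologyπ (n + 1) n)).Exact :=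
    ShortComplex.exact_of_g_is_cokernel _ (K.homologyIsCokernel (n + 1) n (by simp))
  rw [ShortComplex.moduleCat_exact_iff] at hex
  constructor
  · intro h
    obtain ⟨y, hy⟩ := hex z h
    exact ⟨y, by rw [← hy]; exact iCycles_toCycles_apply K y⟩
  · rintro ⟨y, hy⟩
    have : z = K.toCycles (n + 1) n y :=
      iCycles_injective K (by rw [hy, iCycles_toCycles_apply])
    rw [this, ← ConcreteCategory.comp_apply, HomologicalComplex.toCycles_comp_homologyπ]
    rfl

variable (f : M →ₗ[R] K.X n) (hf : ∀ x, K.d n ((ComplexShape.down ℕ).next n) (f x) = 0)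

lemma homologyLift_eq_zero_iff (x : M) :
    homologyLift K f hf x = 0 ↔ ∃ y, f x = K.d (n + 1) n y := by
  refine (homologyπ_eq_zero_iff K _).trans (exists_congr fun y => ?_)
  exact ⟨(iCycles_liftCycles_apply K f hf x).symm.trans, (iCycles_liftCycles_apply K f hf x).trans⟩

lemma homologyLift_surjective
    (h : ∀ x, K.d n ((ComplexShape.down ℕ).next n) x = 0 → ∃ m y, x = f m + K.d (n + 1) n y) :
    Function.Surjective (homologyLift K f hf) := by
  intro c
  obtain ⟨z, rfl⟩ := (ModuleCat.epi_iff_surjective (K.homologyπ n)).1 inferInstance c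
  have hz : K.d n ((ComplexShape.down ℕ).next n) (K.iCycles n z) = 0 := by
    rw [← ConcreteCategory.comp_apply, HomologicalComplex.iCycles_d]
    rfl
  obtain ⟨m, y, hm⟩ := h _ hz
  refine ⟨m, ?_⟩
  have : K.homologyπ n (z - K.liftCycles (ModuleCat.ofHom f) _ rfl
      (ModuleCat.hom_ext (LinearMap.ext hf)) m) = 0 := by
    refine (homologyπ_eq_zero_iff K _).2 ⟨y, ?_⟩
    rw [map_sub, iCycles_liftCycles_apply K f hf, hm, add_sub_cancel_left]
  rw [map_sub, sub_eq_zero] at this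
  exact this.symm

lemma homologyMap_homologyLift {L : ChainComplex (ModuleCat.{u} R) ℕ} (φ : K ⟶ L)
    {M' : Type u} [AddCommGroup M'] [Module R M'] (f' : M' →ₗ[R] L.X n)
    (hf' : ∀ x, L.d n ((ComplexShape.down ℕ).next n) (f' x) = 0) (x : M) (x' : M')
    (h : φ.f n (f x) = f' x') :
    HomologicalComplex.homologyMap φ n (homologyLift K f hf x) = homologyLift L f' hf' x' := by
  change HomologicalComplex.homologyMap φ n (K.homologyπ n _) = L.homologyπ n _
  rw [← ConcreteCategory.comp_apply, HomologicalComplex.homologyπ_naturality,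
    ConcreteCategory.comp_apply]
  congr 1
  apply iCycles_injective L
  rw [← ConcreteCategory.comp_apply, HomologicalComplex.cyclesMap_i, ConcreteCategory.comp_apply]
  exact ((congrArg (φ.f n) (iCycles_liftCycles_apply K f hf x)).trans h).trans
    (iCycles_liftCycles_apply L f' hf' x').symm

end HomologyClasses

/-! ### The singular chain complex -/

section SingularComplex

open Opposite Simplicial

variable (R : Type v) [Ring R] (A : Type u) [AddCommGroup A] [Module R A] (X : TopCat.{u})

/-- The singular chain complex of a space, as defined by coproducts. -/
abbrev singComplex : ChainComplex (ModuleCat.{u} R) ℕ :=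
  (TopCat.toSSet.obj X).chainComplex (ModuleCat.of R A)

/-- The singular simplex with values in `X` that corresponds to an element of the singular
simplicial set. -/
def simplexEquiv (n : ℕ) : (TopCat.toSSet.obj X) _⦋n⦌ ≃ C(Simp n, X) := X.toSSetObjEquiv (op ⦋n⦌)

/-- The inclusion of a summand in the module of singular chains. -/
def ιSing {n : ℕ} (s : C(Simp n, X)) : A →ₗ[R] (singComplex R A X).X n :=
  ((TopCat.toSSet.obj X).ιChainComplex (R := ModuleCat.of R A) ((simplexEquiv X n).symm s)).hom

variable {X}

lemma stdSimplex_map_succAbove {n : ℕ} (i : Fin (n + 2)) (x : Simp n) :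
    stdSimplex.map i.succAbove x = faceMap i x := by
  have h (y : Simp n) : stdSimplex.map i.succAbove y = aff (vertices (n + 1) ∘ i.succAbove) y := by
    apply Subtype.ext
    funext j
    change stdSimplex.map i.succAbove y j =
      (∑ k, y.1 k • (vertices (n + 1) (i.succAbove k) : Fin (n + 2) → ℝ)) j
    simp only [stdSimplex.map_coe, FunOnFinite.linearMap_apply_apply, Finset.sum_apply,
      Pi.smul_apply, smul_eq_mul, vertices, stdSimplex.vertex_coe]
    rw [Finset.sum_filter]
    refine Finset.sum_congr rfl fun k _ => ?_
    change _ = _ * (Pi.single (i.succAbove k) (1 : ℝ) : Fin (n + 2) → ℝ) j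
    rw [Pi.single_apply]
    by_cases h : i.succAbove k = j
    · rw [if_pos h, if_pos h.symm, mul_one]
      rfl
    · rw [if_neg h, if_neg (Ne.symm h), mul_zero]
  exact h x

lemma d_ιSing {n : ℕ} (s : C(Simp (n + 1), X)) (a : A) :
    (singComplex R A X).d (n + 1) n (ιSing R A X s a) =
      ∑ i : Fin (n + 2), (-1 : ℤ) ^ (i : ℕ) • ιSing R A X (s.comp (faceMap i)) a := by
  have h := (TopCat.toSSet.obj X).ιChainComplex_d (R := ModuleCat.of R A)
    ((simplexEquiv X (n + 1)).symm s)
  have h' := congrArg (fun g : ModuleCat.of R A ⟶ (singComplex R A X).X n => g.hom a) h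
  refine h'.trans ?_
  rw [ModuleCat.hom_sum, LinearMap.sum_apply]
  refine Finset.sum_congr rfl fun i _ => ?_
  rw [ModuleCat.hom_zsmul, LinearMap.smul_apply]
  congr 1
  rw [ιSing]
  congr 3
  rw [Equiv.eq_symm_apply]
  change ((simplexEquiv X (n + 1)) ((simplexEquiv X (n + 1)).symm s)).comp
    ⟨_, stdSimplex.continuous_map (Fin.succAbove i)⟩ = _
  rw [Equiv.apply_symm_apply]
  refine ContinuousMap.ext fun x => congrArg s ?_
  exact stdSimplex_map_succAbove i x

lemma map_ιSing {Y : TopCat.{u}} (f : X ⟶ Y) {n : ℕ} (s : C(Simp n, X)) (a : A) :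
    (SSet.chainComplexMap (TopCat.toSSet.map f) (ModuleCat.of R A)).f n (ιSing R A X s a) =
      ιSing R A Y (f.hom.comp s) a := by
  have h := SSet.ι_chainComplexMap_f _ _ (TopCat.toSSet.map f) (ModuleCat.of R A)
    ((simplexEquiv X n).symm s)
  refine (congrArg (fun g : ModuleCat.of R A ⟶ (singComplex R A Y).X n => g.hom a) h).trans ?_
  change ((TopCat.toSSet.obj Y).ιChainComplex (R := ModuleCat.of R A) _).hom a =
    ((TopCat.toSSet.obj Y).ιChainComplex (R := ModuleCat.of R A) _).hom a
  congr 3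

variable {A}

/-- The singular chain that corresponds to an element of the singular chain complex. -/
def toSing (n : ℕ) : (singComplex R A X).X n →ₗ[R] Sing X →₀ A :=
  (Limits.Cofan.IsColimit.desc
    ((TopCat.toSSet.obj X).isColimitChainComplexXCofan (ModuleCat.of R A) n)
    (A := ModuleCat.of R (Sing X →₀ A))
    fun s => ModuleCat.ofHom (Finsupp.lsingle (⟨n, simplexEquiv X n s⟩ : Sing X))).hom

lemma toSing_ιSing {n : ℕ} (s : C(Simp n, X)) (a : A) :
    toSing R n (ιSing R A X s a) = Finsupp.single ⟨n, s⟩ a := by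
  have h := Limits.Cofan.IsColimit.fac
    ((TopCat.toSSet.obj X).isColimitChainComplexXCofan (ModuleCat.of R A) n)
    (A := ModuleCat.of R (Sing X →₀ A))
    (fun s => ModuleCat.ofHom (Finsupp.lsingle (⟨n, simplexEquiv X n s⟩ : Sing X)))
    ((simplexEquiv X n).symm s)
  refine (congrArg (fun g : ModuleCat.of R A ⟶ ModuleCat.of R (Sing X →₀ A) => g.hom a) h).trans ?_
  change Finsupp.single (⟨n, simplexEquiv X n ((simplexEquiv X n).symm s)⟩ : Sing X) a = _
  rw [Equiv.apply_symm_apply]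

/-- The element of the singular chain complex in degree `n` that corresponds to the homogeneous
component of a singular chain. -/
def fromSing (n : ℕ) : (Sing X →₀ A) →ₗ[R] (singComplex R A X).X n :=
  (Finsupp.lsum ℕ fun s => ιSing R A X s) ∘ₗ
    Finsupp.lcomapDomain (Sigma.mk n : _ → Sing X) sigma_mk_injective

lemma fromSing_single {n : ℕ} (s : C(Simp n, X)) (a : A) :
    fromSing R n (Finsupp.single ⟨n, s⟩ a) = ιSing R A X s a := by
  have : Finsupp.lcomapDomain (R := R) (Sigma.mk n : _ → Sing X) sigma_mk_injective
      (Finsupp.single ⟨n, s⟩ a) = Finsupp.single s a := by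
    classical
    ext t
    change Finsupp.single (⟨n, s⟩ : Sing X) a ⟨n, t⟩ = _
    rw [Finsupp.single_apply, Finsupp.single_apply]
    by_cases h : s = t
    · rw [if_pos h, if_pos (by rw [h])]
    · have h' : (⟨n, s⟩ : Sing X) ≠ ⟨n, t⟩ := fun h' => h (eq_of_heq (Sigma.mk.inj h').2)
      rw [if_neg h, if_neg h']
  rw [fromSing, LinearMap.comp_apply, this, Finsupp.lsum_single]

lemma linearMap_ext_ιSing {n : ℕ} {M : Type u} [AddCommGroup M] [Module R M]
    {f g : (singComplex R A X).X n →ₗ[R] M}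
    (h : ∀ s a, f (ιSing R A X s a) = g (ιSing R A X s a)) : f = g := by
  have : ModuleCat.ofHom f = ModuleCat.ofHom g := by
    refine SSet.chainComplex_hom_ext fun x => ?_
    ext a
    have := h (simplexEquiv X n x) a
    rw [ιSing, Equiv.symm_apply_apply] at this
    exact this
  exact congrArg ModuleCat.Hom.hom this

lemma fromSing_toSing {n : ℕ} (x : (singComplex R A X).X n) :
    fromSing R n (toSing R n x) = x := by
  have : fromSing R n ∘ₗ toSing R n = LinearMap.id (R := R) (M := (singComplex R A X).X n) :=
    linearMap_ext_ιSing R fun s a => by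
      rw [LinearMap.comp_apply, toSing_ιSing, fromSing_single, LinearMap.id_apply]
  exact LinearMap.congr_fun this x

lemma toSing_fromSing {n : ℕ} {y : Sing X →₀ A} (hy : y ∈ singHomog R A X n) :
    toSing R n (fromSing R n y) = y := by
  have : y ∈ LinearMap.eqLocus (toSing R n ∘ₗ fromSing R n)
      (LinearMap.id (R := R) (M := Sing X →₀ A)) := by
    refine mem_of_mem_supported R ?_ hy
    rintro ⟨_, s⟩ rfl a
    rw [LinearMap.mem_eqLocus, LinearMap.comp_apply, fromSing_single, toSing_ιSing,
      LinearMap.id_apply]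
  exact this

lemma bd_toSing {n : ℕ} (x : (singComplex R A X).X (n + 1)) :
    bd R (toSing R (n + 1) x) = toSing R n ((singComplex R A X).d (n + 1) n x) := by
  have : bd R ∘ₗ toSing R (n + 1) = toSing R n ∘ₗ ((singComplex R A X).d (n + 1) n).hom :=
    linearMap_ext_ιSing R fun s a => by
      rw [LinearMap.comp_apply, LinearMap.comp_apply, toSing_ιSing, bd_single_succ]
      refine Eq.trans ?_ (congrArg (toSing R n) (d_ιSing R A s a)).symm
      simp only [map_sum, map_zsmul, toSing_ιSing]
  exact LinearMap.congr_fun this x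

lemma toSing_mem {n : ℕ} (x : (singComplex R A X).X n) : toSing R n x ∈ singHomog R A X n := by
  have : degProj R n ∘ₗ toSing R n = toSing R n (A := A) (X := X) :=
    linearMap_ext_ιSing R fun s a => by
      rw [LinearMap.comp_apply, toSing_ιSing]
      exact degProj_eq_self R (single_mem_homog R (α := fun n => C(Simp n, X)) s a)
  rw [← this]
  exact degProj_mem R n _

lemma bd_toSing_zero (x : (singComplex R A X).X 0) : bd R (toSing R 0 x) = 0 := by
  have : bd R ∘ₗ toSing R 0 = (0 : (singComplex R A X).X 0 →ₗ[R] _) :=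
    linearMap_ext_ιSing R fun s a => by
      rw [LinearMap.comp_apply, toSing_ιSing, bd_single_zero, LinearMap.zero_apply]
  exact LinearMap.congr_fun this x

lemma toSing_injective (n : ℕ) : Function.Injective (toSing R n (A := A) (X := X)) :=
  Function.LeftInverse.injective (fromSing_toSing R)

/-- An element of the singular chain complex is a cycle if and only if the corresponding singular
chain is. -/
lemma d_next_eq_zero_iff {n : ℕ} (x : (singComplex R A X).X n) :
    (singComplex R A X).d n ((ComplexShape.down ℕ).next n) x = 0 ↔ bd R (toSing R n x) = 0 := by
  cases n with
  | zero =>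
    rw [(singComplex R A X).shape _ _ (by simp)]
    simp only [bd_toSing_zero, iff_true]
    rfl
  | succ n =>
    rw [ChainComplex.next_nat_succ, bd_toSing]
    exact ((toSing_injective R n).eq_iff' (map_zero _)).symm

lemma toSing_map {Y : TopCat.{u}} (f : X ⟶ Y) {n : ℕ} (x : (singComplex R A X).X n) :
    toSing R n ((SSet.chainComplexMap (TopCat.toSSet.map f) (ModuleCat.of R A)).f n x) =
      push R f.hom (toSing R n x) := by
  have : toSing R n ∘ₗ ((SSet.chainComplexMap (TopCat.toSSet.map f) (ModuleCat.of R A)).f n).hom =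
      push R f.hom ∘ₗ toSing R n :=
    linearMap_ext_ιSing R fun s a => by
      rw [LinearMap.comp_apply, LinearMap.comp_apply, toSing_ιSing, push_single]
      exact (congrArg (toSing R n) (map_ιSing R A f s a)).trans (toSing_ιSing R _ a)
  exact LinearMap.congr_fun this x

end SingularComplex

/-! ### Finitely supported functions on the infinite cyclic group -/

section Induced

open FiniteSetComplex

variable (R : Type v) [Ring R]

section Augmentation

variable {M N : Type*} [AddCommGroup M] [Module R M] [AddCommGroup N] [Module R N]

lemma mapRange_translate (f : M →ₗ[R] N) (z : DeckGroup) (m : DeckGroup →₀ M) :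
    Finsupp.mapRange.linearMap f (translate R M z m) =
      translate R N z (Finsupp.mapRange.linearMap f m) := by
  induction m using Finsupp.induction_linear with
  | zero => simp
  | add c d hc hd => simp only [map_add, hc, hd]
  | single y x => simp

lemma mapRange_genSubOne (f : M →ₗ[R] N) (m : DeckGroup →₀ M) :
    Finsupp.mapRange.linearMap f (genSubOne R M m) =
      genSubOne R N (Finsupp.mapRange.linearMap f m) := by
  simp only [genSubOne, LinearMap.sub_apply, map_sub, mapRange_translate, LinearMap.id_apply]

lemma genSubOne_translate (z : DeckGroup) (m : DeckGroup →₀ M) :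
    genSubOne R M (translate R M z m) = translate R M z (genSubOne R M m) := by
  induction m using Finsupp.induction_linear with
  | zero => simp
  | add c d hc hd => simp only [map_add, hc, hd]
  | single y x => simp only [translate_single, genSubOne_single, map_sub, mul_left_comm]

/-- A finitely supported function on an infinite cyclic group that is invariant under translation
is constant, so it vanishes. -/
lemma genSubOne_injective : Function.Injective (genSubOne R M) := by
  rw [injective_iff_map_eq_zero]
  intro m hm
  have hm' : translate R M gen m = m := sub_eq_zero.1 hm
  have hstep (k : ℤ) : m (Multiplicative.ofAdd (k + 1)) = m (Multiplicative.ofAdd k) := by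
    have h := Finsupp.mapDomain_apply (mul_right_injective gen) m (Multiplicative.ofAdd k)
    rw [show Finsupp.mapDomain (gen * ·) m = m from hm', ← ofAdd_add, add_comm] at h
    exact h
  have hconst (k : ℤ) : m (Multiplicative.ofAdd k) = m 1 := by
    induction k using Int.induction_on with
    | zero => rfl
    | succ k ih => rw [hstep, ih]
    | pred k ih => rw [← ih, ← hstep, sub_add_cancel]
  obtain ⟨y, hy⟩ := Infinite.exists_notMem_finset m.support
  ext z
  exact (hconst z.toAdd).trans ((hconst y.toAdd).symm.trans (Finsupp.notMem_support_iff.1 hy))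

/-- The sum of the values of a finitely supported function. -/
def sumValues (M : Type*) [AddCommGroup M] [Module R M] : (DeckGroup →₀ M) →ₗ[R] M :=
  Finsupp.lsum ℕ fun _ => LinearMap.id

lemma sumValues_single (z : DeckGroup) (x : M) :
    sumValues R M (Finsupp.single z x) = x := by
  rw [sumValues, Finsupp.lsum_single, LinearMap.id_apply]

lemma sumValues_translate (z : DeckGroup) (m : DeckGroup →₀ M) :
    sumValues R M (translate R M z m) = sumValues R M m := by
  induction m using Finsupp.induction_linear with
  | zero => simp
  | add c d hc hd => simp only [map_add, hc, hd]
  | single y x => simp only [translate_single, sumValues_single]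

lemma sumValues_genSubOne (m : DeckGroup →₀ M) :
    sumValues R M (genSubOne R M m) = 0 := by
  rw [genSubOne, LinearMap.sub_apply, map_sub, sumValues_translate, LinearMap.id_apply, sub_self]

/-- The sumValues ideal of an infinite cyclic group is generated by the difference of a
generator and `1`. -/
lemma exists_eq_genSubOne_add (m : DeckGroup →₀ M) :
    ∃ c, m = genSubOne R M c + Finsupp.single 1 (sumValues R M m) := by
  induction m using Finsupp.induction_linear with
  | zero => exact ⟨0, by simp⟩
  | add m₁ m₂ h₁ h₂ =>
    obtain ⟨c₁, h₁⟩ := h₁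
    obtain ⟨c₂, h₂⟩ := h₂
    refine ⟨c₁ + c₂, ?_⟩
    rw [map_add, map_add, Finsupp.single_add, add_add_add_comm, ← h₁, ← h₂]
  | single z x =>
    rw [sumValues_single]
    obtain ⟨k, rfl⟩ := Multiplicative.ofAdd.surjective z
    induction k using Int.induction_on with
    | zero => exact ⟨0, by simp⟩
    | succ k ih =>
      obtain ⟨c, hc⟩ := ih
      refine ⟨Finsupp.single (Multiplicative.ofAdd (k : ℤ)) x + c, ?_⟩
      rw [map_add (genSubOne R M), add_assoc, ← hc, genSubOne_single, sub_add_cancel,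
        ← ofAdd_add, add_comm]
    | pred k ih =>
      obtain ⟨c, hc⟩ := ih
      refine ⟨c - Finsupp.single (Multiplicative.ofAdd (-(k : ℤ) - 1)) x, ?_⟩
      rw [map_sub (genSubOne R M), sub_add_eq_add_sub, ← hc, genSubOne_single, ← ofAdd_add,
        add_sub_cancel, sub_sub_cancel]

variable {R} in
lemma mapRange_comp_eq_zero {P : Type*} [AddCommGroup P] [Module R P] {f : M →ₗ[R] N}
    {g : N →ₗ[R] P} (h : g ∘ₗ f = 0) (m : DeckGroup →₀ M) :
    Finsupp.mapRange.linearMap g (Finsupp.mapRange.linearMap f m) = 0 :=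
  Finsupp.ext fun z => LinearMap.congr_fun h (m z)

variable {R} in
lemma exists_mapRange_eq {P : Type*} [AddCommGroup P] [Module R P] {f : M →ₗ[R] N} {g : N →ₗ[R] P}
    (h : Function.Exact f g) {m : DeckGroup →₀ N}
    (hm : Finsupp.mapRange.linearMap (α := DeckGroup) g m = 0) :
    ∃ c, Finsupp.mapRange.linearMap (α := DeckGroup) f c = m := by
  have : m.sum Finsupp.single ∈
      LinearMap.range (Finsupp.mapRange.linearMap (α := DeckGroup) f) := by
    refine Submodule.sum_mem _ fun z _ => ?_
    obtain ⟨c, hc⟩ := (h (m z)).1 (DFunLike.congr_fun hm z)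
    exact ⟨Finsupp.single z c, by
      rw [Finsupp.mapRange.linearMap_apply, Finsupp.mapRange_single, hc]⟩
  rw [Finsupp.sum_single] at this
  exact this

end Augmentation

/-- The induced module `ℤ[Z] ⊗ M` consists of the finitely supported functions on `Z` with values
in `M`. -/
def inducedEquiv (M : Type u) [AddCommGroup M] [Module R M] :
    Induced M ≃ₗ[R] DeckGroup →₀ M :=
  TensorProduct.AlgebraTensorModule.congr (LinearEquiv.refl R M)
      (MonoidAlgebra.coeffLinearEquiv ℤ) ≪≫ₗ
    TensorProduct.finsuppScalarRight ℤ R M DeckGroup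

lemma inducedEquiv_tmul_single {M : Type u} [AddCommGroup M] [Module R M] (x : M) (z : DeckGroup)
    (k : ℤ) :
    inducedEquiv R M (x ⊗ₜ MonoidAlgebra.single z k) = Finsupp.single z (k • x) :=
  (TensorProduct.finsuppScalarRight_apply_tmul (S := R) x (Finsupp.single z k)).trans
    (Finsupp.sum_single_index (by rw [zero_smul, Finsupp.single_zero]))

lemma inducedEquiv_inducedAction {M : Type u} [AddCommGroup M] [Module R M] (z : DeckGroup)
    (x : Induced M) :
    inducedEquiv R M (inducedAction R M z x) = translate R M z (inducedEquiv R M x) := by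
  induction x using TensorProduct.induction_on with
  | zero => simp
  | add x y hx hy => simp only [map_add, hx, hy]
  | tmul x p =>
    induction p using MonoidAlgebra.induction_linear with
    | zero => simp
    | add p q hp hq => simp only [TensorProduct.tmul_add, map_add, hp, hq]
    | single y k =>
      have h : inducedAction R M z (x ⊗ₜ[ℤ] MonoidAlgebra.single y k) =
          x ⊗ₜ[ℤ] (MonoidAlgebra.of ℤ DeckGroup z * MonoidAlgebra.single y k) := rfl
      rw [h, MonoidAlgebra.of_apply, MonoidAlgebra.single_mul_single, one_mul,
        inducedEquiv_tmul_single, inducedEquiv_tmul_single, translate_single]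

end Induced

/-! ### The two exact sequences of a module with generators and relations -/

section Sequences

open FiniteSetComplex

variable {R : Type v} [Ring R]

lemma exists_comp_eq {M H N : Type*} [AddCommGroup M] [Module R M] [AddCommGroup H] [Module R H]
    [AddCommGroup N] [Module R N] {f : M →ₗ[R] H} (hf : Function.Surjective f) (g : M →ₗ[R] N)
    (h : ∀ m, f m = 0 → g m = 0) : ∃ g' : H →ₗ[R] N, ∀ m, g' (f m) = g m := by
  refine ⟨(LinearMap.ker f).liftQ g h ∘ₗ (f.quotKerEquivOfSurjective hf).symm.toLinearMap,
    fun m => ?_⟩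
  have : (f.quotKerEquivOfSurjective hf).symm (f m) = (LinearMap.ker f).mkQ m :=
    (LinearEquiv.symm_apply_eq _).2 rfl
  rw [LinearMap.comp_apply, LinearEquiv.coe_coe, this]
  exact Submodule.liftQ_apply _ _ _

/-- The `R[Z]`-module `H`, with action `ρ`, is the quotient by `Ψ` of the induced module `ℤ[Z] ⊗ M`
by the submodule `(z - 1) (ℤ[Z] ⊗ ker π)`, where `z` is the generator of `Z`. Here `ℤ[Z] ⊗ ker π` is
described as the kernel of the map from `ℤ[Z] ⊗ M` to `ℤ[Z] ⊗ Q` that is induced by `π`. -/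
structure IsPresentation {M Q H : Type*} [AddCommGroup M] [Module R M] [AddCommGroup Q] [Module R Q]
    [AddCommGroup H] [Module R H] (ρ : DeckGroup →* Module.End R H) (π : M →ₗ[R] Q)
    (Ψ : (DeckGroup →₀ M) →ₗ[R] H) : Prop where
  surjective : Function.Surjective Ψ
  map_eq_zero_iff : ∀ μ, Ψ μ = 0 ↔
    ∃ β, μ = genSubOne R M β ∧ Finsupp.mapRange.linearMap (α := DeckGroup) π β = 0
  map_translate : ∀ z μ, Ψ (translate R M z μ) = ρ z (Ψ μ)

variable {B M Q H : Type u} [AddCommGroup B] [Module R B] [AddCommGroup M] [Module R M]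
  [AddCommGroup Q] [Module R Q] [AddCommGroup H] [Module R H] {ρ : DeckGroup →* Module.End R H}
  {ι : B →ₗ[R] M} {π : M →ₗ[R] Q} {Ψ : (DeckGroup →₀ M) →ₗ[R] H}

/-- Modulo the relations, a function with values in `B` can be replaced by the sum of its values,
placed at `1`. -/
lemma IsPresentation.map_mapRange_eq (h : IsPresentation ρ π Ψ) (hιπ : Function.Exact ι π)
    (ν : DeckGroup →₀ B) :
    Ψ (Finsupp.mapRange.linearMap ι ν) = Ψ (Finsupp.single 1 (ι (sumValues R B ν))) := by
  obtain ⟨c, hc⟩ := exists_eq_genSubOne_add R ν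
  have h0 : Ψ (Finsupp.mapRange.linearMap ι (genSubOne R B c)) = 0 := by
    refine (h.map_eq_zero_iff _).2 ⟨_, mapRange_genSubOne R ι c, ?_⟩
    rw [mapRange_comp_eq_zero hιπ.linearMap_comp_eq_zero]
  conv_lhs => rw [hc, map_add, map_add, h0, zero_add, Finsupp.mapRange.linearMap_apply,
    Finsupp.mapRange_single]

/-- The kernel `B` of `π`, embedded as `1 ⊗ B`, is the module of fixed points of `H`, and the
quotient of `H` by `B` is induced from `Q`. -/
theorem IsPresentation.exists_trivial_induced (h : IsPresentation ρ π Ψ)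
    (hι : Function.Injective ι) (hιπ : Function.Exact ι π) (hπ : Function.Surjective π) :
    ∃ (i : B →ₗ[R] H) (p : H →ₗ[R] Induced Q),
      (∀ z b, ρ z (i b) = i b) ∧
      (∀ z x, p (ρ z x) = inducedAction R _ z (p x)) ∧
      Function.Injective i ∧ Function.Exact i p ∧ Function.Surjective p ∧
      Set.range i = {x | ∀ z, ρ z x = x} ∧
      (Module.Projective R Q → ∃ s : Induced Q →ₗ[R] H,
          (∀ z x, s (inducedAction R _ z x) = ρ z (s x)) ∧ p ∘ₗ s = LinearMap.id) := by
  obtain ⟨p, hp⟩ := exists_comp_eq h.surjective (Finsupp.mapRange.linearMap (α := DeckGroup) π) (by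
    intro μ hμ
    obtain ⟨β, rfl, hβ⟩ := (h.map_eq_zero_iff μ).1 hμ
    rw [mapRange_genSubOne, hβ, map_zero])
  let i : B →ₗ[R] H := Ψ ∘ₗ Finsupp.lsingle 1 ∘ₗ ι
  have hi (ν : DeckGroup →₀ B) : Ψ (Finsupp.mapRange.linearMap ι ν) = i (sumValues R B ν) :=
    h.map_mapRange_eq hιπ ν
  have hfix (z : DeckGroup) (b : B) : ρ z (i b) = i b := by
    have := hi (Finsupp.single z b)
    rw [sumValues_single, Finsupp.mapRange.linearMap_apply, Finsupp.mapRange_single] at this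
    refine Eq.trans ?_ this
    rw [← mul_one z, ← translate_single R, h.map_translate, mul_one]
    rfl
  have hpρ (z : DeckGroup) (x : H) : p (ρ z x) = translate R Q z (p x) := by
    obtain ⟨μ, rfl⟩ := h.surjective x
    rw [← h.map_translate, hp, hp, mapRange_translate]
  have hexact : Function.Exact i p := by
    intro x
    constructor
    · intro hx
      obtain ⟨μ, rfl⟩ := h.surjective x
      rw [hp] at hx
      obtain ⟨ν, rfl⟩ := exists_mapRange_eq hιπ hx
      exact ⟨_, (hi ν).symm⟩
    · rintro ⟨b, rfl⟩
      refine (hp _).trans ?_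
      rw [LinearMap.comp_apply, Finsupp.lsingle_apply, Finsupp.mapRange.linearMap_apply,
        Finsupp.mapRange_single, hιπ.apply_apply_eq_zero, Finsupp.single_zero]
  let e := inducedEquiv R Q
  have he (z : DeckGroup) (y : DeckGroup →₀ Q) :
      e.symm (translate R Q z y) = inducedAction R Q z (e.symm y) := by
    rw [LinearEquiv.symm_apply_eq, inducedEquiv_inducedAction, LinearEquiv.apply_symm_apply]
  refine ⟨i, e.symm.toLinearMap ∘ₗ p, hfix, fun z x => ?_, ?_, ?_, ?_, ?_, ?_⟩
  · rw [LinearMap.comp_apply, hpρ]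
    exact he _ _
  · rw [injective_iff_map_eq_zero]
    intro b hb
    obtain ⟨β, hβ, -⟩ := (h.map_eq_zero_iff _).1 hb
    have := congrArg (sumValues R M) hβ
    rw [sumValues_genSubOne, LinearMap.comp_apply, Finsupp.lsingle_apply, sumValues_single] at this
    exact hι (this.trans (map_zero ι).symm)
  · intro x
    rw [← hexact x]
    exact e.symm.map_eq_zero_iff
  · refine e.symm.surjective.comp fun y => ?_
    obtain ⟨μ, rfl⟩ := Finsupp.mapRange_surjective π (map_zero π) hπ y
    exact ⟨Ψ μ, hp μ⟩
  · ext x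
    constructor
    · rintro ⟨b, rfl⟩ z
      exact hfix z b
    · intro hx
      -- The image of a fixed point in the induced module is fixed, so it vanishes.
      refine (hexact x).1 (genSubOne_injective R ?_)
      rw [map_zero, genSubOne, LinearMap.sub_apply, ← hpρ, hx gen]
      exact sub_self _
  · intro _
    obtain ⟨σ, hσ⟩ := Module.projective_lifting_property π LinearMap.id hπ
    refine ⟨Ψ ∘ₗ Finsupp.mapRange.linearMap σ ∘ₗ e.toLinearMap, fun z x => ?_, ?_⟩
    · simp only [LinearMap.comp_apply, LinearEquiv.coe_coe]
      rw [inducedEquiv_inducedAction, mapRange_translate, h.map_translate]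
    · refine LinearMap.ext fun x => ?_
      simp only [LinearMap.comp_apply, LinearEquiv.coe_coe]
      rw [hp, ← LinearMap.comp_apply (Finsupp.mapRange.linearMap π),
        ← Finsupp.mapRange.linearMap_comp, hσ, Finsupp.mapRange.linearMap_id,
        LinearMap.id_apply, LinearEquiv.symm_apply_apply, LinearMap.id_apply]

/-- The sum of values identifies `M` with the module of coinvariants of `H`, and the kernel is
induced from `Q`, embedded by multiplication by `z - 1`. -/
theorem IsPresentation.exists_induced_coinvariants (h : IsPresentation ρ π Ψ)
    (hπ : Function.Surjective π) :
    ∃ (j : Induced Q →ₗ[R] H) (q : H →ₗ[R] M),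
      (∀ z x, j (inducedAction R _ z x) = ρ z (j x)) ∧
      (∀ z x, q (ρ z x) = q x) ∧
      Function.Injective j ∧ Function.Exact j q ∧ Function.Surjective q ∧
      LinearMap.ker q = Submodule.span R {y | ∃ z x, y = ρ z x - x} ∧
      ∃ s : M →ₗ[R] H, q ∘ₗ s = LinearMap.id := by
  have hπ' : Function.Surjective (Finsupp.mapRange.linearMap (α := DeckGroup) π) :=
    Finsupp.mapRange_surjective π (map_zero π) hπ
  obtain ⟨j, hj⟩ := exists_comp_eq hπ' (Ψ ∘ₗ genSubOne R M)
    (fun β hβ => (h.map_eq_zero_iff _).2 ⟨β, rfl, hβ⟩)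
  obtain ⟨q, hq⟩ := exists_comp_eq h.surjective (sumValues R M) (by
    intro μ hμ
    obtain ⟨β, rfl, -⟩ := (h.map_eq_zero_iff μ).1 hμ
    exact sumValues_genSubOne R β)
  have hqρ (z : DeckGroup) (x : H) : q (ρ z x) = q x := by
    obtain ⟨μ, rfl⟩ := h.surjective x
    rw [← h.map_translate, hq, hq, sumValues_translate]
  have hker {x : H} (hx : q x = 0) : ∃ c, x = Ψ (genSubOne R M c) := by
    obtain ⟨μ, rfl⟩ := h.surjective x
    rw [hq] at hx
    obtain ⟨c, hc⟩ := exists_eq_genSubOne_add R μ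
    rw [hx, Finsupp.single_zero, add_zero] at hc
    exact ⟨c, by rw [← hc]⟩
  have hexact : Function.Exact j q := by
    intro x
    constructor
    · intro hx
      obtain ⟨c, rfl⟩ := hker hx
      exact ⟨_, hj c⟩
    · rintro ⟨y, rfl⟩
      obtain ⟨β, rfl⟩ := hπ' y
      rw [hj, LinearMap.comp_apply, hq, sumValues_genSubOne]
  have hs (x : M) : q (Ψ (Finsupp.single 1 x)) = x := by rw [hq, sumValues_single]
  let e := inducedEquiv R Q
  refine ⟨j ∘ₗ e.toLinearMap, q, fun z x => ?_, hqρ, ?_, ?_, fun x => ⟨_, hs x⟩, ?_,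
    Ψ ∘ₗ Finsupp.lsingle 1, LinearMap.ext hs⟩
  · simp only [LinearMap.comp_apply, LinearEquiv.coe_coe]
    rw [inducedEquiv_inducedAction]
    obtain ⟨β, hβ⟩ := hπ' (inducedEquiv R Q x)
    rw [← hβ, ← mapRange_translate, hj, hj, LinearMap.comp_apply, LinearMap.comp_apply,
      genSubOne_translate, h.map_translate]
  · refine Function.Injective.comp (g := j) ?_ e.injective
    rw [injective_iff_map_eq_zero]
    intro y hy
    obtain ⟨β, rfl⟩ := hπ' y
    rw [hj] at hy
    obtain ⟨β', hβ, hβ'⟩ := (h.map_eq_zero_iff _).1 hy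
    rw [genSubOne_injective R hβ, hβ']
  · intro x
    rw [hexact x]
    constructor
    · rintro ⟨y, rfl⟩
      exact ⟨e.symm y, congrArg j (e.apply_symm_apply y)⟩
    · rintro ⟨y, rfl⟩
      exact ⟨e y, rfl⟩
  · refine le_antisymm (fun x hx => ?_) (Submodule.span_le.2 ?_)
    · obtain ⟨c, rfl⟩ := hker hx
      refine Submodule.subset_span ⟨gen, Ψ c, ?_⟩
      rw [← h.map_translate, ← map_sub]
      rfl
    · rintro _ ⟨z, x, rfl⟩
      rw [SetLike.mem_coe, LinearMap.mem_ker, map_sub, hqρ, sub_self]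

end Sequences

/-! ### The presentation of the homology of the cover -/

section Cover

open FiniteSetComplex

variable (R : Type v) [Ring R] (A : Type u) [AddCommGroup A] [Module R A]
variable {V : Type u} [LinearOrder V] (L : FiniteSetComplex V)

/-- The chain of tuples of vertices that corresponds to an augmented simplicial chain. -/
def vertexChain (n : ℕ) : AugChain L A n →ₗ[R] Tuple V →₀ A :=
  Finsupp.lmapDomain A R fun σ => ⟨n, vtx σ⟩

variable {A L} in
lemma vertexChain_single {n : ℕ} (σ : L.Simplex n) (a : A) :
    vertexChain R A L n (Finsupp.single σ a) = Finsupp.single ⟨n, vtx σ⟩ a :=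
  Finsupp.mapDomain_single

lemma vertexChain_injective (n : ℕ) : Function.Injective (vertexChain R A L n) := by
  refine Finsupp.mapDomain_injective fun σ τ h => Subtype.ext (Finset.ext fun v => ?_)
  have h' (i : Fin n) : vtx σ i = vtx τ i := congrFun (eq_of_heq (Sigma.mk.inj h).2) i
  constructor
  · intro hv
    obtain ⟨i, rfl⟩ := exists_vtx_eq σ hv
    exact h' i ▸ vtx_mem τ i
  · intro hv
    obtain ⟨i, rfl⟩ := exists_vtx_eq τ hv
    exact h' i ▸ vtx_mem σ i

lemma vertexChain_augBoundary (n : ℕ) (c : AugChain L A (n + 1)) :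
    vertexChain R A L n (augBoundary R L A n c) = tupleBd R (vertexChain R A L (n + 1) c) := by
  induction c using Finsupp.induction_linear with
  | zero => simp
  | add c d hc hd => simp only [map_add, hc, hd]
  | single σ a =>
    rw [augBoundary_single, vertexChain_single, tupleBd_single_succ, map_sum]
    refine Finset.sum_congr rfl fun i _ => ?_
    rw [map_zsmul, vertexChain_single]
    congr 3
    exact funext (vtx_faceAt σ i)

lemma augBoundaries_le_augCycles (n : ℕ) : augBoundaries R L A n ≤ augCycles R L A n := by
  rintro _ ⟨c, rfl⟩
  cases n with
  | zero => trivial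
  | succ n =>
    refine LinearMap.mem_ker.2 (vertexChain_injective R A L n ?_)
    rw [vertexChain_augBoundary, vertexChain_augBoundary, tupleBd_tupleBd, map_zero]

/-- The element of the singular chain complex of the cover that corresponds to a cellular cycle. -/
def cycleChain (n : ℕ) :
    (DeckGroup →₀ augCycles R L A n) →ₗ[R] (singComplex R A (TopCat.of L.Cover)).X n :=
  fromSing R n ∘ₗ indToSing R n ∘ₗ Finsupp.mapRange.linearMap (augCycles R L A n).subtype

variable {A L}

lemma toSing_cycleChain {n : ℕ} (μ : DeckGroup →₀ augCycles R L A n) :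
    toSing R n (cycleChain R A L n μ) =
      indToSing R n (Finsupp.mapRange.linearMap (augCycles R L A n).subtype μ) :=
  toSing_fromSing R (indToSing_mem R n _)

lemma d_cycleChain {n : ℕ} (μ : DeckGroup →₀ augCycles R L A n) :
    (singComplex R A (TopCat.of L.Cover)).d n ((ComplexShape.down ℕ).next n)
      (cycleChain R A L n μ) = 0 := by
  rw [d_next_eq_zero_iff, toSing_cycleChain]
  cases n with
  | zero => exact bd_indToSing_zero R _
  | succ n =>
    have h : augBoundary R L A n ∘ₗ (augCycles R L A (n + 1)).subtype = 0 :=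
      LinearMap.ext fun x => x.2
    rw [bd_indToSing, mapRange_comp_eq_zero h, map_zero, map_zero]

variable (A L) in
/-- The homology classes of the cover that are represented by cellular cycles. -/
def cycleClass (n : ℕ) :
    (DeckGroup →₀ augCycles R L A n) →ₗ[R] (singComplex R A (TopCat.of L.Cover)).homology n :=
  homologyLift (M := DeckGroup →₀ augCycles R L A n) _ (cycleChain R A L n)
    (fun μ => d_cycleChain R μ)

/-- The coefficients of a cellular cycle are cycles of `L`, since multiplication by `z - 1` is
injective. -/
lemma exists_mapRange_subtype_eq {n : ℕ} {m : DeckGroup →₀ AugChain L A n}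
    (h : cellBd R (toCell R n m) = 0) :
    ∃ μ, Finsupp.mapRange.linearMap (augCycles R L A n).subtype μ = m := by
  cases n with
  | zero =>
    refine Finsupp.mapRange_surjective _ (map_zero (augCycles R L A 0).subtype)
      (fun x => ⟨⟨x, trivial⟩, rfl⟩) m
  | succ n =>
    rw [cellBd_toCell, map_eq_zero_iff _ (toCell_injective R n),
      map_eq_zero_iff _ (genSubOne_injective R)] at h
    exact exists_mapRange_eq (LinearMap.exact_subtype_ker_map (augBoundary R L A n)) h

lemma cycleClass_surjective (n : ℕ) : Function.Surjective (cycleClass R A L n) := by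
  refine homologyLift_surjective (M := DeckGroup →₀ augCycles R L A n)
    (singComplex R A (TopCat.of L.Cover)) (cycleChain R A L n)
    (fun μ => d_cycleChain R μ) ?_
  intro x hx
  rw [d_next_eq_zero_iff] at hx
  obtain ⟨m, w, h0, hw, h⟩ := exists_eq_indToSing_add_bd R (toSing_mem R x) hx
  obtain ⟨μ, rfl⟩ := exists_mapRange_subtype_eq R h0
  refine ⟨μ, fromSing R (n + 1) w, toSing_injective R n ?_⟩
  rw [h, map_add, toSing_cycleChain, ← bd_toSing, toSing_fromSing R hw]

lemma cycleClass_eq_zero_iff {n : ℕ} (μ : DeckGroup →₀ augCycles R L A n) :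
    cycleClass R A L n μ = 0 ↔ ∃ m : DeckGroup →₀ AugChain L A (n + 1),
      Finsupp.mapRange.linearMap (augCycles R L A n).subtype μ =
        genSubOne R _ (Finsupp.mapRange.linearMap (augBoundary R L A n) m) := by
  refine (homologyLift_eq_zero_iff (M := DeckGroup →₀ augCycles R L A n) _ (cycleChain R A L n)
    (fun μ => d_cycleChain R μ) μ).trans ⟨?_, ?_⟩
  · rintro ⟨y, hy⟩
    have h := congrArg (toSing R n) hy
    rw [toSing_cycleChain, ← bd_toSing] at h
    exact exists_eq_of_indToSing_eq_bd R h
  · rintro ⟨m, hm⟩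
    refine ⟨fromSing R (n + 1) (indToSing R (n + 1) m), toSing_injective R n ?_⟩
    rw [toSing_cycleChain, ← bd_toSing, toSing_fromSing R (indToSing_mem R _ _), bd_indToSing, hm]

lemma homologyMap_cycleClass (z : DeckGroup) {n : ℕ} (μ : DeckGroup →₀ augCycles R L A n) :
    HomologicalComplex.homologyMap
      (SSet.chainComplexMap (TopCat.toSSet.map (TopCat.ofHom (L.deckMap z))) (ModuleCat.of R A)) n
      (cycleClass R A L n μ) = cycleClass R A L n (translate R _ z μ) := by
  have h : (SSet.chainComplexMap (TopCat.toSSet.map (TopCat.ofHom (L.deckMap z)))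
      (ModuleCat.of R A)).f n (cycleChain R A L n μ) = cycleChain R A L n (translate R _ z μ) := by
    refine toSing_injective R n ((toSing_map R (TopCat.ofHom (L.deckMap z)) _).trans ?_)
    rw [toSing_cycleChain, toSing_cycleChain, mapRange_translate]
    exact push_deckMap_indToSing R z _
  have key := homologyMap_homologyLift (M := DeckGroup →₀ augCycles R L A n)
    (M' := DeckGroup →₀ augCycles R L A n) (singComplex R A (TopCat.of L.Cover))
    (L := singComplex R A (TopCat.of L.Cover)) (cycleChain R A L n) (fun μ => d_cycleChain R μ)
    (SSet.chainComplexMap (TopCat.toSSet.map (TopCat.ofHom (L.deckMap z))) (ModuleCat.of R A))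
    (cycleChain R A L n) (fun μ => d_cycleChain R μ) μ (translate R _ z μ) h
  exact key

/-- The homology of the cover is the quotient of `ℤ[Z] ⊗ Z⁺` by `(z - 1) (ℤ[Z] ⊗ B⁺)`. -/
theorem cycleClass_isPresentation (n : ℕ) :
    IsPresentation (H := CoverHomology R L A n) (deckAction R L A n)
      ((augBoundaries R L A n).submoduleOf (augCycles R L A n)).mkQ (cycleClass R A L n) where
  surjective := cycleClass_surjective R n
  map_eq_zero_iff μ := by
    have hinj : Function.Injective
        (Finsupp.mapRange.linearMap (α := DeckGroup) (augCycles R L A n).subtype) :=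
      Finsupp.mapRange_injective _ (map_zero (augCycles R L A n).subtype) Subtype.val_injective
    let f : AugChain L A (n + 1) →ₗ[R] augCycles R L A n :=
      (augBoundary R L A n).codRestrict _
        fun c => augBoundaries_le_augCycles R A L n (LinearMap.mem_range_self _ c)
    have hf : (augCycles R L A n).subtype ∘ₗ f = augBoundary R L A n := rfl
    have hexact : Function.Exact f
        ((augBoundaries R L A n).submoduleOf (augCycles R L A n)).mkQ := by
      intro x
      rw [Submodule.mkQ_apply, Submodule.Quotient.mk_eq_zero]
      constructor
      · rintro ⟨c, hc⟩
        exact ⟨c, Subtype.ext hc⟩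
      · rintro ⟨c, rfl⟩
        exact ⟨c, rfl⟩
    have hcomp (m : DeckGroup →₀ AugChain L A (n + 1)) :
        Finsupp.mapRange.linearMap (augCycles R L A n).subtype
          (genSubOne R _ (Finsupp.mapRange.linearMap f m)) =
        genSubOne R _ (Finsupp.mapRange.linearMap (augBoundary R L A n) m) := by
      rw [mapRange_genSubOne, ← hf, Finsupp.mapRange.linearMap_comp, LinearMap.comp_apply]
    refine (cycleClass_eq_zero_iff R μ).trans ⟨?_, ?_⟩
    · rintro ⟨m, hm⟩
      refine ⟨Finsupp.mapRange.linearMap f m, hinj (by rw [hm, hcomp]), ?_⟩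
      rw [mapRange_comp_eq_zero hexact.linearMap_comp_eq_zero]
    · rintro ⟨β, rfl, hβ⟩
      obtain ⟨m, rfl⟩ := exists_mapRange_eq hexact hβ
      exact ⟨m, hcomp m⟩
  map_translate z μ := (homologyMap_cycleClass R z μ).symm

end Cover

end TorusCover

end

/-- `Z` acts trivially on the cycles and boundaries of `L`.  Maps of modules over the group ring
`R[Z]` are the `R`-linear maps that commute with the actions of `Z`. -/
theorem mainTheorem3 {V : Type u} [LinearOrder V] (L : FiniteSetComplex V)
    (R : Type v) [Ring R] (A : Type u) [AddCommGroup A] [Module R A] (n : ℕ) :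
    (∃ (i : L.augBoundaries R A n →ₗ[R] L.CoverHomology R A n)
        (p : L.CoverHomology R A n →ₗ[R]
          FiniteSetComplex.Induced (L.ReducedHomology R A n)),
      (∀ z b, L.deckAction R A n z (i b) = i b) ∧
      (∀ z h, p (L.deckAction R A n z h) = FiniteSetComplex.inducedAction R _ z (p h)) ∧
      Function.Injective i ∧ Function.Exact i p ∧ Function.Surjective p ∧
      Set.range i = {h | ∀ z, L.deckAction R A n z h = h} ∧
      (Module.Projective R (L.ReducedHomology R A n) →
        ∃ s : FiniteSetComplex.Induced (L.ReducedHomology R A n) →ₗ[R]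
            L.CoverHomology R A n,
          (∀ z x, s (FiniteSetComplex.inducedAction R _ z x) = L.deckAction R A n z (s x)) ∧
          p ∘ₗ s = LinearMap.id)) ∧
    (∃ (j : FiniteSetComplex.Induced (L.ReducedHomology R A n) →ₗ[R] L.CoverHomology R A n)
        (q : L.CoverHomology R A n →ₗ[R] L.augCycles R A n),
      (∀ z x, j (FiniteSetComplex.inducedAction R _ z x) = L.deckAction R A n z (j x)) ∧
      (∀ z h, q (L.deckAction R A n z h) = q h) ∧
      Function.Injective j ∧ Function.Exact j q ∧ Function.Surjective q ∧
      LinearMap.ker q =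
        Submodule.span R {x | ∃ z h, x = L.deckAction R A n z h - h} ∧
      ∃ s : L.augCycles R A n →ₗ[R] L.CoverHomology R A n, q ∘ₗ s = LinearMap.id) :=
  have h := TorusCover.cycleClass_isPresentation R (A := A) (L := L) n
  have hle := TorusCover.augBoundaries_le_augCycles R A L n
  have hexact : Function.Exact (Submodule.inclusion hle)
      ((L.augBoundaries R A n).submoduleOf (L.augCycles R A n)).mkQ := fun x => by
    rw [Submodule.mkQ_apply, Submodule.Quotient.mk_eq_zero]
    exact ⟨fun hx => ⟨⟨x.1, hx⟩, rfl⟩, by rintro ⟨y, rfl⟩; exact y.2⟩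
  have hsurj := Submodule.mkQ_surjective
    ((L.augBoundaries R A n).submoduleOf (L.augCycles R A n))
  ⟨h.exists_trivial_induced (Submodule.inclusion_injective hle) hexact hsurj,
    h.exists_induced_coinvariants hsurj⟩
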